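/- **Conventions.** A graded poset is a finite poset with minimum $\hat 0$, maximum $\hat 1$ and a rank function $\rho$ with $\rho(\hat 0)=0$ and $\rho(y)=\rho(x)+1$ whenever $y$ covers $x$; its rank is $\rho(\hat 1)$. It is Eulerian if $\mu([x,y])=(-1)^{\rho(y)-\rho(x)}$ for every interval $[x,y]$. For $P$ of rank $n+1$ and $S\subseteq[1,n]=\{1,\dots,n\}$, $f_S(P)$ is the number of chains of $P$ with rank set $S$, and $(f_S(P))_{S\subseteq[1,n]}\in\mathbb R^{2^n}$ is the flag vector. $\mathcal C^{n+1}_{\mathcal E}\subset\mathbb R^{2^n}$ is the smallest closed convex cone containing the flag vectors of all Eulerian posets of rank $n+1$. An extreme ray of a cone $C$ is a face of $C$ of the form $\mathbb R_{\ge0}v$ with $v\ne0$; a facet of $C$ is a face of dimension $\dim C-1$. A facet $F$ is given by the linear inequality $\varphi\ge0$ if $\varphi\ge 0$ on $C$ and $F=\{v\in C:\varphi(v)=0\}$. Put $$L_S=(-1)^{n-|S|}\sum_{[1,n]\setminus S\subseteq T\subseteq[1,n]}\left(-\tfrac12\right)^{|T|}f_T .$$ *Operators.* For an interval $I\subseteq[1,n]$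 and $k\ge1$, $D_I^k(P)$ is obtained from $P$ (of rank $n+1$) by replacing each $x$ with $\rho(x)\in I$ by $k$ copies $x_1,\dots,x_k$; for $x<y$ in $P$, all copies are comparable if at most one of $\rho(x),\rho(y)$ is in $I$, and $x_i<y_j$ iff $i=j$ if both are in $I$. The horizontal double $DP$ results from applying $D^2_{[i,i]}$ for all $i\in[1,n]$. $P$ is half-Eulerian if $DP$ is Eulerian. *Limit posets.* An interval system $\mathcal I$ on $[1,n]$ is a set of nonempty subintervals of $[1,n]$, none contained in another; it is even if $|I\cap J|$ is even for all $I,J\in\mathcal I$ (including $I=J$). $P(n,\mathcal I,N)$ is the result of applying $D_I^N$ for all $I\in\mathcal I$ to a chain of rank $n+1$. The flag vector of the doubled limit poset $DP(n,\mathcal I)$ is the limit, as $N\to\infty$, of $N^{-|\mathcal I|}$ times the flag vector of $DP(n,\mathcal I,N)$. *Glued posets.* Let $C^7$ be the chain of rank 7. For $N\ge1$ let - $Q_1(N)$ be $D^N_{[1,2]}D^N_{[2,6]}(C^7)$ and $D^N_{[1,5]}D^N_{[5,6]}(C^7)$, identified at ranks $1,6$; - $Q_2(N)$ be $D^N_{[1,3]}D^N_{[3,4]}D^N_{[4,6]}(C^7)$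 and $D^N_{[1,2]}D^N_{[2,4]}D^N_{[2,6]}(C^7)$, identified at ranks $1,4,5,6$, together with $D^N_{[1,5]}D^N_{[3,5]}D^N_{[5,6]}(C^7)$, identified with the first at ranks $1,2,3,6$; - $Q_3(N)$ be $D^{N+1}_{[1,2]}D^{N+1}_{[3,4]}D^{N}_{[3,6]}D^{N+1}_{[4,5]}(C^7)$ and $D^{N+1}_{[1,5]}D^{N^2}_{[3,5]}D^{N}_{[5,6]}(C^7)$, identified at ranks $1,2,6$, together with $D^{N+2}_{[1,2]}D^{N^2-N+2}_{[2,5]}D^{N}_{[1,6]}(C^7)$, identified with the first at rank $6$; - $Q_4(N)$ be the dual of $Q_3(N)$. (At the ranks $0$ and $7$ all pieces are identified. Elements are identified when they have the same copy numbers, where the operators of two pieces acting at a common identified rank are matched as follows: in $Q_1$, $[1,2]$ with $[1,5]$ and $[2,6]$ with $[5,6]$; in $Q_2$, $[1,3],[3,4],[4,6]$ with $[1,2],[2,4],[2,6]$ and with $[1,5],[3,5],[5,6]$, respectively; in $Q_3$, $[1,2],[3,6]$ with $[1,5],[5,6]$, and $[3,6]$ with $[1,6]$; dually in $Q_4$.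 The order is the union of the orders of the pieces.) Put $(e_1,e_2,e_3,e_4)=(2,3,4,4)$. **Theorem.** For every interval system $\mathcal I$ on $[1,6]$ the flag vector of $DP(6,\mathcal I)$ exists, i.e. the limit exists. The posets $Q_m(N)$ are half-Eulerian of rank $7$ for all $m\in\{1,2,3,4\}$ and $N\ge1$, and $N^{-e_m}$ times the flag vector of $DQ_m(N)$ converges as $N\to\infty$ to a vector $w_m$. Here $w_m$ is the sum of the flag vectors of the doubled limit posets $DP(6,\mathcal I)$ over the following interval systems: - $m=1$: $\{[1,2],[2,6]\}$, $\{[2,5],[5,6]\}$; - $m=2$: $\{[1,3],[3,4],[4,6]\}$, $\{[1,2],[2,3]\}$, $\{[4,5],[5,6]\}$; - $m=3$: $\{[1,2],[3,4],[4,5]\}$, $\{[3,5],[5,6]\}$, $\{[1,2],[2,5]\}$; - $m=4$: $\{[1,2],[2,4]\}$, $\{[2,5],[5,6]\}$, $\{[2,3],[3,4],[5,6]\}$. (i) The cone $\mathcal C^7_{\mathcal E}$ is finitely generated and has exactly 24 extreme rays: the 20 distinct rays generated by the flag vectors of $DP(6,\mathcal I)$ for the even interval systems $\mathcal I$ on $[1,6]$,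 and the 4 distinct rays generated by $w_1,w_2,w_3,w_4$. (ii) The cone $\mathcal C^7_{\mathcal E}$ has exactly 23 facets ($n=6$ below): - Exactly 15 facets are given by the inequalities $(-1)^{|M|/2}\sum_{M\subseteq Q\subseteq V}L_Q\ge0$, where $M\subseteq V\subseteq[1,n]$ satisfy: every maximal interval of $V$ has at least 2 elements; every maximal interval of $[0,n+1]\setminus V$ has at most 3 elements; and for every maximal interval $[a,b]$ of $V$, $M\cap[a,b]\in\{\emptyset,[a,a+1],[b-1,b]\}$, if $a\notin M$ then $a-2\in\{-1\}\cup M$, and if $b\notin M$ then $b+2\in\{n+2\}\cup M$. Every such inequality gives a facet. - Exactly 4 further facets are given by the inequalities $\sum_{R\subseteq T}(-2)^{|T\setminus R|}f_{S\cup R}\ge0$, where $T\subseteq V\subseteq[1,n]$, $S=[1,n]\setminus V$ and $|I\cap T|\le1$ for every maximal interval $I$ of $V$. - The remaining 4 facets are given by the inequalities $f_{\{i,k\}}-2f_{\{i\}}-2f_{\{k\}}+2f_{\{j\}}\ge0$ with $1\le i<j<k\le n$; exactly these 4 facets arise from inequalities of this kind. -/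

import Mathlib

open Filter Topology

/-! ### Graded posets, Eulerian posets, flag vectors -/

/-- A graded poset: finite, with minimum `⊥` and maximum `⊤`, and with a rank function
`grade ℕ` that vanishes at `⊥` and increases by exactly one along covering relations. -/
structure GradedPoset where
  carrier : Type
  [partialOrder : PartialOrder carrier]
  [boundedOrder : BoundedOrder carrier]
  [finite : Finite carrier]
  [gradeMinOrder : GradeMinOrder ℕ carrier]

namespace GradedPoset

instance : CoeSort GradedPoset Type := ⟨carrier⟩

attribute [instance] partialOrder boundedOrder finite gradeMinOrder

/-- The rank of the graded poset, i.e. the rank of its maximum. -/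
def totalRank (P : GradedPoset) : ℕ := grade ℕ (⊤ : P)

open Classical in
/-- `P` is Eulerian if the Möbius function of every interval `[x, y]` is
`(-1) ^ (rank y - rank x)`. -/
def IsEulerian (P : GradedPoset) : Prop :=
  letI : Fintype P := Fintype.ofFinite P
  letI : LocallyFiniteOrder P := Fintype.toLocallyFiniteOrder
  ∀ x y : P, x ≤ y → IncidenceAlgebra.mu ℤ x y = (-1) ^ (grade ℕ y - grade ℕ x)

/-- `f_S(P)`: the number of chains of `P` whose set of ranks is `S`. -/
noncomputable def flagNumber (P : GradedPoset) (S : Finset ℕ) : ℕ :=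
  {C : Set P | IsChain (· ≤ ·) C ∧ (grade ℕ) '' C = (S : Set ℕ)}.ncard

/-- Build a graded poset from a poset with bounds and a strictly monotone rank function that
starts at `0` and does not jump over covering relations. -/
def ofRank (α : Type) [PartialOrder α] [BoundedOrder α] [Finite α] (r : α → ℕ)
    (h0 : r ⊥ = 0) (hmono : StrictMono r) (hcov : ∀ x y : α, x ⋖ y → r y = r x + 1) :
    GradedPoset :=
  { carrier := α
    gradeMinOrder :=
      { grade := r
        grade_strictMono := hmono
        covBy_grade := fun x y h => by
          rw [hcov x y h]; exact Order.covBy_add_one _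
        isMin_grade := fun a ha => by
          have : a = ⊥ := isMin_iff_eq_bot.mp ha
          rw [this, h0]; exact isMin_bot } }

lemma exists_between (P : GradedPoset) {x y : P} (h : x < y)
    (hr : grade ℕ y ≠ grade ℕ x + 1) : ∃ z, x < z ∧ z < y := by
  by_contra hc
  push Not at hc
  have hcov : x ⋖ y := ⟨h, fun z hxz hzy => hc z hxz hzy⟩
  exact hr (Order.covBy_iff_add_one_eq.mp (hcov.grade ℕ)).symm

/-! ### Replacing elements by copies, horizontal doubles -/

/-- The element `x` of `P` is replicated by the interval `[J.1, J.2]` of ranks. The minimum and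
the maximum are never replicated; this is automatic if `[J.1, J.2] ⊆ [1, totalRank - 1]`. -/
def Replicated (P : GradedPoset) (J : ℕ × ℕ) (x : P) : Prop :=
  J.1 ≤ grade ℕ x ∧ grade ℕ x ≤ J.2 ∧ x ≠ ⊥ ∧ x ≠ ⊤

lemma Replicated.of_between {P : GradedPoset} {J : ℕ × ℕ} {x y z : P}
    (hx : P.Replicated J x) (hz : P.Replicated J z) (hxy : x ≤ y) (hyz : y ≤ z) :
    P.Replicated J y := by
  refine ⟨hx.1.trans (grade_mono hxy), (grade_mono hyz).trans hz.2.1, ?_, ?_⟩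
  · rintro rfl; exact hx.2.2.1 (le_bot_iff.mp hxy)
  · rintro rfl; exact hz.2.2.2 (top_le_iff.mp hyz)

/-- The elements of `P.replicate I k`: an element `x` of `P` with a copy number
`c j ∈ {0, …, k j - 1}` for every `j` such that `I j` replicates `x` (and `c j = 0` for the
other `j`). -/
def Copies (P : GradedPoset) {ι : Type} (I : ι → ℕ × ℕ) (k : ι → ℕ+) : Type :=
  {z : P × (ι → ℕ) // ∀ j, (P.Replicated (I j) z.1 → z.2 j < k j) ∧
    (¬ P.Replicated (I j) z.1 → z.2 j = 0)}

namespace Copies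

variable {P : GradedPoset} {ι : Type} {I : ι → ℕ × ℕ} {k : ι → ℕ+}

/-- A copy of `x` lies below a copy of `y` iff `x ≤ y` and the copy numbers agree for every
interval containing the ranks of both `x` and `y`. -/
instance : PartialOrder (Copies P I k) where
  le z w := z.1.1 ≤ w.1.1 ∧
    ∀ j, P.Replicated (I j) z.1.1 → P.Replicated (I j) w.1.1 → z.1.2 j = w.1.2 j
  le_refl z := ⟨le_rfl, fun _ _ _ => rfl⟩
  le_trans a b c hab hbc := ⟨hab.1.trans hbc.1, fun j ha hc => by
    have hb := ha.of_between hc hab.1 hbc.1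
    exact (hab.2 j ha hb).trans (hbc.2 j hb hc)⟩
  le_antisymm a b hab hba := by
    have h1 : a.1.1 = b.1.1 := le_antisymm hab.1 hba.1
    apply Subtype.ext
    refine Prod.ext h1 (funext fun j => ?_)
    by_cases h : P.Replicated (I j) a.1.1
    · exact hab.2 j h (h1 ▸ h)
    · rw [(a.2 j).2 h, (b.2 j).2 (h1 ▸ h)]

lemma le_def {z w : Copies P I k} : z ≤ w ↔ z.1.1 ≤ w.1.1 ∧
    ∀ j, P.Replicated (I j) z.1.1 → P.Replicated (I j) w.1.1 → z.1.2 j = w.1.2 j := Iff.rfl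

instance : BoundedOrder (Copies P I k) where
  bot := ⟨(⊥, fun _ => 0), fun _ => ⟨fun h => (h.2.2.1 rfl).elim, fun _ => rfl⟩⟩
  top := ⟨(⊤, fun _ => 0), fun _ => ⟨fun h => (h.2.2.2 rfl).elim, fun _ => rfl⟩⟩
  bot_le _ := ⟨bot_le, fun _ h _ => (h.2.2.1 rfl).elim⟩
  le_top _ := ⟨le_top, fun _ _ h => (h.2.2.2 rfl).elim⟩

instance [Finite ι] : Finite (Copies P I k) := by
  have hlt : ∀ (z : Copies P I k) (j : ι), z.1.2 j < k j := fun z j => by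
    by_cases h : P.Replicated (I j) z.1.1
    · exact (z.2 j).1 h
    · rw [(z.2 j).2 h]; exact (k j).pos
  let f : Copies P I k → P × ((j : ι) → Fin (k j)) := fun z => (z.1.1, fun j => ⟨z.1.2 j, hlt z j⟩)
  refine Finite.of_injective f fun a b hab => ?_
  apply Subtype.ext
  refine Prod.ext (congrArg (fun p => p.1) hab) (funext fun j => ?_)
  exact congrArg (fun p => (p.2 j : ℕ)) hab

lemma lt_fst {z w : Copies P I k} (h : z < w) : z.1.1 < w.1.1 := by
  refine lt_of_le_of_ne h.le.1 fun he => h.not_ge ?_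
  exact ⟨he.ge, fun j hw hz => (h.le.2 j hz hw).symm⟩

lemma grade_of_covBy {z w : Copies P I k} (h : z ⋖ w) :
    grade ℕ w.1.1 = grade ℕ z.1.1 + 1 := by
  classical
  by_contra hne
  obtain ⟨u, hzu, huw⟩ := P.exists_between (lt_fst h.1) hne
  let c : ι → ℕ := fun j => if P.Replicated (I j) u then
    (if P.Replicated (I j) z.1.1 then z.1.2 j else
      if P.Replicated (I j) w.1.1 then w.1.2 j else 0) else 0
  let v : Copies P I k := ⟨(u, c), fun j => by
    refine ⟨fun hu => ?_, fun hu => by simp only [c, if_neg hu]⟩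
    simp only [c]
    rw [if_pos hu]
    split_ifs with h1 h2
    · exact (z.2 j).1 h1
    · exact (w.2 j).1 h2
    · exact (k j).pos⟩
  have hzv : z ≤ v := ⟨hzu.le, fun j hz hu => by
    change z.1.2 j = c j
    simp only [c]; rw [if_pos hu, if_pos hz]⟩
  have hvw : v ≤ w := ⟨huw.le, fun j hu hw => by
    change c j = w.1.2 j
    simp only [c]; rw [if_pos hu, if_pos hw]
    split_ifs with hz
    · exact h.1.le.2 j hz hw
    · rfl⟩
  have hzv' : z < v := lt_of_le_of_ne hzv fun he => hzu.ne (congrArg (fun t => t.1.1) he)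
  have hvw' : v < w := lt_of_le_of_ne hvw fun he => huw.ne (congrArg (fun t => t.1.1) he)
  exact h.2 hzv' hvw'

end Copies

/-- The graded poset obtained from `P` by applying, for all `j`, the operators which replace
every element with rank in the interval `[(I j).1, (I j).2]` by `k j` copies, where copies of
`x < y` are comparable iff their copy numbers agree for every `j` such that both ranks are in
the interval `I j`. (The result does not depend on the order of these operators.) -/
def replicate (P : GradedPoset) {ι : Type} [Finite ι] (I : ι → ℕ × ℕ) (k : ι → ℕ+) :
    GradedPoset :=
  ofRank (Copies P I k) (fun z => grade ℕ z.1.1) (grade_bot (𝕆 := ℕ) (α := P))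
    (fun _ _ h => grade_strictMono (Copies.lt_fst h)) (fun _ _ h => Copies.grade_of_covBy h)

/-- The horizontal double: every element other than `⊥`, `⊤` is replaced by two copies, and
copies of `x < y` are always comparable; that is, the operators above for the intervals
`[1, 1], …, [n, n]` with two copies each, if `P` has rank `n + 1`. -/
def double (P : GradedPoset) : GradedPoset :=
  P.replicate (fun i : Fin (P.totalRank - 1) => ((i : ℕ) + 1, (i : ℕ) + 1)) (fun _ => 2)

/-- A graded poset is half-Eulerian if its horizontal double is Eulerian. -/
def IsHalfEulerian (P : GradedPoset) : Prop := P.double.IsEulerian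

/-- The chain of rank `n + 1`. -/
def chain (n : ℕ) : GradedPoset :=
  ofRank (Fin (n + 2)) (fun i => (i : ℕ)) rfl (fun _ _ h => h) (fun i j h => by
    have := (Fin.covBy_iff).mp h
    exact (Order.covBy_iff_add_one_eq.mp this).symm)

end GradedPoset

/-! ### Interval systems and limit posets -/

/-- `𝓘` is an interval system on `[1, n]`: an antichain of (nonempty) subintervals of `[1, n]`,
where `[a, b]` is encoded by the pair `(a, b)`. -/
def IsIntervalSystem (n : ℕ) (𝓘 : Finset (ℕ × ℕ)) : Prop :=
  (∀ I ∈ 𝓘, 1 ≤ I.1 ∧ I.1 ≤ I.2 ∧ I.2 ≤ n) ∧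
  ∀ I ∈ 𝓘, ∀ J ∈ 𝓘, Finset.Icc I.1 I.2 ⊆ Finset.Icc J.1 J.2 → I = J

/-- An interval system is even if any two of its members (equal or not) meet in an even number
of elements. -/
def IsEvenIntervalSystem (n : ℕ) (𝓘 : Finset (ℕ × ℕ)) : Prop :=
  IsIntervalSystem n 𝓘 ∧
  ∀ I ∈ 𝓘, ∀ J ∈ 𝓘, Even (Finset.Icc I.1 I.2 ∩ Finset.Icc J.1 J.2).card

/-- The poset `P(n, 𝓘, N)`. -/
def intervalPoset (n : ℕ) (𝓘 : Finset (ℕ × ℕ)) (N : ℕ+) : GradedPoset :=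
  (GradedPoset.chain n).replicate (fun I : 𝓘 => (I : ℕ × ℕ)) (fun _ => N)

/-- The subsets `S` of `[1, n]`. -/
abbrev RankSet (n : ℕ) : Type := {S : Finset ℕ // S ∈ (Finset.Icc 1 n).powerset}

/-- The space `ℝ^(2^n)` with coordinates indexed by the subsets of `[1, n]`. -/
abbrev FlagSpace (n : ℕ) : Type := RankSet n → ℝ

/-- The flag vector of a graded poset of rank `n + 1`. -/
noncomputable def flagVector (n : ℕ) (P : GradedPoset) : FlagSpace n :=
  fun S => (P.flagNumber S : ℝ)

/-- `v` is the flag vector of the doubled limit poset `D P(n, 𝓘)`: the limit of the flag vectors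
of the horizontal doubles of `P(n, 𝓘, N)`, divided by `N ^ |𝓘|`. -/
def IsDoubledLimitFlagVector (n : ℕ) (𝓘 : Finset (ℕ × ℕ)) (v : FlagSpace n) : Prop :=
  Tendsto (fun N : ℕ+ => (((N : ℕ) : ℝ) ^ 𝓘.card)⁻¹ • flagVector n (intervalPoset n 𝓘 N).double)
    atTop (𝓝 v)

/-! ### The cone, its extreme rays and facets -/

/-- The closed cone of flag vectors of Eulerian posets of rank `n + 1`: the smallest closed convex
cone containing all these vectors. -/
noncomputable def eulerianCone (n : ℕ) : PointedCone ℝ (FlagSpace n) :=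
  PointedCone.closure (PointedCone.hull ℝ
    {v | ∃ P : GradedPoset, P.IsEulerian ∧ P.totalRank = n + 1 ∧ v = flagVector n P})

/-- The ray generated by a vector. -/
noncomputable def ray {n : ℕ} (v : FlagSpace n) : PointedCone ℝ (FlagSpace n) :=
  PointedCone.hull ℝ {v}

/-- An extreme ray of `C`: a face that is the ray generated by a nonzero vector. -/
def IsExtremeRay {n : ℕ} (C R : PointedCone ℝ (FlagSpace n)) : Prop :=
  R.IsFaceOf C ∧ ∃ v : FlagSpace n, v ≠ 0 ∧ R = ray v

/-- A facet of `C`: a face of dimension one less than the dimension of `C`. -/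
def IsFacet {n : ℕ} (C F : PointedCone ℝ (FlagSpace n)) : Prop :=
  F.IsFaceOf C ∧
  Module.finrank ℝ (Submodule.span ℝ (F : Set (FlagSpace n))) + 1 =
    Module.finrank ℝ (Submodule.span ℝ (C : Set (FlagSpace n)))

/-- `F` is the facet of `C` given by the inequality `φ ≥ 0`: the inequality is valid on `C`, and
`F` is a facet and consists of the points of `C` where equality holds. -/
def IsFacetGivenBy {n : ℕ} (C F : PointedCone ℝ (FlagSpace n)) (φ : FlagSpace n → ℝ) : Prop :=
  IsFacet C F ∧ (∀ v ∈ C, 0 ≤ φ v) ∧ (F : Set (FlagSpace n)) = {v | v ∈ C ∧ φ v = 0}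

/-! ### The inequalities -/

/-- The coordinate `f_S` of a vector (for `S ⊆ [1, n]`). -/
noncomputable def coord {n : ℕ} (v : FlagSpace n) (S : Finset ℕ) : ℝ :=
  if h : S ∈ (Finset.Icc 1 n).powerset then v ⟨S, h⟩ else 0

/-- The coordinate `L_S` of the flag `L`-vector, for `S ⊆ [1, n]`. -/
noncomputable def coordL {n : ℕ} (v : FlagSpace n) (S : Finset ℕ) : ℝ :=
  (-1) ^ (n - S.card) *
    ∑ T ∈ (Finset.Icc 1 n).powerset with Finset.Icc 1 n \ S ⊆ T,
      (-1 / 2 : ℝ) ^ T.card * coord v T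

/-- `[a, b]` is a maximal interval contained in the finite set `S` of natural numbers. -/
def IsMaxInterval (S : Finset ℕ) (a b : ℕ) : Prop :=
  a ≤ b ∧ Finset.Icc a b ⊆ S ∧ (∀ c, c + 1 = a → c ∉ S) ∧ b + 1 ∉ S

/-- The conditions on `(M, V)` under which
`(-1) ^ (|M| / 2) * ∑_{M ⊆ Q ⊆ V} L_Q ≥ 0` gives a facet. -/
def IsFacetPair (n : ℕ) (M V : Finset ℕ) : Prop :=
  V ⊆ Finset.Icc 1 n ∧ M ⊆ V ∧
  (∀ a b, IsMaxInterval V a b → 2 ≤ (Finset.Icc a b).card) ∧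
  (∀ a b, IsMaxInterval (Finset.Icc 0 (n + 1) \ V) a b → (Finset.Icc a b).card ≤ 3) ∧
  ∀ a b, IsMaxInterval V a b →
    (M ∩ Finset.Icc a b = ∅ ∨ M ∩ Finset.Icc a b = Finset.Icc a (a + 1) ∨
      M ∩ Finset.Icc a b = Finset.Icc (b - 1) b) ∧
    (a ∉ M → a = 1 ∨ ∃ m ∈ M, m + 2 = a) ∧
    (b ∉ M → b = n ∨ b + 2 ∈ M)

/-- The linear form `(-1) ^ (|M| / 2) * ∑_{M ⊆ Q ⊆ V} L_Q`. -/
noncomputable def facetForm {n : ℕ} (M V : Finset ℕ) (v : FlagSpace n) : ℝ :=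
  (-1) ^ (M.card / 2) * ∑ Q ∈ V.powerset with M ⊆ Q, coordL v Q

/-- `T ⊆ V ⊆ [1, n]`, and `T` has at most one element in each maximal interval of `V`. -/
def IsInequalityPair (n : ℕ) (T V : Finset ℕ) : Prop :=
  V ⊆ Finset.Icc 1 n ∧ T ⊆ V ∧ ∀ a b, IsMaxInterval V a b → (Finset.Icc a b ∩ T).card ≤ 1

/-- The linear form `∑_{R ⊆ T} (-2) ^ |T \ R| * f_{S ∪ R}`, where `S = [1, n] \ V`. -/
noncomputable def inequalityForm {n : ℕ} (T V : Finset ℕ) (v : FlagSpace n) : ℝ :=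
  ∑ R ∈ T.powerset, (-2) ^ (T \ R).card * coord v ((Finset.Icc 1 n \ V) ∪ R)

/-- The linear form `f_{ik} - 2 f_i - 2 f_k + 2 f_j`. -/
noncomputable def tripleForm {n : ℕ} (i j k : ℕ) (v : FlagSpace n) : ℝ :=
  coord v {i, k} - 2 * coord v {i} - 2 * coord v {k} + 2 * coord v {j}

/-- The facets given by the inequalities `(-1) ^ (|M| / 2) * ∑_{M ⊆ Q ⊆ V} L_Q ≥ 0`. -/
def pairFacets (n : ℕ) : Set (PointedCone ℝ (FlagSpace n)) :=
  {F | ∃ M V, IsFacetPair n M V ∧ IsFacetGivenBy (eulerianCone n) F (facetForm M V)}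

/-- The facets given by the inequalities `∑_{R ⊆ T} (-2) ^ |T \ R| * f_{S ∪ R} ≥ 0`. -/
def inequalityFacets (n : ℕ) : Set (PointedCone ℝ (FlagSpace n)) :=
  {F | ∃ T V, IsInequalityPair n T V ∧ IsFacetGivenBy (eulerianCone n) F (inequalityForm T V)}

/-- The facets given by the inequalities `f_{ik} - 2 f_i - 2 f_k + 2 f_j ≥ 0`,
`1 ≤ i < j < k ≤ n`. -/
def tripleFacets (n : ℕ) : Set (PointedCone ℝ (FlagSpace n)) :=
  {F | ∃ i j k, 1 ≤ i ∧ i < j ∧ j < k ∧ k ≤ n ∧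
    IsFacetGivenBy (eulerianCone n) F (tripleForm i j k)}

/-! ### Gluing -/

/-- Data for gluing: posets `E t` with injections `code t` into a common set, such that the order
relations of the images fit together. Elements `x` of `E s` and `y` of `E t` are identified iff
`code s x = code t y`. -/
structure Gluing (τ κ : Type) where
  E : τ → GradedPoset
  code : ∀ t, E t → κ
  rk : κ → ℕ
  rk_code : ∀ t x, rk (code t x) = grade ℕ x
  code_injective : ∀ t, Function.Injective (code t)
  bot_eq : ∀ s t, code s ⊥ = code t ⊥
  top_eq : ∀ s t, code s ⊤ = code t ⊤
  trans : ∀ s t (x y : E s) (y' z : E t), code s y = code t y' → x ≤ y → y' ≤ z →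
    ∃ (u : τ) (x' z' : E u), x' ≤ z' ∧ code u x' = code s x ∧ code u z' = code t z

namespace Gluing

variable {τ κ : Type} (G : Gluing τ κ)

/-- The union of the (images of the) posets `E t`. -/
def Carrier : Type := {z : κ // ∃ t, ∃ x : G.E t, G.code t x = z}

variable {G}

/-- The union of the order relations of the posets `E t`. -/
instance : LE G.Carrier where
  le z w := ∃ (t : τ) (x y : G.E t), x ≤ y ∧ G.code t x = z.1 ∧ G.code t y = w.1

lemma rk_le {z w : G.Carrier} (h : z ≤ w) : G.rk z.1 ≤ G.rk w.1 := by
  obtain ⟨t, x, y, hxy, hx, hy⟩ := h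
  rw [← hx, ← hy, G.rk_code, G.rk_code]
  exact grade_mono hxy

lemma eq_of_rk_eq {z w : G.Carrier} (h : z ≤ w) (hr : G.rk z.1 = G.rk w.1) : z = w := by
  obtain ⟨t, x, y, hxy, hx, hy⟩ := h
  rw [← hx, ← hy, G.rk_code, G.rk_code] at hr
  apply Subtype.ext
  rw [← hx, ← hy]
  rcases hxy.lt_or_eq with h | h
  · exact absurd hr (grade_strictMono (𝕆 := ℕ) h).ne
  · rw [h]

instance : PartialOrder G.Carrier where
  le_refl z := by
    obtain ⟨t, x, hx⟩ := z.2
    exact ⟨t, x, x, le_rfl, hx, hx⟩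
  le_trans := by
    rintro a b c ⟨s, x, y, hxy, hx, hy⟩ ⟨t, y', z, hyz, hy', hz⟩
    obtain ⟨u, x', z', h1, h2, h3⟩ := G.trans s t x y y' z (hy.trans hy'.symm) hxy hyz
    exact ⟨u, x', z', h1, h2.trans hx, h3.trans hz⟩
  le_antisymm a b hab hba := eq_of_rk_eq hab (le_antisymm (rk_le hab) (rk_le hba))

noncomputable instance [Nonempty τ] : BoundedOrder G.Carrier where
  bot := ⟨G.code (Classical.arbitrary τ) ⊥, _, _, rfl⟩
  top := ⟨G.code (Classical.arbitrary τ) ⊤, _, _, rfl⟩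
  bot_le := by
    rintro ⟨z, t, x, rfl⟩
    exact ⟨t, ⊥, x, bot_le, G.bot_eq _ _, rfl⟩
  le_top := by
    rintro ⟨z, t, x, rfl⟩
    exact ⟨t, x, ⊤, le_top, rfl, G.top_eq _ _⟩

instance [Finite τ] : Finite G.Carrier :=
  Finite.of_surjective (fun p : (Σ t, G.E t) => (⟨G.code p.1 p.2, p.1, p.2, rfl⟩ : G.Carrier))
    (by rintro ⟨z, t, x, rfl⟩; exact ⟨⟨t, x⟩, rfl⟩)

lemma rk_covBy {z w : G.Carrier} (h : z ⋖ w) : G.rk w.1 = G.rk z.1 + 1 := by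
  obtain ⟨t, x, y, hxy, hx, hy⟩ := h.1.le
  have hlt : x < y := by
    refine lt_of_le_of_ne hxy fun he => h.1.ne (Subtype.ext ?_)
    rw [← hx, ← hy, he]
  rw [← hx, ← hy, G.rk_code, G.rk_code]
  by_contra hne
  obtain ⟨v, hxv, hvy⟩ := (G.E t).exists_between hlt hne
  let v' : G.Carrier := ⟨G.code t v, t, v, rfl⟩
  have h1 : z < v' := by
    refine lt_of_le_of_ne ⟨t, x, v, hxv.le, hx, rfl⟩ fun he => hxv.ne ?_
    exact G.code_injective t (hx.trans (congrArg Subtype.val he))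
  have h2 : v' < w := by
    refine lt_of_le_of_ne ⟨t, v, y, hvy.le, rfl, hy⟩ fun he => hvy.ne ?_
    exact G.code_injective t ((congrArg Subtype.val he).trans hy.symm)
  exact h.2 h1 h2

variable (G)

/-- The poset glued from the posets `E t`: the union of their elements, with elements of equal
code identified, and with the union of their order relations. -/
noncomputable def poset [Finite τ] [Nonempty τ] : GradedPoset :=
  GradedPoset.ofRank G.Carrier (fun z => G.rk z.1)
    ((G.rk_code _ ⊥).trans grade_bot)
    (fun _ _ h => lt_of_le_of_ne (rk_le h.le) fun he => h.ne (eq_of_rk_eq h.le he))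
    (fun _ _ h => rk_covBy h)

end Gluing

/-- A recipe for gluing `m` posets obtained from the chain of rank 7 by replication: the `t`-th
poset uses the intervals `int t j` (with `k j` copies for the index `j`, the same for all `t`),
and at rank `r` the elements of the `s`-th and the `t`-th poset with equal copy numbers are
identified iff `rep s r = rep t r`. An unused index `j` has the empty interval `(1, 0)`. -/
structure GluingRecipe (m l : ℕ) where
  int : Fin m → Fin l → ℕ × ℕ
  rep : Fin m → Fin 8 → Fin m
  rep_zero : ∀ s t, rep s 0 = rep t 0
  rep_last : ∀ s t, rep s 7 = rep t 7
  int_mem : ∀ t j, 1 ≤ (int t j).1 ∧ (int t j).2 ≤ 6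
  /-- at a rank where two of the posets are identified, they are replicated in the same way -/
  same : ∀ s t r, rep s r = rep t r → ∀ j,
    ((int s j).1 ≤ r.val ∧ r.val ≤ (int s j).2 ↔ (int t j).1 ≤ r.val ∧ r.val ≤ (int t j).2)
  /-- a condition ensuring that the union of the order relations is transitive -/
  compat : ∀ r₁ r₂ r₃ : Fin 8, r₁ ≤ r₂ → r₂ ≤ r₃ → ∀ s t, rep s r₂ = rep t r₂ →
    ∃ u, rep u r₁ = rep s r₁ ∧ rep u r₃ = rep t r₃ ∧
      ∀ j, ((int u j).1 ≤ r₁.val ∧ r₃.val ≤ (int u j).2) →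
        ((int s j).1 ≤ r₂.val ∧ r₂.val ≤ (int s j).2)

namespace GluingRecipe

open GradedPoset

variable {m l : ℕ} (A : GluingRecipe m l) (k : Fin l → ℕ+)

/-- The posets to be glued. -/
def component (t : Fin m) : GradedPoset := (chain 6).replicate (A.int t) k

variable {A k}

lemma replicated_iff {t : Fin m} {j : Fin l} {r : Fin 8} :
    (chain 6).Replicated (A.int t j) r ↔ (A.int t j).1 ≤ r.val ∧ r.val ≤ (A.int t j).2 := by
  refine ⟨fun h => ⟨h.1, h.2.1⟩, fun h => ⟨h.1, h.2, ?_, ?_⟩⟩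
  · intro he
    have h0 : r.val = 0 := congrArg (fun x : Fin 8 => x.val) he
    have := (A.int_mem t j).1
    omega
  · intro he
    have h0 : r.val = 7 := congrArg (fun x : Fin 8 => x.val) he
    have := (A.int_mem t j).2
    omega

variable (A k)

/-- Elements are identified iff they have the same rank, the same copy numbers, and come from
posets that are glued at that rank. -/
def gluing : Gluing (Fin m) (Fin 8 × Fin m × (Fin l → ℕ)) where
  E := A.component k
  code t := fun z : Copies (chain 6) (A.int t) k => (z.1.1, A.rep t z.1.1, z.1.2)
  rk z := z.1.val
  rk_code _ _ := rfl
  code_injective t := fun (x y : Copies (chain 6) (A.int t) k) h => by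
    apply Subtype.ext
    exact Prod.ext (congrArg (fun p => p.1) h) (congrArg (fun p => p.2.2) h)
  bot_eq s t := Prod.ext rfl (Prod.ext (A.rep_zero s t) rfl)
  top_eq s t := Prod.ext rfl (Prod.ext (A.rep_last s t) rfl)
  trans s t := fun (x y : Copies (chain 6) (A.int s) k) (y' z : Copies (chain 6) (A.int t) k)
      h hxy hyz => by
    have hr : (y.1.1 : Fin 8) = y'.1.1 := congrArg (fun p => p.1) h
    have hc : y.1.2 = y'.1.2 := congrArg (fun p => p.2.2) h
    have hrep : A.rep s y.1.1 = A.rep t y.1.1 := by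
      have := congrArg (fun p => p.2.1) h
      simp only at this
      rw [hr] at this ⊢
      exact this
    have hxy' := Copies.le_def.mp hxy
    have hyz' := Copies.le_def.mp hyz
    have h2 : (y.1.1 : Fin 8) ≤ z.1.1 := hr ▸ hyz'.1
    obtain ⟨u, hu1, hu3, hu⟩ := A.compat x.1.1 y.1.1 z.1.1 hxy'.1 h2 s t hrep
    have e1 : ∀ j, (chain 6).Replicated (A.int u j) x.1.1 ↔
        (chain 6).Replicated (A.int s j) x.1.1 := fun j =>
      replicated_iff.trans ((A.same u s x.1.1 hu1 j).trans replicated_iff.symm)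
    have e3 : ∀ j, (chain 6).Replicated (A.int u j) z.1.1 ↔
        (chain 6).Replicated (A.int t j) z.1.1 := fun j =>
      replicated_iff.trans ((A.same u t z.1.1 hu3 j).trans replicated_iff.symm)
    let x' : Copies (chain 6) (A.int u) k := ⟨x.1, fun j => by
      rw [e1 j]; exact x.2 j⟩
    let z' : Copies (chain 6) (A.int u) k := ⟨z.1, fun j => by
      rw [e3 j]; exact z.2 j⟩
    refine ⟨u, x', z', ?_, ?_, ?_⟩
    · refine Copies.le_def.mpr ⟨hxy'.1.trans h2, fun j hj1 hj3 => ?_⟩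
      have hs2 := hu j ⟨(replicated_iff.mp hj1).1, (replicated_iff.mp hj3).2⟩
      have ht2 := (A.same s t y.1.1 hrep j).mp hs2
      have a1 := hxy'.2 j ((e1 j).mp hj1) (replicated_iff.mpr hs2)
      have a2 := hyz'.2 j (hr ▸ replicated_iff.mpr ht2) ((e3 j).mp hj3)
      exact a1.trans ((congrFun hc j).trans a2)
    · exact Prod.ext rfl (Prod.ext hu1 rfl)
    · exact Prod.ext rfl (Prod.ext hu3 rfl)

/-- The glued poset. -/
noncomputable def poset [NeZero m] : GradedPoset := (A.gluing k).poset

end GluingRecipe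

/-! ### The four glued posets -/

/-- Posets `D_[1,2] D_[2,6]` and `D_[1,5] D_[5,6]`, identified at ranks 1 and 6. -/
def recipe1 : GluingRecipe 2 2 where
  int := ![![(1, 2), (2, 6)], ![(1, 5), (5, 6)]]
  rep := ![fun _ => 0, ![0, 0, 1, 1, 1, 1, 0, 0]]
  rep_zero := by decide
  rep_last := by decide
  int_mem := by decide
  same := by decide
  compat := by decide

/-- Posets `D_[1,3] D_[3,4] D_[4,6]`, `D_[1,2] D_[2,4] D_[2,6]` and `D_[1,5] D_[3,5] D_[5,6]`; the
first and second are identified at ranks 1, 4, 5, 6, the first and third at ranks 1, 2, 3, 6. -/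
def recipe2 : GluingRecipe 3 3 where
  int := ![![(1, 3), (3, 4), (4, 6)], ![(1, 2), (2, 4), (2, 6)], ![(1, 5), (3, 5), (5, 6)]]
  rep := ![fun _ => 0, ![0, 0, 1, 1, 0, 0, 0, 0], ![0, 0, 0, 0, 2, 2, 0, 0]]
  rep_zero := by decide
  rep_last := by decide
  int_mem := by decide
  same := by decide
  compat := by decide

/-- Posets `D_[1,2] D_[3,4] D_[3,6] D_[4,5]`, `D_[1,5] D_[3,5] D_[5,6]` and
`D_[1,2] D_[2,5] D_[1,6]`; the first and second are identified at ranks 1, 2, 6, the first and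
third at rank 6. The indices are those of the multiplicities `mult3`. -/
def recipe3 : GluingRecipe 3 7 where
  int := ![![(1, 2), (3, 4), (4, 5), (3, 6), (1, 0), (1, 0), (1, 0)],
    ![(1, 5), (1, 0), (1, 0), (5, 6), (3, 5), (1, 0), (1, 0)],
    ![(1, 0), (1, 0), (1, 0), (1, 6), (1, 0), (1, 2), (2, 5)]]
  rep := ![fun _ => 0, ![0, 0, 0, 1, 1, 1, 0, 0], ![0, 2, 2, 2, 2, 2, 0, 0]]
  rep_zero := by decide
  rep_last := by decide
  int_mem := by decide
  same := by decide
  compat := by decide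

/-- The dual of `recipe3`: rank `r` becomes rank `7 - r`. -/
def recipe4 : GluingRecipe 3 7 where
  int := ![![(5, 6), (3, 4), (2, 3), (1, 4), (1, 0), (1, 0), (1, 0)],
    ![(2, 6), (1, 0), (1, 0), (1, 2), (2, 4), (1, 0), (1, 0)],
    ![(1, 0), (1, 0), (1, 0), (1, 6), (1, 0), (5, 6), (2, 5)]]
  rep := ![fun _ => 0, ![0, 0, 1, 1, 1, 0, 0, 0], ![0, 0, 2, 2, 2, 2, 2, 0]]
  rep_zero := by decide
  rep_last := by decide
  int_mem := by decide
  same := by decide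
  compat := by decide

/-- The multiplicities for `recipe3` and `recipe4`. -/
def mult3 (N : ℕ+) : Fin 7 → ℕ+ :=
  ![N + 1, N + 1, N + 1, N, N ^ 2, N + 2, ⟨(N : ℕ) ^ 2 - N + 2, Nat.succ_pos _⟩]

/-- The four sequences of glued posets. -/
noncomputable def gluedPoset (N : ℕ+) : Fin 4 → GradedPoset :=
  ![recipe1.poset (fun _ => N), recipe2.poset (fun _ => N), recipe3.poset (mult3 N),
    recipe4.poset (mult3 N)]

/-- The powers of `N` by which the flag vectors of the glued posets are normalized. -/
def gluedExponent : Fin 4 → ℕ := ![2, 3, 4, 4]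

/-- The interval systems whose limit posets are added. -/
def gluedSystems : Fin 4 → Finset (Finset (ℕ × ℕ)) :=
  ![{{(1, 2), (2, 6)}, {(2, 5), (5, 6)}},
    {{(1, 3), (3, 4), (4, 6)}, {(1, 2), (2, 3)}, {(4, 5), (5, 6)}},
    {{(1, 2), (3, 4), (4, 5)}, {(3, 5), (5, 6)}, {(1, 2), (2, 5)}},
    {{(1, 2), (2, 4)}, {(2, 5), (5, 6)}, {(2, 3), (3, 4), (5, 6)}}]

/-! The cone `eulerianCone 6` is squeezed between an outer cone given by inequalities and an inner
cone given by generators, and the two are shown to coincide.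

Outer cone. `facetCone` is cut out of the space of solutions of the generalized Dehn-Sommerville
relations by 23 inequalities. The relations hold because the Eulerian property fixes the alternating
sum of every open interval (`IsEulerian.flagVector_mem`). For the first 19 inequalities, fix a chain
with rank set `[1,6] \ V`. Extensions of the chain at ranks in different gaps are independent, so
the form is a sum over such chains of products of terms "number of extensions minus 2". Each factor
is nonnegative, since an Eulerian poset has at least two elements at every intermediate rank of an
interval (`IsEulerian.inequalityForm_nonneg`). For the last four, every element `y` of rank `j`
yields the complete bipartite graph between the elements of rank `i` below `y` and those of rank `k`
above it. These graphs have the comparability graph of ranks `i`, `k` as their union and cover each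
vertex at least twice, and a counting argument for such covers applies (`bipartiteExcess_nonneg`).

Inner cone. The 24 generators are limits of normalized flag vectors of horizontal doubles of
half-Eulerian posets. All posets involved consist of copies of finitely many types of elements
(`CopyPresentation`), so numbers of chains and alternating sums over intervals are polynomials in
the multiplicities. Being half-Eulerian is then a finite list of polynomial identities
(`CopyPresentation.isHalfEulerian`), and the limit is a coefficient of the polynomial counting
chains.

Equality. Thirteen of the generators span the Dehn-Sommerville space (`exists_basis_sum`); the other
eleven are integer combinations of them. A point of `facetCone` is a nonnegative combination of
generators as soon as a system of linear inequalities in eleven unknowns is solvable, and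
Fourier-Motzkin elimination derives solvability from the 23 inequalities (`exists_coefficients`,
`facetCone_le_hull`).

Rays and facets. The table `slack` of the values of the 23 forms at the 24 generators shows that
neither description is redundant, so the generators give the extreme rays and the forms give the
facets, without repetition (`DoubleDescription.extremeRays`, `DoubleDescription.facets`). A facet is
determined by the generators lying on it. The inequalities of the three families are therefore
sorted by their zero patterns (`sameZeros`), once the forms in `L_Q` have been rewritten as
multiples of `inequalityForm` (`facetForm_eq`). -/

/-! ### Cones with a double description -/

/-- The cone `C` is generated by the vectors `r j` and is cut out of the subspace `W` by the
inequalities `φ i ≥ 0`, where neither description is redundant. -/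
structure DoubleDescription {n : ℕ} {ι κ : Type} [Fintype ι] [Fintype κ]
    (C : PointedCone ℝ (FlagSpace n)) (W : Submodule ℝ (FlagSpace n)) (r : ι → FlagSpace n)
    (φ : κ → FlagSpace n →ₗ[ℝ] ℝ) : Prop where
  mem_iff_sum : ∀ v, v ∈ C ↔ ∃ a : ι → ℝ, (∀ j, 0 ≤ a j) ∧ v = ∑ j, a j • r j
  mem_iff_forms : ∀ v, v ∈ C ↔ v ∈ W ∧ ∀ i, 0 ≤ φ i v
  sep_rays : ∀ j k, j ≠ k → ∃ i, φ i (r j) = 0 ∧ 0 < φ i (r k)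
  sep_forms : ∀ i k, i ≠ k → ∃ j, φ i (r j) = 0 ∧ 0 < φ k (r j)

lemma mem_ray_iff {n : ℕ} {v x : FlagSpace n} : x ∈ ray v ↔ ∃ t : ℝ, 0 ≤ t ∧ x = t • v := by
  rw [ray, PointedCone.hull, Submodule.mem_span_singleton]
  constructor
  · rintro ⟨t, rfl⟩
    exact ⟨t.1, t.2, rfl⟩
  · rintro ⟨t, ht, rfl⟩
    exact ⟨⟨t, ht⟩, rfl⟩

lemma self_mem_ray {n : ℕ} (v : FlagSpace n) : v ∈ ray v :=
  mem_ray_iff.mpr ⟨1, zero_le_one, (one_smul _ _).symm⟩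

lemma ray_smul {n : ℕ} (v : FlagSpace n) {t : ℝ} (ht : 0 < t) : ray (t • v) = ray v := by
  ext x
  rw [mem_ray_iff, mem_ray_iff]
  constructor
  · rintro ⟨s, hs, rfl⟩
    exact ⟨s * t, by positivity, by rw [smul_smul]⟩
  · rintro ⟨s, hs, rfl⟩
    exact ⟨s / t, by positivity, by rw [smul_smul, div_mul_cancel₀ _ ht.ne']⟩

/-- The face of `C` on which the linear form `ψ` vanishes. -/
def zeroFace {n : ℕ} (C : PointedCone ℝ (FlagSpace n)) (ψ : FlagSpace n →ₗ[ℝ] ℝ) :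
    PointedCone ℝ (FlagSpace n) :=
  C ⊓ PointedCone.ofSubmodule (LinearMap.ker ψ)

lemma mem_zeroFace {n : ℕ} {C : PointedCone ℝ (FlagSpace n)}
    {ψ : FlagSpace n →ₗ[ℝ] ℝ} {v : FlagSpace n} :
    v ∈ zeroFace C ψ ↔ v ∈ C ∧ ψ v = 0 := Iff.rfl

namespace DoubleDescription

variable {n : ℕ} {ι κ : Type} [Fintype ι] [Fintype κ] {C : PointedCone ℝ (FlagSpace n)}
  {W : Submodule ℝ (FlagSpace n)} {r : ι → FlagSpace n} {φ : κ → FlagSpace n →ₗ[ℝ] ℝ}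

lemma ray_mem (D : DoubleDescription C W r φ) (j : ι) : r j ∈ C := by
  classical
  refine (D.mem_iff_sum _).mpr ⟨Pi.single j 1, fun k => ?_, ?_⟩
  · by_cases h : k = j
    · subst h; simp
    · simp [Pi.single_eq_of_ne h]
  · simp [Pi.single_apply, ite_smul]

lemma nonneg (D : DoubleDescription C W r φ) (i : κ) {v : FlagSpace n} (hv : v ∈ C) :
    0 ≤ φ i v := ((D.mem_iff_forms v).mp hv).2 i

lemma fg (D : DoubleDescription C W r φ) : C.FG := by
  have h : C = PointedCone.hull ℝ (Set.range r) := by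
    apply le_antisymm
    · intro v hv
      obtain ⟨a, ha, rfl⟩ := (D.mem_iff_sum v).mp hv
      exact Submodule.sum_mem _ fun j _ =>
        PointedCone.smul_mem _ (ha j) (Submodule.subset_span ⟨j, rfl⟩)
    · refine Submodule.span_le.mpr ?_
      rintro _ ⟨j, rfl⟩
      exact D.ray_mem j
  rw [h]
  exact Submodule.fg_span (Set.finite_range r)

/-- A linear form that is nonnegative on the generators is nonnegative on the cone, and it vanishes
exactly on the combinations of the generators on which it vanishes. -/
lemma form_sum {ψ : FlagSpace n →ₗ[ℝ] ℝ} (hψ : ∀ j, 0 ≤ ψ (r j)) {a : ι → ℝ}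
    (ha : ∀ j, 0 ≤ a j) :
    0 ≤ ψ (∑ j, a j • r j) ∧ (ψ (∑ j, a j • r j) = 0 ↔ ∀ j, 0 < ψ (r j) → a j = 0) := by
  have e : ψ (∑ j, a j • r j) = ∑ j, a j * ψ (r j) := by simp
  have hn : ∀ j ∈ Finset.univ, 0 ≤ a j * ψ (r j) := fun j _ => mul_nonneg (ha j) (hψ j)
  rw [e]
  refine ⟨Finset.sum_nonneg hn, ?_⟩
  rw [Finset.sum_eq_zero_iff_of_nonneg hn]
  constructor
  · intro h j hj
    rcases mul_eq_zero.mp (h j (Finset.mem_univ _)) with h | h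
    · exact h
    · exact absurd h hj.ne'
  · intro h j _
    rcases (hψ j).eq_or_lt with h0 | h0
    · rw [← h0, mul_zero]
    · rw [h j h0, zero_mul]

lemma ray_ne_zero [Nontrivial ι] (D : DoubleDescription C W r φ) (j : ι) : r j ≠ 0 := by
  obtain ⟨k, hk⟩ := exists_ne j
  obtain ⟨i, -, hi⟩ := D.sep_rays k j hk
  intro h
  rw [h, map_zero] at hi
  exact hi.false

/-- For every other generator `r k` some valid form vanishes at `r j` and is positive at `r k`. If
`a • x + y` lies on the ray, this form vanishes at `x`, so `r k` does not occur in any nonnegative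
representation of `x`. -/
lemma isFaceOf_ray (D : DoubleDescription C W r φ) (j : ι) : (ray (r j)).IsFaceOf C := by
  refine ⟨?_, ?_⟩
  · intro x hx
    obtain ⟨t, ht, rfl⟩ := mem_ray_iff.mp hx
    exact C.smul_mem ht (D.ray_mem j)
  · intro x y a hx hy ha hxy
    obtain ⟨t, ht, e⟩ := mem_ray_iff.mp hxy
    obtain ⟨b, hb, rfl⟩ := (D.mem_iff_sum x).mp hx
    have h0 : ∀ k, k ≠ j → b k = 0 := fun k hk => by
      obtain ⟨i, hij, hik⟩ := D.sep_rays j k hk.symm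
      have h1 : a * φ i (∑ k, b k • r k) + φ i y = 0 := by
        rw [← smul_eq_mul, ← map_smul, ← map_add, e, map_smul, hij, smul_zero]
      have h2 := D.nonneg i hx
      have h3 := D.nonneg i hy
      have h4 : φ i (∑ k, b k • r k) = 0 := by
        have := mul_nonneg ha.le h2
        have h5 : a * φ i (∑ k, b k • r k) = 0 := by linarith
        exact (mul_eq_zero.mp h5).resolve_left ha.ne'
      exact ((form_sum (fun k => D.nonneg i (D.ray_mem k)) hb).2.mp h4) k hik
    rw [Finset.sum_eq_single_of_mem j (Finset.mem_univ _) fun k _ hk => by rw [h0 k hk, zero_smul]]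
    exact mem_ray_iff.mpr ⟨b j, hb j, rfl⟩

/-- The extreme rays are the rays of the generators. -/
lemma extremeRays [Nontrivial ι] (D : DoubleDescription C W r φ) :
    {R | IsExtremeRay C R} = Set.range fun j => ray (r j) := by
  ext R
  constructor
  · rintro ⟨hF, v, hv, rfl⟩
    have hvR := self_mem_ray v
    obtain ⟨a, ha, e⟩ := (D.mem_iff_sum v).mp (hF.le hvR)
    -- Some generator occurs in `v` with positive coefficient. The face property puts it on the ray
    -- of `v`, so it is a positive multiple of `v`.
    obtain ⟨j, hj⟩ : ∃ j, 0 < a j := by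
      by_contra hc
      push Not at hc
      apply hv
      rw [e]
      exact Finset.sum_eq_zero fun j _ => by rw [le_antisymm (hc j) (ha j), zero_smul]
    have hj' := hF.mem_of_sum_smul_mem D.ray_mem ha (e ▸ hvR) j hj
    obtain ⟨t, ht, e'⟩ := mem_ray_iff.mp hj'
    have ht' : 0 < t := ht.lt_of_ne fun h => D.ray_ne_zero j (by rw [e', ← h, zero_smul])
    exact ⟨j, by simp only; rw [e', ray_smul v ht']⟩
  · rintro ⟨j, rfl⟩
    exact ⟨D.isFaceOf_ray j, r j, D.ray_ne_zero j, rfl⟩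

lemma ray_injective (D : DoubleDescription C W r φ) : Function.Injective fun j => ray (r j) := by
  intro j k h
  by_contra hne
  obtain ⟨i, h1, h2⟩ := D.sep_rays j k hne
  have h3 : r k ∈ ray (r j) := by
    simp only at h
    rw [h]; exact self_mem_ray _
  obtain ⟨t, -, e⟩ := mem_ray_iff.mp h3
  rw [e, map_smul, h1, smul_zero] at h2
  exact h2.false

/-- Points of `C` may be moved in those directions of `W` in which no inequality that is tight
decreases. -/
lemma exists_add_smul_mem (D : DoubleDescription C W r φ) {z y : FlagSpace n} (hz : z ∈ C)
    (hy : y ∈ W) (h : ∀ i, 0 < φ i z ∨ 0 ≤ φ i y) : ∃ ε : ℝ, 0 < ε ∧ z + ε • y ∈ C := by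
  have hz' := (D.mem_iff_forms z).mp hz
  -- There are finitely many forms: those positive at `z` stay positive for small `ε` by continuity,
  -- the others do not decrease in direction `y`.
  have key : ∀ᶠ ε : ℝ in 𝓝[>] 0, ∀ i, 0 ≤ φ i (z + ε • y) := by
    rw [eventually_all]
    intro i
    simp only [map_add, map_smul, smul_eq_mul]
    rcases h i with h | h
    · have hc : Tendsto (fun ε : ℝ => φ i z + ε * φ i y) (𝓝[>] 0) (𝓝 (φ i z + 0 * φ i y)) := by
        apply Tendsto.mono_left _ nhdsWithin_le_nhds
        exact Continuous.tendsto (by fun_prop) 0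
      rw [zero_mul, add_zero] at hc
      exact (hc.eventually (lt_mem_nhds h)).mono fun _ h => h.le
    · filter_upwards [self_mem_nhdsWithin] with ε hε
      exact add_nonneg (hz'.2 i) (mul_nonneg (le_of_lt hε) h)
  obtain ⟨ε, h1, h2⟩ := (key.and self_mem_nhdsWithin).exists
  exact ⟨ε, h2, (D.mem_iff_forms _).mpr ⟨W.add_mem hz'.1 (W.smul_mem _ hy), h1⟩⟩

lemma mem_span_of_add_smul {F : PointedCone ℝ (FlagSpace n)} {z y : FlagSpace n} {ε : ℝ}
    (hε : 0 < ε) (hz : z ∈ F) (h : z + ε • y ∈ F) :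
    y ∈ Submodule.span ℝ (F : Set (FlagSpace n)) := by
  have e : y = ε⁻¹ • ((z + ε • y) - z) := by
    rw [add_sub_cancel_left, smul_smul, inv_mul_cancel₀ hε.ne', one_smul]
  rw [e]
  exact Submodule.smul_mem _ _ (Submodule.sub_mem _ (Submodule.subset_span h)
    (Submodule.subset_span hz))

/-- Comparing with any second form, irredundancy excludes that `φ i` vanishes on all of `C`; this is
where at least two forms are needed. -/
lemma exists_form_pos [Nontrivial κ] (D : DoubleDescription C W r φ) (i : κ) :
    ∃ j, 0 < φ i (r j) := by
  obtain ⟨k, hk⟩ := exists_ne i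
  obtain ⟨j, -, h⟩ := D.sep_forms k i hk
  exact ⟨j, h⟩

lemma sum_pos_of (D : DoubleDescription C W r φ) (i : κ) (s : Finset ι) {j : ι} (hj : j ∈ s)
    (h : 0 < φ i (r j)) : 0 < φ i (∑ j ∈ s, r j) := by
  rw [map_sum]
  exact Finset.sum_pos' (fun k _ => D.nonneg i (D.ray_mem k)) ⟨j, hj, h⟩

/-- The sum of all generators is strictly positive for every form, hence is an interior point
relative to `W` and can be moved in every direction of `W`. -/
lemma span_eq [Nontrivial κ] (D : DoubleDescription C W r φ) :
    Submodule.span ℝ (C : Set (FlagSpace n)) = W := by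
  apply le_antisymm
  · exact Submodule.span_le.mpr fun v hv => ((D.mem_iff_forms v).mp hv).1
  · intro y hy
    have hz : ∑ j, r j ∈ C := C.sum_mem fun j _ => D.ray_mem j
    obtain ⟨ε, hε, h⟩ := D.exists_add_smul_mem hz hy fun i => by
      obtain ⟨j, hj⟩ := D.exists_form_pos i
      exact Or.inl (D.sum_pos_of i _ (Finset.mem_univ j) hj)
    exact mem_span_of_add_smul hε hz h

/-- The sum of the generators on which `φ i` vanishes is strictly positive for every other form, by
`sep_forms`. It is a relative interior point of the face and can be moved in all directions of `W`
that keep `φ i` equal to zero. -/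
lemma span_zeroFace (D : DoubleDescription C W r φ) (i : κ) :
    Submodule.span ℝ (zeroFace C (φ i) : Set (FlagSpace n)) = W ⊓ LinearMap.ker (φ i) := by
  classical
  apply le_antisymm
  · exact Submodule.span_le.mpr fun v hv => ⟨((D.mem_iff_forms v).mp hv.1).1, hv.2⟩
  · intro y hy
    have hz : ∑ j with φ i (r j) = 0, r j ∈ C := C.sum_mem fun j _ => D.ray_mem j
    have hz0 : φ i (∑ j with φ i (r j) = 0, r j) = 0 := by
      rw [map_sum]
      exact Finset.sum_eq_zero fun j hj => (Finset.mem_filter.mp hj).2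
    have hyi : φ i y = 0 := hy.2
    obtain ⟨ε, hε, h⟩ := D.exists_add_smul_mem hz hy.1 fun k => by
      by_cases hk : i = k
      · right; rw [← hk, hyi]
      · obtain ⟨j, h1, h2⟩ := D.sep_forms i k hk
        exact Or.inl (D.sum_pos_of k _ (by simp [h1]) h2)
    refine mem_span_of_add_smul hε (mem_zeroFace.mpr ⟨hz, hz0⟩) (mem_zeroFace.mpr ⟨h, ?_⟩)
    rw [map_add, map_smul, hz0, hyi, smul_zero, add_zero]

lemma isFaceOf_zeroFace {ψ : FlagSpace n →ₗ[ℝ] ℝ} (hψ : ∀ v ∈ C, 0 ≤ ψ v) :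
    (zeroFace C ψ).IsFaceOf C := by
  refine ⟨inf_le_left, fun {x y a} hx hy ha hxy => mem_zeroFace.mpr ⟨hx, ?_⟩⟩
  have h := (mem_zeroFace.mp hxy).2
  rw [map_add, map_smul, smul_eq_mul] at h
  have h1 := mul_nonneg ha.le (hψ x hx)
  have h2 := hψ y hy
  exact (mul_eq_zero.mp (by linarith : a * ψ x = 0)).resolve_left ha.ne'

lemma finrank_inf_ker [Nontrivial κ] (D : DoubleDescription C W r φ) (i : κ) :
    Module.finrank ℝ ↥(W ⊓ LinearMap.ker (φ i)) + 1 = Module.finrank ℝ W := by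
  obtain ⟨j, hj⟩ := D.exists_form_pos i
  let ψ := (φ i).domRestrict W
  have hsurj : Function.Surjective ψ := by
    apply LinearMap.surjective
    intro h
    have := LinearMap.congr_fun h ⟨r j, ((D.mem_iff_forms _).mp (D.ray_mem j)).1⟩
    exact hj.ne' this
  have h1 := LinearMap.finrank_range_add_finrank_ker ψ
  rw [LinearMap.range_eq_top.mpr hsurj, finrank_top, Module.finrank_self] at h1
  have h2 : (LinearMap.ker ψ).map W.subtype = W ⊓ LinearMap.ker (φ i) := by
    have : LinearMap.ker ψ = (LinearMap.ker (φ i)).comap W.subtype := rfl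
    rw [this, Submodule.map_comap_subtype]
  have h3 : Module.finrank ℝ ((LinearMap.ker ψ).map W.subtype) =
      Module.finrank ℝ (LinearMap.ker ψ) := Submodule.finrank_map_subtype_eq W _
  rw [h2] at h3
  rw [h3, ← h1, add_comm]

lemma isFacet_zeroFace [Nontrivial κ] (D : DoubleDescription C W r φ) (i : κ) :
    IsFacet C (zeroFace C (φ i)) := by
  refine ⟨isFaceOf_zeroFace fun v hv => D.nonneg i hv, ?_⟩
  rw [D.span_zeroFace, D.span_eq, D.finrank_inf_ker]

lemma exists_sub_of_mem_span {F : PointedCone ℝ (FlagSpace n)} {y : FlagSpace n}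
    (hy : y ∈ Submodule.span ℝ (F : Set (FlagSpace n))) : ∃ p ∈ F, ∃ q ∈ F, y = p - q := by
  induction hy using Submodule.span_induction with
  | mem x hx => exact ⟨x, hx, 0, F.zero_mem, (sub_zero x).symm⟩
  | zero => exact ⟨0, F.zero_mem, 0, F.zero_mem, (sub_zero 0).symm⟩
  | add x y _ _ hx hy =>
    obtain ⟨p, hp, q, hq, rfl⟩ := hx
    obtain ⟨p', hp', q', hq', rfl⟩ := hy
    exact ⟨p + p', F.add_mem hp hp', q + q', F.add_mem hq hq', by abel⟩
  | smul a x _ hx =>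
    obtain ⟨p, hp, q, hq, rfl⟩ := hx
    rcases le_total 0 a with ha | ha
    · exact ⟨a • p, F.smul_mem ha hp, a • q, F.smul_mem ha hq, smul_sub _ _ _⟩
    · refine ⟨(-a) • q, F.smul_mem (neg_nonneg.mpr ha) hq, (-a) • p,
        F.smul_mem (neg_nonneg.mpr ha) hp, ?_⟩
      rw [smul_sub, neg_smul, neg_smul]; abel

/-- Write `y = p - q` with `p`, `q` in the face. Then `y + q = p` is a sum of two points of `C`
lying in the face, which forces `y` into it. Thus a face is recovered from its span. -/
lemma mem_of_mem_span {F : PointedCone ℝ (FlagSpace n)} (hF : F.IsFaceOf C) {y : FlagSpace n}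
    (hy : y ∈ C) (h : y ∈ Submodule.span ℝ (F : Set (FlagSpace n))) : y ∈ F := by
  obtain ⟨p, hp, q, hq, rfl⟩ := exists_sub_of_mem_span h
  exact hF.mem_of_add_mem_left hy (hF.le hq) (by rwa [sub_add_cancel])

/-- A proper face is contained in one of the facets. -/
lemma exists_le_zeroFace (D : DoubleDescription C W r φ) {F : PointedCone ℝ (FlagSpace n)}
    (hF : F.IsFaceOf C) (hne : F ≠ C) : ∃ i, F ≤ zeroFace C (φ i) := by
  by_contra hc
  push Not at hc
  -- If no facet contains `F`, then each form is positive somewhere on `F`. The sum of such points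
  -- lies in `F` and is positive for all forms simultaneously.
  have hx : ∀ i, ∃ x ∈ F, 0 < φ i x := fun i => by
    obtain ⟨x, hx, hn⟩ := SetLike.not_le_iff_exists.mp (hc i)
    refine ⟨x, hx, (D.nonneg i (hF.le hx)).lt_of_ne fun h => hn ?_⟩
    exact mem_zeroFace.mpr ⟨hF.le hx, h.symm⟩
  choose x hxF hxpos using hx
  have hsF : ∑ i, x i ∈ F := F.sum_mem fun i _ => hxF i
  apply hne
  refine le_antisymm hF.le fun y hy => ?_
  -- A small multiple of any `y` in `C` can be subtracted from this interior point, so it is a sum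
  -- of two points of `C`, one of them a positive multiple of `y`. The face property gives `y ∈ F`,
  -- contradicting `F ≠ C`.
  obtain ⟨ε, hε, h⟩ := D.exists_add_smul_mem (y := -y) (hF.le hsF)
    (W.neg_mem ((D.mem_iff_forms y).mp hy).1) fun i => by
      left
      rw [map_sum]
      exact Finset.sum_pos' (fun k _ => D.nonneg i (hF.le (hxF k))) ⟨i, Finset.mem_univ _, hxpos i⟩
  refine hF.mem_of_smul_add_mem hy h hε ?_
  rwa [smul_neg, add_comm, neg_add_cancel_right]

/-- The facets are the faces given by the inequalities. -/
lemma facets [Nontrivial κ] (D : DoubleDescription C W r φ) :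
    {F | IsFacet C F} = Set.range fun i => zeroFace C (φ i) := by
  ext F
  constructor
  · rintro ⟨hF, hd⟩
    have hne : F ≠ C := by
      rintro rfl
      omega
    obtain ⟨i, hi⟩ := D.exists_le_zeroFace hF hne
    -- Both faces have codimension one, so their spans agree, and a face contains every point of `C`
    -- in its span.
    refine ⟨i, le_antisymm (fun y hy => ?_) hi⟩
    refine mem_of_mem_span hF (mem_zeroFace.mp hy).1 ?_
    have hle : Submodule.span ℝ (F : Set (FlagSpace n)) ≤
        Submodule.span ℝ (zeroFace C (φ i) : Set (FlagSpace n)) := Submodule.span_mono hi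
    rw [Submodule.eq_of_le_of_finrank_le hle
      (by have := (D.isFacet_zeroFace i).2; omega)]
    exact Submodule.subset_span hy
  · rintro ⟨i, rfl⟩
    exact D.isFacet_zeroFace i

lemma zeroFace_injective (D : DoubleDescription C W r φ) :
    Function.Injective fun i => zeroFace C (φ i) := by
  intro i k h
  by_contra hne
  obtain ⟨j, h1, h2⟩ := D.sep_forms i k hne
  have h3 : r j ∈ zeroFace C (φ k) := by
    simp only at h
    rw [← h]; exact mem_zeroFace.mpr ⟨D.ray_mem j, h1⟩
  exact h2.ne' (mem_zeroFace.mp h3).2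

/-- A linear form that is nonnegative on the generators gives the `i`-th facet if it vanishes on
the same generators as `φ i`. -/
lemma isFacetGivenBy [Nontrivial κ] (D : DoubleDescription C W r φ) {ψ : FlagSpace n →ₗ[ℝ] ℝ}
    {i : κ} (hψ : ∀ j, 0 ≤ ψ (r j)) (h : ∀ j, ψ (r j) = 0 ↔ φ i (r j) = 0) :
    IsFacetGivenBy C (zeroFace C (φ i)) ψ := by
  have hφ : ∀ j, 0 ≤ φ i (r j) := fun j => D.nonneg i (D.ray_mem j)
  refine ⟨D.isFacet_zeroFace i, fun v hv => ?_, ?_⟩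
  · obtain ⟨a, ha, rfl⟩ := (D.mem_iff_sum v).mp hv
    exact (form_sum hψ ha).1
  · ext v
    rw [SetLike.mem_coe, mem_zeroFace, Set.mem_ofPred_eq]
    refine and_congr_right fun hv => ?_
    obtain ⟨a, ha, rfl⟩ := (D.mem_iff_sum v).mp hv
    rw [(form_sum hψ ha).2, (form_sum hφ ha).2]
    refine forall_congr' fun j => ?_
    rw [(hψ j).lt_iff_ne', (hφ j).lt_iff_ne', Ne, Ne, h j]

/-- A facet is identified by the generators on it. Any inequality that gives a facet must therefore
share its zero pattern on the generators with one of the `φ i`, which can be tested on a finite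
table. -/
lemma exists_of_isFacetGivenBy [Nontrivial κ] (D : DoubleDescription C W r φ)
    {ψ : FlagSpace n → ℝ} {F : PointedCone ℝ (FlagSpace n)} (h : IsFacetGivenBy C F ψ) :
    ∃ i, F = zeroFace C (φ i) ∧ ∀ j, ψ (r j) = 0 ↔ φ i (r j) = 0 := by
  obtain ⟨h1, -, h3⟩ := h
  obtain ⟨i, rfl⟩ : F ∈ Set.range fun i => zeroFace C (φ i) := D.facets ▸ h1
  refine ⟨i, rfl, fun j => ?_⟩
  have := Set.ext_iff.mp h3 (r j)
  rw [SetLike.mem_coe, mem_zeroFace, Set.mem_ofPred_eq] at this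
  have hj := D.ray_mem j
  tauto

end DoubleDescription

/-! ### Chains with a given set of ranks -/

namespace GradedPoset

noncomputable instance (P : GradedPoset) : Fintype P := Fintype.ofFinite P

variable (P : GradedPoset)

open Classical in
/-- The chains of `P` with rank set `S`. -/
noncomputable def chains (S : Finset ℕ) : Finset (Finset P) :=
  {C | IsChain (· ≤ ·) (C : Set P) ∧ C.image (grade ℕ) = S}

open Classical in
/-- The elements of rank `t` that are comparable with all elements of `C`. -/
noncomputable def extensions (C : Finset P) (t : ℕ) : Finset P :=
  {z | grade ℕ z = t ∧ ∀ x ∈ C, x ≤ z ∨ z ≤ x}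

open Classical in
/-- The elements of rank `t` strictly between `x` and `y`. -/
noncomputable def between (x y : P) (t : ℕ) : Finset P := {z | (x < z ∧ z < y) ∧ grade ℕ z = t}

/-- The elements of `C` with rank in `S`. -/
noncomputable def restrictRanks (S : Finset ℕ) (C : Finset P) : Finset P :=
  C.filter fun x => grade ℕ x ∈ S

variable {P}

lemma mem_chains {S : Finset ℕ} {C : Finset P} :
    C ∈ P.chains S ↔ IsChain (· ≤ ·) (C : Set P) ∧ ∀ t, (∃ x ∈ C, grade ℕ x = t) ↔ t ∈ S := by
  classical
  simp [chains, Finset.ext_iff]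

lemma mem_extensions {C : Finset P} {t : ℕ} {z : P} :
    z ∈ P.extensions C t ↔ grade ℕ z = t ∧ ∀ x ∈ C, x ≤ z ∨ z ≤ x := by
  simp [extensions]

lemma mem_between {x y z : P} {t : ℕ} :
    z ∈ P.between x y t ↔ (x < z ∧ z < y) ∧ grade ℕ z = t := by
  simp [between]

lemma mem_restrictRanks {S : Finset ℕ} {C : Finset P} {x : P} :
    x ∈ P.restrictRanks S C ↔ x ∈ C ∧ grade ℕ x ∈ S := Finset.mem_filter

lemma flagNumber_eq (S : Finset ℕ) : P.flagNumber S = (P.chains S).card := by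
  classical
  have h : {C : Set P | IsChain (· ≤ ·) C ∧ (grade ℕ) '' C = (S : Set ℕ)} =
      (fun C : Finset P => (C : Set P)) '' (P.chains S : Set (Finset P)) := by
    ext C
    constructor
    · rintro ⟨h1, h2⟩
      refine ⟨C.toFinite.toFinset, ?_, C.toFinite.coe_toFinset⟩
      rw [Finset.mem_coe, mem_chains, C.toFinite.coe_toFinset]
      refine ⟨h1, fun t => ?_⟩
      have := Set.ext_iff.mp h2 t
      simpa using this
    · rintro ⟨D, hD, rfl⟩
      rw [Finset.mem_coe, mem_chains] at hD
      refine ⟨hD.1, ?_⟩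
      ext t
      simpa using hD.2 t
  rw [flagNumber, h, Set.ncard_image_of_injective _ Finset.coe_injective, Set.ncard_coe_finset]

lemma le_of_grade_le {x y : P} (h : x ≤ y ∨ y ≤ x) (hg : grade ℕ x ≤ grade ℕ y) : x ≤ y := by
  rcases h with h | h
  · exact h
  · rcases h.eq_or_lt with h | h
    · exact h.ge
    · exact absurd (grade_strictMono (𝕆 := ℕ) h) hg.not_gt

lemma lt_of_grade_lt {x y : P} (h : x ≤ y ∨ y ≤ x) (hg : grade ℕ x < grade ℕ y) : x < y :=
  (le_of_grade_le h hg.le).lt_of_ne fun e => hg.ne (e ▸ rfl)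

lemma chain_comparable {S : Finset ℕ} {C : Finset P} (hC : C ∈ P.chains S) {x y : P}
    (hx : x ∈ C) (hy : y ∈ C) : x ≤ y ∨ y ≤ x :=
  (mem_chains.mp hC).1.total hx hy

lemma grade_mem_of_mem_chains {S : Finset ℕ} {C : Finset P} (hC : C ∈ P.chains S) {x : P}
    (hx : x ∈ C) : grade ℕ x ∈ S := ((mem_chains.mp hC).2 _).mp ⟨x, hx, rfl⟩

lemma restrictRanks_mem_chains {S T : Finset ℕ} (hST : S ⊆ T) {C : Finset P}
    (hC : C ∈ P.chains T) : P.restrictRanks S C ∈ P.chains S := by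
  have hC' := mem_chains.mp hC
  refine mem_chains.mpr ⟨hC'.1.mono fun x hx => (mem_restrictRanks.mp hx).1, fun t => ?_⟩
  constructor
  · rintro ⟨x, hx, rfl⟩
    exact (mem_restrictRanks.mp hx).2
  · intro ht
    obtain ⟨x, hx, rfl⟩ := (hC'.2 t).mpr (hST ht)
    exact ⟨x, mem_restrictRanks.mpr ⟨hx, ht⟩, rfl⟩

lemma restrictRanks_restrictRanks {S T : Finset ℕ} (hST : S ⊆ T) (C : Finset P) :
    P.restrictRanks S (P.restrictRanks T C) = P.restrictRanks S C := by
  ext x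
  simp only [mem_restrictRanks]
  exact ⟨fun h => ⟨h.1.1, h.2⟩, fun h => ⟨⟨h.1, hST h.2⟩, h.2⟩⟩

lemma restrictRanks_self {S : Finset ℕ} {C : Finset P} (hC : C ∈ P.chains S) :
    P.restrictRanks S C = C :=
  Finset.filter_true_of_mem fun _ hx => grade_mem_of_mem_chains hC hx

/-- Chains with one more rank, grouped by their restrictions. -/
lemma sum_chains_insert {S : Finset ℕ} {t : ℕ} (ht : t ∉ S) (h : Finset P → ℝ) :
    ∑ D ∈ P.chains (insert t S), h (P.restrictRanks S D) =
      ∑ C ∈ P.chains S, ((P.extensions C t).card : ℝ) * h C := by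
  classical
  have hres : ∀ C ∈ P.chains S, ∀ z ∈ P.extensions C t, P.restrictRanks S (insert z C) = C := by
    intro C hC z hz
    ext x
    rw [mem_restrictRanks, Finset.mem_insert]
    constructor
    · rintro ⟨rfl | hx, hx'⟩
      · rw [(mem_extensions.mp hz).1] at hx'; exact absurd hx' ht
      · exact hx
    · exact fun hx => ⟨Or.inr hx, grade_mem_of_mem_chains hC hx⟩
  have e : ∑ C ∈ P.chains S, ((P.extensions C t).card : ℝ) * h C =
      ∑ p ∈ (P.chains S).sigma fun C => P.extensions C t, h p.1 := by
    rw [Finset.sum_sigma]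
    simp
  rw [e]
  symm
  refine Finset.sum_bij (fun p _ => insert p.2 p.1) ?_ ?_ ?_ ?_
  · rintro ⟨C, z⟩ hp
    obtain ⟨hC, hz⟩ := Finset.mem_sigma.mp hp
    simp only at hC hz
    have hz' := mem_extensions.mp hz
    have hC' := mem_chains.mp hC
    refine mem_chains.mpr ⟨?_, fun s => ?_⟩
    · rw [Finset.coe_insert]
      exact hC'.1.insert fun x hx _ => (hz'.2 x hx).symm
    · rw [Finset.mem_insert, ← hC'.2 s]
      simp only [Finset.mem_insert, exists_eq_or_imp, hz'.1]
      rw [eq_comm (a := t)]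
  · rintro ⟨C, z⟩ hp ⟨C', z'⟩ hp' heq
    obtain ⟨hC, hz⟩ := Finset.mem_sigma.mp hp
    obtain ⟨hC', hz'⟩ := Finset.mem_sigma.mp hp'
    simp only at hC hz hC' hz' heq
    have h1 : C = C' := by rw [← hres C hC z hz, heq, hres C' hC' z' hz']
    subst h1
    have h2 : z ∈ insert z' C := heq ▸ Finset.mem_insert_self z C
    rcases Finset.mem_insert.mp h2 with h2 | h2
    · rw [h2]
    · have := grade_mem_of_mem_chains hC h2
      rw [(mem_extensions.mp hz).1] at this
      exact absurd this ht
  · intro D hD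
    have hD' := mem_chains.mp hD
    obtain ⟨z, hz, hzt⟩ := (hD'.2 t).mpr (Finset.mem_insert_self t S)
    refine ⟨⟨P.restrictRanks S D, z⟩, ?_, ?_⟩
    · refine Finset.mem_sigma.mpr ⟨restrictRanks_mem_chains (Finset.subset_insert t S) hD, ?_⟩
      exact mem_extensions.mpr ⟨hzt, fun x hx =>
        chain_comparable hD (mem_restrictRanks.mp hx).1 hz⟩
    · ext x
      simp only [Finset.mem_insert, mem_restrictRanks]
      constructor
      · rintro (rfl | hx)
        · exact hz
        · exact hx.1
      · intro hx
        rcases Finset.mem_insert.mp (grade_mem_of_mem_chains hD hx) with h | h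
        · left
          have h1 := chain_comparable hD hx hz
          exact le_antisymm (le_of_grade_le h1 (by rw [h, hzt]))
            (le_of_grade_le h1.symm (by rw [h, hzt]))
        · exact Or.inr ⟨hx, h⟩
  · rintro ⟨C, z⟩ hp
    obtain ⟨hC, hz⟩ := Finset.mem_sigma.mp hp
    simp only at hC hz ⊢
    rw [hres C hC z hz]

lemma flagNumber_insert {S : Finset ℕ} {t : ℕ} (ht : t ∉ S) :
    (P.flagNumber (insert t S) : ℝ) = ∑ C ∈ P.chains S, ((P.extensions C t).card : ℝ) := by
  have := sum_chains_insert (P := P) ht fun _ => 1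
  simpa [flagNumber_eq] using this

/-- An element of `D` with rank in `R` is separated from rank `t` by an element of `D` with rank in
`S`. Comparability with the separating element implies comparability with the farther one by
transitivity. -/
lemma extensions_restrictRanks {S R : Finset ℕ} {t : ℕ}
    (hsep : ∀ r ∈ R, ∃ s ∈ S, (r < s ∧ s < t) ∨ (t < s ∧ s < r)) {D : Finset P}
    (hD : D ∈ P.chains (S ∪ R)) :
    P.extensions (P.restrictRanks S D) t = P.extensions D t := by
  ext z
  simp only [mem_extensions, mem_restrictRanks]
  refine and_congr_right fun hz => ⟨fun h x hx => ?_, fun h x hx => h x hx.1⟩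
  rcases Finset.mem_union.mp (grade_mem_of_mem_chains hD hx) with hx' | hx'
  · exact h x ⟨hx, hx'⟩
  · obtain ⟨s, hs, hcase⟩ := hsep _ hx'
    obtain ⟨y, hy, rfl⟩ := ((mem_chains.mp hD).2 s).mpr (Finset.mem_union_left _ hs)
    have h1 := chain_comparable hD hx hy
    have h2 := h y ⟨hy, hs⟩
    rcases hcase with ⟨h3, h4⟩ | ⟨h3, h4⟩
    · exact Or.inl ((lt_of_grade_lt h1 h3).le.trans (lt_of_grade_lt h2 (hz ▸ h4)).le)
    · exact Or.inr ((lt_of_grade_lt h2.symm (hz ▸ h3)).le.trans (lt_of_grade_lt h1.symm h4).le)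

/-- Chains whose additional ranks are separated by `S`, grouped by their restrictions to `S`. -/
lemma sum_chains_union {S T : Finset ℕ} (hST : Disjoint S T)
    (hsep : ∀ t ∈ T, ∀ r ∈ T, r ≠ t → ∃ s ∈ S, (r < s ∧ s < t) ∨ (t < s ∧ s < r))
    {R : Finset ℕ} (hR : R ⊆ T) (h : Finset P → ℝ) :
    ∑ D ∈ P.chains (S ∪ R), h (P.restrictRanks S D) =
      ∑ C ∈ P.chains S, h C * ∏ t ∈ R, ((P.extensions C t).card : ℝ) := by
  classical
  induction R using Finset.induction_on generalizing h with
  | empty =>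
    simp only [Finset.union_empty, Finset.prod_empty, mul_one]
    exact Finset.sum_congr rfl fun D hD => by rw [restrictRanks_self hD]
  | insert t R ht ih =>
    have htT := hR (Finset.mem_insert_self t R)
    have hRT : R ⊆ T := fun r hr => hR (Finset.mem_insert_of_mem hr)
    have htS : t ∉ S ∪ R := by
      rw [Finset.mem_union, not_or]
      exact ⟨fun h => Finset.disjoint_left.mp hST h htT, ht⟩
    have h1 := sum_chains_insert (P := P) htS fun D => h (P.restrictRanks S D)
    simp only [restrictRanks_restrictRanks Finset.subset_union_left] at h1
    rw [Finset.union_insert, h1]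
    -- The number of extensions at `t` depends only on the restriction to `S`, so it can be absorbed
    -- into the weight `h` and the induction hypothesis applies again.
    have h2 : ∀ D ∈ P.chains (S ∪ R), ((P.extensions D t).card : ℝ) * h (P.restrictRanks S D) =
        (fun C => ((P.extensions C t).card : ℝ) * h C) (P.restrictRanks S D) := fun D hD => by
      simp only
      rw [extensions_restrictRanks (fun r hr => hsep t htT r (hRT hr) fun e => ht (e ▸ hr)) hD]
    rw [Finset.sum_congr rfl h2, ih hRT fun C => ((P.extensions C t).card : ℝ) * h C]
    refine Finset.sum_congr rfl fun C _ => ?_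
    rw [Finset.prod_insert ht]
    ring

lemma flagNumber_union {S T : Finset ℕ} (hST : Disjoint S T)
    (hsep : ∀ t ∈ T, ∀ r ∈ T, r ≠ t → ∃ s ∈ S, (r < s ∧ s < t) ∨ (t < s ∧ s < r))
    {R : Finset ℕ} (hR : R ⊆ T) :
    (P.flagNumber (S ∪ R) : ℝ) =
      ∑ C ∈ P.chains S, ∏ t ∈ R, ((P.extensions C t).card : ℝ) := by
  have := sum_chains_union (P := P) hST hsep hR fun _ => 1
  simpa [flagNumber_eq] using this

/-- Only the neighbours `x`, `y` of the gap containing `t` matter; all other elements of the chain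
lie beyond them. If the gap reaches the end of the chain, `⊥` or `⊤` acts as neighbour. -/
lemma extensions_eq_between {S : Finset ℕ} {C : Finset P} (hC : C ∈ P.chains S) {x y : P}
    (hx : x = ⊥ ∨ x ∈ C) (hy : y = ⊤ ∨ y ∈ C)
    (hgap : ∀ s ∈ S, s ≤ grade ℕ x ∨ grade ℕ y ≤ s) {t : ℕ} (hxt : grade ℕ x < t)
    (hty : t < grade ℕ y) : P.extensions C t = P.between x y t := by
  ext z
  rw [mem_extensions, mem_between, and_comm]
  refine and_congr_left fun hz => ⟨fun h => ?_, fun h c hc => ?_⟩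
  · subst hz
    refine ⟨lt_of_grade_lt ?_ hxt, lt_of_grade_lt ?_ hty⟩
    · rcases hx with rfl | hx
      · exact Or.inl bot_le
      · exact h x hx
    · rcases hy with rfl | hy
      · exact Or.inl le_top
      · exact (h y hy).symm
  · rcases hgap _ (grade_mem_of_mem_chains hC hc) with hg | hg
    · left
      refine le_trans (le_of_grade_le ?_ hg) h.1.le
      rcases hx with rfl | hx
      · exact Or.inr bot_le
      · exact chain_comparable hC hc hx
    · right
      refine h.2.le.trans (le_of_grade_le ?_ hg)
      rcases hy with rfl | hy
      · exact Or.inr le_top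
      · exact chain_comparable hC hy hc

/-! ### Consequences of the Eulerian property -/

lemma exists_grade_eq {x y : P} (hxy : x < y) {t : ℕ} (hxt : grade ℕ x < t)
    (hty : t < grade ℕ y) : ∃ z, (x < z ∧ z < y) ∧ grade ℕ z = t := by
  obtain ⟨d, hd⟩ : ∃ d, d = grade ℕ y - grade ℕ x := ⟨_, rfl⟩
  induction d using Nat.strong_induction_on generalizing x y with
  | _ d ih =>
    obtain ⟨u, hxu, huy⟩ := P.exists_between hxy (by omega)
    have h1 := grade_strictMono (𝕆 := ℕ) hxu
    have h2 := grade_strictMono (𝕆 := ℕ) huy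
    rcases lt_trichotomy (grade ℕ u) t with h | h | h
    · obtain ⟨z, hz, hzt⟩ := ih _ (by omega) huy h hty rfl
      exact ⟨z, ⟨hxu.trans hz.1, hz.2⟩, hzt⟩
    · exact ⟨u, ⟨hxu, huy⟩, h⟩
    · obtain ⟨z, hz, hzt⟩ := ih _ (by omega) hxu hxt h rfl
      exact ⟨z, ⟨hz.1, hz.2.trans huy⟩, hzt⟩

open Classical in
/-- In an Eulerian poset the alternating sum over an open interval is as in a sphere. -/
lemma IsEulerian.sum_Ioo (hP : P.IsEulerian) {x y : P} (hxy : x < y) :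
    ∑ z with x < z ∧ z < y, (-1 : ℤ) ^ (grade ℕ z - grade ℕ x) =
      -1 - (-1) ^ (grade ℕ y - grade ℕ x) := by
  let _ : LocallyFiniteOrder P := Fintype.toLocallyFiniteOrder
  have h : ∀ x y : P, x ≤ y →
      IncidenceAlgebra.mu ℤ x y = (-1) ^ (grade ℕ y - grade ℕ x) := hP
  have h1 := IncidenceAlgebra.sum_Icc_mu_right (𝕜 := ℤ) x y
  rw [if_neg hxy.ne, Finset.sum_congr rfl fun z hz => h x z (Finset.mem_Icc.mp hz).1] at h1
  have h2 : (Finset.Icc x y : Finset P) =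
      insert x (insert y ({z | x < z ∧ z < y} : Finset P)) := by
    ext z
    simp only [Finset.mem_Icc, Finset.mem_insert, Finset.mem_filter, Finset.mem_univ, true_and]
    constructor
    · rintro ⟨h1, h2⟩
      rcases h1.eq_or_lt with h1 | h1
      · exact Or.inl h1.symm
      · rcases h2.eq_or_lt with h2 | h2
        · exact Or.inr (Or.inl h2)
        · exact Or.inr (Or.inr ⟨h1, h2⟩)
    · rintro (rfl | rfl | h)
      · exact ⟨le_rfl, hxy.le⟩
      · exact ⟨hxy.le, le_rfl⟩
      · exact ⟨h.1.le, h.2.le⟩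
  rw [h2, Finset.sum_insert (by simp [hxy.ne]), Finset.sum_insert (by simp), Nat.sub_self,
    pow_zero] at h1
  linarith

/-- This is `IsEulerian.sum_Ioo` with the open interval sorted by rank. -/
lemma IsEulerian.sum_between (hP : P.IsEulerian) {x y : P} (hxy : x < y) :
    ∑ t ∈ Finset.Ioo (grade ℕ x) (grade ℕ y),
      (-1 : ℤ) ^ (t - grade ℕ x) * ((P.between x y t).card : ℤ) =
        -1 - (-1) ^ (grade ℕ y - grade ℕ x) := by
  classical
  have hmap : ∀ z ∈ ({z | x < z ∧ z < y} : Finset P),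
      grade ℕ z ∈ Finset.Ioo (grade ℕ x) (grade ℕ y) := fun z hz => by
    have hz := (Finset.mem_filter.mp hz).2
    exact Finset.mem_Ioo.mpr ⟨grade_strictMono hz.1, grade_strictMono hz.2⟩
  rw [← hP.sum_Ioo hxy, ← Finset.sum_fiberwise_of_maps_to hmap]
  refine Finset.sum_congr rfl fun t _ => ?_
  rw [Finset.filter_filter, Finset.sum_congr rfl (g := fun _ => (-1 : ℤ) ^ (t - grade ℕ x))
    fun z hz => by rw [(Finset.mem_filter.mp hz).2.2], Finset.sum_const, nsmul_eq_mul, mul_comm]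
  rfl

/-- In an Eulerian poset every intermediate rank of an interval has at least two elements. -/
lemma IsEulerian.two_le_card_between (hP : P.IsEulerian) {x y : P} (hxy : x < y) {t : ℕ}
    (hxt : grade ℕ x < t) (hty : t < grade ℕ y) : 2 ≤ (P.between x y t).card := by
  obtain ⟨z, hz, hzt⟩ := exists_grade_eq hxy hxt hty
  -- It suffices to look at an interval `[a, b]` of length 2 around one element `z` of rank `t`.
  -- There the alternating sum has a single term and gives exactly two middle elements.
  obtain ⟨a, hxa, haz, ha⟩ : ∃ a, x ≤ a ∧ a < z ∧ grade ℕ a + 1 = t := by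
    by_cases h : grade ℕ x + 1 = t
    · exact ⟨x, le_rfl, hz.1, h⟩
    · obtain ⟨a, h1, h2⟩ := exists_grade_eq hz.1 (t := t - 1) (by omega) (by omega)
      exact ⟨a, h1.1.le, h1.2, by omega⟩
  obtain ⟨b, hzb, hby, hb⟩ : ∃ b, z < b ∧ b ≤ y ∧ grade ℕ b = t + 1 := by
    by_cases h : grade ℕ y = t + 1
    · exact ⟨y, hz.2, le_rfl, h⟩
    · obtain ⟨b, h1, h2⟩ := exists_grade_eq hz.2 (t := t + 1) (by omega) (by omega)
      exact ⟨b, h1.1, h1.2.le, h2⟩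
  have h := hP.sum_between (haz.trans hzb)
  have e : Finset.Ioo (grade ℕ a) (grade ℕ b) = {t} := by
    ext s; rw [Finset.mem_Ioo, Finset.mem_singleton]; omega
  have e1 : t - grade ℕ a = 1 := by omega
  have e2 : grade ℕ b - grade ℕ a = 2 := by omega
  rw [e, Finset.sum_singleton, e1, e2] at h
  have h3 : (P.between a b t).card = 2 := by
    norm_num at h
    exact_mod_cast h
  rw [← h3]
  refine Finset.card_le_card fun w hw => ?_
  have hw := mem_between.mp hw
  exact mem_between.mpr ⟨⟨hxa.trans_lt hw.1.1, hw.1.2.trans_le hby⟩, hw.2⟩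

lemma IsEulerian.two_le_card_extensions (hP : P.IsEulerian) {n : ℕ} (hr : P.totalRank = n + 1)
    {S : Finset ℕ} {C : Finset P} (hC : C ∈ P.chains S) {t : ℕ} (ht : t ∉ S)
    (ht1 : 1 ≤ t) (htn : t ≤ n) : 2 ≤ (P.extensions C t).card := by
  classical
  have hbot : grade ℕ (⊥ : P) = 0 := grade_bot
  have htop : grade ℕ (⊤ : P) = n + 1 := hr
  obtain ⟨x, hx, hxmax⟩ := Finset.exists_max_image
    ((insert ⊥ C).filter fun c => grade ℕ c < t) (grade ℕ)
    ⟨⊥, Finset.mem_filter.mpr ⟨Finset.mem_insert_self _ _, by omega⟩⟩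
  obtain ⟨y, hy, hymin⟩ := Finset.exists_min_image
    ((insert ⊤ C).filter fun c => t < grade ℕ c) (grade ℕ)
    ⟨⊤, Finset.mem_filter.mpr ⟨Finset.mem_insert_self _ _, by omega⟩⟩
  rw [Finset.mem_filter, Finset.mem_insert] at hx hy
  have hgap : ∀ s ∈ S, s ≤ grade ℕ x ∨ grade ℕ y ≤ s := fun s hs => by
    obtain ⟨c, hc, rfl⟩ := ((mem_chains.mp hC).2 s).mpr hs
    rcases lt_trichotomy (grade ℕ c) t with h | h | h
    · exact Or.inl (hxmax c (Finset.mem_filter.mpr ⟨Finset.mem_insert_of_mem hc, h⟩))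
    · exact absurd (h ▸ hs) ht
    · exact Or.inr (hymin c (Finset.mem_filter.mpr ⟨Finset.mem_insert_of_mem hc, h⟩))
  rw [extensions_eq_between hC hx.1 hy.1 hgap hx.2 hy.2]
  refine hP.two_le_card_between (lt_of_grade_lt ?_ (hx.2.trans hy.2)) hx.2 hy.2
  rcases hx.1 with h | h
  · exact Or.inl (h ▸ bot_le)
  · rcases hy.1 with h' | h'
    · exact Or.inl (h' ▸ le_top)
    · exact chain_comparable hC h h'

end GradedPoset

/-! ### Unions of complete bipartite graphs -/

section Bipartite

variable {α β γ : Type*} [DecidableEq α] [DecidableEq β] [DecidableEq γ]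
  (a : β → Finset α) (b : β → Finset γ)

/-- For the union of the complete bipartite graphs on `a y`, `b y` (`y ∈ Z`): the number of edges,
minus twice the number of vertices, plus twice the number of graphs. -/
def bipartiteExcess (Z : Finset β) : ℤ :=
  ((Z.biUnion fun y => a y ×ˢ b y).card : ℤ) + 2 * Z.card - 2 * (Z.biUnion a).card -
    2 * (Z.biUnion b).card

variable {a b}

/-- Inclusion-exclusion for the two vertex sets and the edges. Let `p` and `q` be the numbers of
vertices that the new graph shares with the old ones on the two sides. At most `p * q` of its edges
are old, and the resulting bound factors as a difference of products shifted by 2. -/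
lemma bipartiteExcess_insert {Z : Finset β} {y : β} (hy : y ∉ Z) :
    bipartiteExcess a b Z +
      ((((a y).card : ℤ) - 2) * ((b y).card - 2) -
        ((a y ∩ Z.biUnion a).card - 2) * ((b y ∩ Z.biUnion b).card - 2) + 2) ≤
      bipartiteExcess a b (insert y Z) := by
  have h1 : (((insert y Z).biUnion a).card : ℤ) =
      (Z.biUnion a).card + (a y).card - (a y ∩ Z.biUnion a).card := by
    have := Finset.card_union_add_card_inter (a y) (Z.biUnion a)
    rw [Finset.biUnion_insert]
    omega
  have h2 : (((insert y Z).biUnion b).card : ℤ) =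
      (Z.biUnion b).card + (b y).card - (b y ∩ Z.biUnion b).card := by
    have := Finset.card_union_add_card_inter (b y) (Z.biUnion b)
    rw [Finset.biUnion_insert]
    omega
  have h3 : (Z.biUnion fun y => a y ×ˢ b y).card + (a y).card * (b y).card ≤
      ((insert y Z).biUnion fun y => a y ×ˢ b y).card +
        (a y ∩ Z.biUnion a).card * (b y ∩ Z.biUnion b).card := by
    have := Finset.card_union_add_card_inter (a y ×ˢ b y) (Z.biUnion fun y => a y ×ˢ b y)
    rw [Finset.card_product] at this
    have hc := Finset.card_product (a y ∩ Z.biUnion a) (b y ∩ Z.biUnion b)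
    rw [Finset.biUnion_insert]
    have h : ((a y ×ˢ b y) ∩ (Z.biUnion fun y => a y ×ˢ b y)).card ≤
        ((a y ∩ Z.biUnion a) ×ˢ (b y ∩ Z.biUnion b)).card := by
      apply Finset.card_le_card
      rintro ⟨x, z⟩ hxz
      simp only [Finset.mem_inter, Finset.mem_product, Finset.mem_biUnion] at hxz ⊢
      obtain ⟨⟨hx, hz⟩, w, hw, hxw, hzw⟩ := hxz
      exact ⟨⟨hx, w, hw, hxw⟩, hz, w, hw, hzw⟩
    omega
  have h4 : ((insert y Z).card : ℤ) = Z.card + 1 := by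
    rw [Finset.card_insert_of_notMem hy]; push_cast; ring
  unfold bipartiteExcess
  rw [h1, h2, h4]
  zify at h3
  linarith

/-- With `p ≤ A` and `q ≤ B`, the increment `(A - 2) * (B - 2) - (p - 2) * (q - 2) + 2` can be
negative only for `p = q = 0`, and then it is at least `-2`. -/
lemma bipartiteExcess_le_insert {Z : Finset β} {y : β} (hy : y ∉ Z) (ha : 2 ≤ (a y).card)
    (hb : 2 ≤ (b y).card) : bipartiteExcess a b Z - 2 ≤ bipartiteExcess a b (insert y Z) ∧
      ((a y ∩ Z.biUnion a).Nonempty ∨ (b y ∩ Z.biUnion b).Nonempty →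
        bipartiteExcess a b Z ≤ bipartiteExcess a b (insert y Z)) := by
  have h := bipartiteExcess_insert (a := a) (b := b) hy
  have hp := Finset.card_le_card (Finset.inter_subset_left (s₁ := a y) (s₂ := Z.biUnion a))
  have hq := Finset.card_le_card (Finset.inter_subset_left (s₁ := b y) (s₂ := Z.biUnion b))
  rw [← Finset.card_pos, ← Finset.card_pos]
  generalize (a y ∩ Z.biUnion a).card = p at *
  generalize (b y ∩ Z.biUnion b).card = q at *
  zify at *
  generalize ((a y).card : ℤ) = A at *
  generalize ((b y).card : ℤ) = B at *
  have hp0 : (0 : ℤ) ≤ p := by positivity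
  have hq0 : (0 : ℤ) ≤ q := by positivity
  have hAB : 0 ≤ (A - 2) * (B - 2) := mul_nonneg (by linarith) (by linarith)
  rcases lt_or_ge (p : ℤ) 2 with hp2 | hp2 <;> rcases lt_or_ge (q : ℤ) 2 with hq2 | hq2
  · have hp3 : p = 0 ∨ p = 1 := by omega
    have hq3 : q = 0 ∨ q = 1 := by omega
    rcases hp3 with rfl | rfl <;> rcases hq3 with rfl | rfl <;> norm_num at h ⊢ <;>
      first | linarith | exact ⟨by linarith, by linarith⟩
  · have : ((p : ℤ) - 2) * (q - 2) ≤ 0 :=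
      mul_nonpos_of_nonpos_of_nonneg (by linarith) (by linarith)
    exact ⟨by linarith, fun _ => by linarith⟩
  · have : ((p : ℤ) - 2) * (q - 2) ≤ 0 :=
      mul_nonpos_of_nonneg_of_nonpos (by linarith) (by linarith)
    exact ⟨by linarith, fun _ => by linarith⟩
  · have : ((p : ℤ) - 2) * (q - 2) ≤ (A - 2) * (B - 2) :=
      mul_le_mul (by linarith) (by linarith) (by linarith) (by linarith)
    exact ⟨by linarith, fun _ => by linarith⟩

/-- If every vertex is covered at least twice, then the number of edges plus twice the number of
complete bipartite graphs is at least twice the number of vertices. -/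
lemma bipartiteExcess_nonneg (Y : Finset β) (ha : ∀ y ∈ Y, 2 ≤ (a y).card)
    (hb : ∀ y ∈ Y, 2 ≤ (b y).card) (ha' : ∀ y ∈ Y, ∀ x ∈ a y, ∃ w ∈ Y, w ≠ y ∧ x ∈ a w)
    (hb' : ∀ y ∈ Y, ∀ x ∈ b y, ∃ w ∈ Y, w ≠ y ∧ x ∈ b w) : 0 ≤ bipartiteExcess a b Y := by
  -- Take a largest subfamily `Z` of nonnegative excess. If it is proper, a strictly larger one is
  -- constructed.
  obtain ⟨Z, hZ, hZmax⟩ := Finset.exists_max_image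
    (Y.powerset.filter fun Z => 0 ≤ bipartiteExcess a b Z) Finset.card
    ⟨∅, by simp [bipartiteExcess]⟩
  rw [Finset.mem_filter, Finset.mem_powerset] at hZ
  obtain ⟨hZY, hZ0⟩ := hZ
  rcases hZY.eq_or_ssubset with rfl | hss
  · exact hZ0
  exfalso
  obtain ⟨y₀, hy₀, hy₀Z⟩ := Finset.exists_of_ssubset hss
  -- One further graph lowers the excess by at most 2, and adding graphs that meet the current union
  -- does not lower it again. Take a largest family `Z'` of this kind. The element `y` is a last
  -- addition, for which the bound `-2` also holds after its removal.
  obtain ⟨Z', hZ', hmax⟩ := Finset.exists_max_image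
    (Y.powerset.filter fun Z' => Z ⊂ Z' ∧ ∃ y ∈ Z', y ∉ Z ∧ -2 ≤ bipartiteExcess a b (Z'.erase y) ∧
      -2 ≤ bipartiteExcess a b Z') Finset.card ⟨insert y₀ Z, by
        rw [Finset.mem_filter, Finset.mem_powerset]
        refine ⟨Finset.insert_subset hy₀ hZY, Finset.ssubset_insert hy₀Z, y₀,
          Finset.mem_insert_self _ _, hy₀Z, ?_, ?_⟩
        · rw [Finset.erase_insert hy₀Z]; linarith
        · have := (bipartiteExcess_le_insert hy₀Z (ha _ hy₀) (hb _ hy₀)).1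
          linarith⟩
  rw [Finset.mem_filter, Finset.mem_powerset] at hZ'
  obtain ⟨hZ'Y, hZZ', y, hyZ', hyZ, hE, hE'⟩ := hZ'
  -- By maximality, no graph outside `Z'` meets a vertex covered by `Z'`.
  have hclosed : ∀ w ∈ Y, w ∉ Z' →
      ¬((a w ∩ Z'.biUnion a).Nonempty ∨ (b w ∩ Z'.biUnion b).Nonempty) := fun w hw hwZ' h => by
    have h1 := (bipartiteExcess_le_insert hwZ' (ha w hw) (hb w hw)).2 h
    have h2 := hmax (insert w Z') (by
      rw [Finset.mem_filter, Finset.mem_powerset]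
      refine ⟨Finset.insert_subset hw hZ'Y, hZZ'.trans (Finset.ssubset_insert hwZ'), w,
        Finset.mem_insert_self _ _, fun h => hwZ' (hZZ'.1 h), ?_, by linarith⟩
      rwa [Finset.erase_insert hwZ'])
    rw [Finset.card_insert_of_notMem hwZ'] at h2
    omega
  have hyY := hZ'Y hyZ'
  -- Every vertex of `y` is covered by a second graph, which belongs to `Z'` by closedness. So `y`
  -- adds no new vertices to the rest of `Z'`.
  have hfa : a y ∩ (Z'.erase y).biUnion a = a y := Finset.inter_eq_left.mpr fun x hx => by
    obtain ⟨w, hw, hwy, hxw⟩ := ha' y hyY x hx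
    refine Finset.mem_biUnion.mpr ⟨w, Finset.mem_erase.mpr ⟨hwy, ?_⟩, hxw⟩
    by_contra hwZ'
    exact hclosed w hw hwZ' (Or.inl ⟨x, Finset.mem_inter.mpr
      ⟨hxw, Finset.mem_biUnion.mpr ⟨y, hyZ', hx⟩⟩⟩)
  have hfb : b y ∩ (Z'.erase y).biUnion b = b y := Finset.inter_eq_left.mpr fun x hx => by
    obtain ⟨w, hw, hwy, hxw⟩ := hb' y hyY x hx
    refine Finset.mem_biUnion.mpr ⟨w, Finset.mem_erase.mpr ⟨hwy, ?_⟩, hxw⟩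
    by_contra hwZ'
    exact hclosed w hw hwZ' (Or.inr ⟨x, Finset.mem_inter.mpr
      ⟨hxw, Finset.mem_biUnion.mpr ⟨y, hyZ', hx⟩⟩⟩)
  -- Now `p = A` and `q = B`, the two products cancel, and the excess rises from at least `-2` by at
  -- least 2. Thus `Z'` has nonnegative excess, against the choice of `Z`.
  have h := bipartiteExcess_insert (a := a) (b := b) (Finset.notMem_erase y Z')
  rw [hfa, hfb, Finset.insert_erase hyZ'] at h
  have h1 := hZmax Z' (by
    rw [Finset.mem_filter, Finset.mem_powerset]
    exact ⟨hZ'Y, by linarith⟩)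
  have h2 := Finset.card_lt_card hZZ'
  omega

end Bipartite

/-! ### Linear relations and inequalities for flag vectors -/

lemma coord_add {n : ℕ} (v w : FlagSpace n) (S : Finset ℕ) :
    coord (v + w) S = coord v S + coord w S := by
  unfold coord; split_ifs <;> simp

lemma coord_smul {n : ℕ} (a : ℝ) (v : FlagSpace n) (S : Finset ℕ) :
    coord (a • v) S = a * coord v S := by
  unfold coord; split_ifs <;> simp

/-- The coordinate `f_S` as a linear form. -/
noncomputable def coordForm (n : ℕ) (S : Finset ℕ) : FlagSpace n →ₗ[ℝ] ℝ where
  toFun v := coord v S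
  map_add' v w := coord_add v w S
  map_smul' a v := coord_smul a v S

lemma coord_mk {n : ℕ} (v : FlagSpace n) (S : RankSet n) : coord v S = v S := dif_pos S.2

lemma coord_flagVector {n : ℕ} (P : GradedPoset) {S : Finset ℕ} (hS : S ⊆ Finset.Icc 1 n) :
    coord (flagVector n P) S = P.flagNumber S :=
  dif_pos (Finset.mem_powerset.mpr hS)

/-- The generalized Dehn-Sommerville relations. -/
def IsDehnSommerville (n : ℕ) (u : Finset ℕ → ℝ) : Prop :=
  ∀ S ⊆ Finset.Icc 1 n, ∀ i k, i ∈ insert 0 S → k ∈ insert (n + 1) S → i < k →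
    (∀ s ∈ S, s ≤ i ∨ k ≤ s) →
    ∑ j ∈ Finset.Ioo i k, (-1) ^ (j - i) * u (insert j S) = (-1 - (-1) ^ (k - i)) * u S

/-- The subspace of solutions of the generalized Dehn-Sommerville relations. -/
noncomputable def dehnSommervilleSpace (n : ℕ) : Submodule ℝ (FlagSpace n) where
  carrier := {v | IsDehnSommerville n (coord v)}
  zero_mem' := fun S _ i k _ _ _ _ => by
    have h : ∀ S, coord (0 : FlagSpace n) S = 0 := fun S => (coordForm n S).map_zero
    simp [h]
  add_mem' := fun {v w} hv hw S hS i k hi hk hik hg => by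
    simp only [coord_add, mul_add, Finset.sum_add_distrib]
    rw [hv S hS i k hi hk hik hg, hw S hS i k hi hk hik hg]
  smul_mem' := fun a v hv S hS i k hi hk hik hg => by
    have e : ∀ j, (-1 : ℝ) ^ (j - i) * (a * coord v (insert j S)) =
        a * ((-1) ^ (j - i) * coord v (insert j S)) := fun j => by ring
    simp only [coord_smul, e, ← Finset.mul_sum]
    rw [hv S hS i k hi hk hik hg]
    ring

/-- A solution of the generalized Dehn-Sommerville relations is determined by its values on the
sets `S ⊆ [1, n - 1]` without two consecutive elements. -/
lemma IsDehnSommerville.eq_zero {n : ℕ} {u : Finset ℕ → ℝ} (hu : IsDehnSommerville n u)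
    (h0 : ∀ S ⊆ Finset.Icc 1 n, (∀ s ∈ S, s + 1 ∉ insert (n + 1) S) → u S = 0)
    {S : Finset ℕ} (hS : S ⊆ Finset.Icc 1 n) : u S = 0 := by
  -- Induction on the sum of the elements: a set with consecutive elements `t`, `t + 1` is expressed
  -- through sets of smaller sum, where `n + 1` counts as an element.
  obtain ⟨d, hd⟩ : ∃ d, d = ∑ s ∈ S, s := ⟨_, rfl⟩
  induction d using Nat.strong_induction_on generalizing S with
  | _ d ih =>
    by_cases hsp : ∀ s ∈ S, s + 1 ∉ insert (n + 1) S
    · exact h0 S hS hsp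
    push Not at hsp
    obtain ⟨t, ht, htS⟩ := hsp
    have ht1 := Finset.mem_Icc.mp (hS ht)
    have hRS : S.erase t ⊆ Finset.Icc 1 n := (Finset.erase_subset _ _).trans hS
    have hsum : ∑ s ∈ S.erase t, s + t = ∑ s ∈ S, s := Finset.sum_erase_add S (fun s => s) ht
    obtain ⟨i, hi, himax⟩ := Finset.exists_max_image
      ((insert 0 (S.erase t)).filter fun s => s < t) id
      ⟨0, Finset.mem_filter.mpr ⟨Finset.mem_insert_self _ _, by omega⟩⟩
    rw [Finset.mem_filter] at hi
    have hk : t + 1 ∈ insert (n + 1) (S.erase t) := by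
      rcases Finset.mem_insert.mp htS with h | h
      · rw [h]; exact Finset.mem_insert_self _ _
      · exact Finset.mem_insert_of_mem (Finset.mem_erase.mpr ⟨by omega, h⟩)
    -- The relation for `S.erase t` and the gap from `i` to `t + 1`: the term `j = t` is `u S` up to
    -- sign, and every other `j` in the gap is smaller than `t`.
    have h := hu _ hRS i (t + 1) hi.1 hk (by omega) fun s hs => by
      rcases lt_trichotomy s t with h | h | h
      · exact Or.inl (himax s (Finset.mem_filter.mpr ⟨Finset.mem_insert_of_mem hs, h⟩))
      · exact absurd h (Finset.mem_erase.mp hs).1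
      · exact Or.inr h
    rw [ih _ (by omega) hRS rfl, mul_zero, Finset.sum_eq_single t] at h
    · rw [Finset.insert_erase ht] at h
      exact (mul_eq_zero.mp h).resolve_left (pow_ne_zero _ (by norm_num))
    · intro j hj hjt
      rw [Finset.mem_Ioo] at hj
      have hjS : j ∉ S.erase t := fun hjS => by
        have : j ≤ i := himax j (Finset.mem_filter.mpr ⟨Finset.mem_insert_of_mem hjS, by omega⟩)
        omega
      rw [ih _ _ _ rfl, mul_zero]
      · rw [Finset.sum_insert hjS]; omega
      · exact Finset.insert_subset (Finset.mem_Icc.mpr (by omega)) hRS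
    · intro hj
      exact absurd (Finset.mem_Ioo.mpr ⟨hi.2, by omega⟩) hj

/-! ### Validity of the relations and inequalities for Eulerian posets -/

namespace GradedPoset

variable {P : GradedPoset} {n : ℕ}

/-- For each chain with rank set `S`, the elements filling the gap between ranks `i` and `k` are
those of an open interval, whose alternating sum is prescribed by the Eulerian property. Summation
over the chains gives the relation. -/
lemma IsEulerian.flagVector_mem (hP : P.IsEulerian) (hr : P.totalRank = n + 1) :
    flagVector n P ∈ dehnSommervilleSpace n := by
  intro S hS i k hi hk hik hg
  have hbot : grade ℕ (⊥ : P) = 0 := grade_bot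
  have htop : grade ℕ (⊤ : P) = n + 1 := hr
  have hkn : k ≤ n + 1 := by
    rcases Finset.mem_insert.mp hk with h | h
    · omega
    · have := Finset.mem_Icc.mp (hS h); omega
  have e : ∀ j ∈ Finset.Ioo i k, (-1 : ℝ) ^ (j - i) * coord (flagVector n P) (insert j S) =
      ∑ C ∈ P.chains S, (-1 : ℝ) ^ (j - i) * ((P.extensions C j).card : ℝ) := fun j hj => by
    rw [Finset.mem_Ioo] at hj
    rw [coord_flagVector P (Finset.insert_subset (Finset.mem_Icc.mpr (by omega)) hS),
      flagNumber_insert, Finset.mul_sum]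
    intro h
    rcases hg j h with h | h <;> omega
  rw [Finset.sum_congr rfl e, Finset.sum_comm, coord_flagVector P hS, flagNumber_eq, mul_comm,
    ← nsmul_eq_mul, ← Finset.sum_const]
  refine Finset.sum_congr rfl fun C hC => ?_
  obtain ⟨x, hx, hxi⟩ : ∃ x, (x = ⊥ ∨ x ∈ C) ∧ grade ℕ x = i := by
    rcases Finset.mem_insert.mp hi with h | h
    · exact ⟨⊥, Or.inl rfl, by omega⟩
    · obtain ⟨x, hx, hxi⟩ := ((mem_chains.mp hC).2 i).mpr h
      exact ⟨x, Or.inr hx, hxi⟩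
  obtain ⟨y, hy, hyk⟩ : ∃ y, (y = ⊤ ∨ y ∈ C) ∧ grade ℕ y = k := by
    rcases Finset.mem_insert.mp hk with h | h
    · exact ⟨⊤, Or.inl rfl, by omega⟩
    · obtain ⟨y, hy, hyk⟩ := ((mem_chains.mp hC).2 k).mpr h
      exact ⟨y, Or.inr hy, hyk⟩
  subst hxi hyk
  have hxy : x < y := by
    refine lt_of_grade_lt ?_ hik
    rcases hx with h | h
    · exact Or.inl (h ▸ bot_le)
    · rcases hy with h' | h'
      · exact Or.inl (h' ▸ le_top)
      · exact chain_comparable hC h h'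
  have h := hP.sum_between hxy
  rw [Finset.sum_congr rfl fun j hj => by
    rw [extensions_eq_between hC hx hy hg (Finset.mem_Ioo.mp hj).1 (Finset.mem_Ioo.mp hj).2]]
  exact_mod_cast h

/-- The inequality obtained by multiplying the numbers of elements in the gaps of a chain. -/
lemma IsEulerian.inequalityForm_nonneg (hP : P.IsEulerian) (hr : P.totalRank = n + 1)
    {T V : Finset ℕ} (hV : V ⊆ Finset.Icc 1 n) (hT : T ⊆ V)
    (hsep : ∀ t ∈ T, ∀ r ∈ T, r ≠ t →
      ∃ s ∈ Finset.Icc 1 n \ V, (r < s ∧ s < t) ∨ (t < s ∧ s < r)) :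
    0 ≤ inequalityForm T V (flagVector n P) := by
  have hd : Disjoint (Finset.Icc 1 n \ V) T :=
    Finset.disjoint_of_subset_right hT Finset.sdiff_disjoint
  -- Expanding the product over `T` gives the sum over subsets `R`. Independence of the gaps turns
  -- the products of extension numbers into the flag numbers of `S ∪ R`.
  have e : inequalityForm T V (flagVector n P) =
      ∑ C ∈ P.chains (Finset.Icc 1 n \ V), ∏ t ∈ T, (((P.extensions C t).card : ℝ) + (-2)) := by
    simp only [Finset.prod_add, Finset.prod_const, inequalityForm]
    rw [Finset.sum_comm]
    refine Finset.sum_congr rfl fun R hR => ?_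
    have hR := Finset.mem_powerset.mp hR
    rw [coord_flagVector, flagNumber_union hd hsep hR, Finset.mul_sum]
    · exact Finset.sum_congr rfl fun C _ => mul_comm _ _
    · exact Finset.union_subset Finset.sdiff_subset (hR.trans (hT.trans hV))
  rw [e]
  refine Finset.sum_nonneg fun C hC => Finset.prod_nonneg fun t ht => ?_
  have ht' := Finset.mem_Icc.mp (hV (hT ht))
  have h := hP.two_le_card_extensions hr hC
    (fun h => Finset.disjoint_left.mp hd h ht) ht'.1 ht'.2
  have h : (2 : ℝ) ≤ (P.extensions C t).card := by exact_mod_cast h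
  linarith

open Classical in
lemma sum_chains_singleton (i : ℕ) (g : Finset P → ℝ) :
    ∑ C ∈ P.chains {i}, g C = ∑ x : P with grade ℕ x = i, g {x} := by
  symm
  refine Finset.sum_bij (fun x _ => {x}) ?_ ?_ ?_ fun _ _ => rfl
  · intro x hx
    rw [mem_chains, Finset.coe_singleton]
    refine ⟨IsChain.singleton, fun t => ?_⟩
    simp [← (Finset.mem_filter.mp hx).2, eq_comm]
  · intro x _ y _ h
    exact Finset.singleton_injective h
  · intro C hC
    obtain ⟨x, hx, hxi⟩ := ((mem_chains.mp hC).2 i).mpr (Finset.mem_singleton_self i)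
    refine ⟨x, by simp [hxi], ?_⟩
    symm
    refine Finset.eq_singleton_iff_unique_mem.mpr ⟨hx, fun y hy => ?_⟩
    have h1 := chain_comparable hC hy hx
    have h2 := Finset.mem_singleton.mp (grade_mem_of_mem_chains hC hy)
    exact le_antisymm (le_of_grade_le h1 (by omega)) (le_of_grade_le h1.symm (by omega))

open Classical in
lemma flagNumber_singleton (i : ℕ) :
    (P.flagNumber {i} : ℝ) = ({x | grade ℕ x = i} : Finset P).card := by
  have := sum_chains_singleton (P := P) i fun _ => 1
  simpa [flagNumber_eq] using this

open Classical in
lemma flagNumber_pair {i k : ℕ} (hik : i < k) :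
    (P.flagNumber {i, k} : ℝ) =
      ({p | (grade ℕ p.1 = i ∧ grade ℕ p.2 = k) ∧ p.1 < p.2} : Finset (P × P)).card := by
  rw [Finset.pair_comm, flagNumber_insert (by simp [hik.ne']), sum_chains_singleton]
  rw [← Nat.cast_sum]
  congr 1
  rw [← Finset.card_sigma]
  refine Finset.card_bij (fun p _ => (p.1, p.2)) ?_ ?_ ?_
  · rintro ⟨x, z⟩ h
    simp only [Finset.mem_sigma, Finset.mem_filter, Finset.mem_univ, true_and, mem_extensions,
      Finset.mem_singleton, forall_eq] at h ⊢
    exact ⟨⟨h.1, h.2.1⟩, lt_of_grade_lt h.2.2 (by omega)⟩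
  · rintro ⟨x, z⟩ _ ⟨x', z'⟩ _ h
    simpa using h
  · rintro ⟨x, z⟩ h
    simp only [Finset.mem_filter, Finset.mem_univ, true_and] at h
    refine ⟨⟨x, z⟩, ?_, rfl⟩
    simp only [Finset.mem_sigma, Finset.mem_filter, Finset.mem_univ, true_and, mem_extensions,
      Finset.mem_singleton, forall_eq]
    exact ⟨h.1.1, h.1.2, Or.inl h.2.le⟩

/-- The inequality obtained from the comparability graph between the ranks `i` and `k`. -/
lemma IsEulerian.tripleForm_nonneg (hP : P.IsEulerian) (hr : P.totalRank = n + 1) {i j k : ℕ}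
    (hi : 1 ≤ i) (hij : i < j) (hjk : j < k) (hk : k ≤ n) :
    0 ≤ tripleForm i j k (flagVector n P) := by
  classical
  have hbot : grade ℕ (⊥ : P) = 0 := grade_bot
  have htop : grade ℕ (⊤ : P) = n + 1 := hr
  let Y : Finset P := {y | grade ℕ y = j}
  let a : P → Finset P := fun y => {x | grade ℕ x = i ∧ x < y}
  let b : P → Finset P := fun y => {z | grade ℕ z = k ∧ y < z}
  have bot_lt : ∀ x : P, 0 < grade ℕ x → ⊥ < x := fun x hx =>
    lt_of_grade_lt (Or.inl bot_le) (by omega)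
  have lt_top : ∀ x : P, grade ℕ x < n + 1 → x < ⊤ := fun x hx =>
    lt_of_grade_lt (Or.inl le_top) (by omega)
  -- Two elements at rank `j` between `x` and `z` leave one different from any given `y`. This
  -- yields both the double covering and the fact that comparable pairs of ranks `i`, `k` are edges.
  have other : ∀ x z : P, x < z → grade ℕ x < j → j < grade ℕ z → ∀ y : P,
      ∃ w, (x < w ∧ w < z) ∧ w ≠ y ∧ grade ℕ w = j := fun x z hxz hx hz y => by
    have h := hP.two_le_card_between hxz hx hz
    obtain ⟨w, hw, hwy⟩ := Finset.exists_mem_ne (s := P.between x z j) (by omega) y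
    have hw := mem_between.mp hw
    exact ⟨w, hw.1, hwy, hw.2⟩
  have h := bipartiteExcess_nonneg (a := a) (b := b) Y ?_ ?_ ?_ ?_
  · have ea : Y.biUnion a = ({x | grade ℕ x = i} : Finset P) := by
      ext x
      simp only [Y, a, Finset.mem_biUnion, Finset.mem_filter, Finset.mem_univ, true_and]
      constructor
      · rintro ⟨y, _, h, _⟩; exact h
      · intro hx
        obtain ⟨w, h1, -, h2⟩ := other x ⊤ (lt_top x (by omega)) (by omega) (by omega) ⊤
        exact ⟨w, h2, hx, h1.1⟩
    have eb : Y.biUnion b = ({x | grade ℕ x = k} : Finset P) := by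
      ext x
      simp only [Y, b, Finset.mem_biUnion, Finset.mem_filter, Finset.mem_univ, true_and]
      constructor
      · rintro ⟨y, _, h, _⟩; exact h
      · intro hx
        obtain ⟨w, h1, -, h2⟩ := other ⊥ x (bot_lt x (by omega)) (by omega) (by omega) ⊥
        exact ⟨w, h2, hx, h1.2⟩
    have ee : (Y.biUnion fun y => a y ×ˢ b y) =
        ({p | (grade ℕ p.1 = i ∧ grade ℕ p.2 = k) ∧ p.1 < p.2} : Finset (P × P)) := by
      ext ⟨x, z⟩
      simp only [Y, a, b, Finset.mem_biUnion, Finset.mem_filter, Finset.mem_univ, true_and,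
        Finset.mem_product]
      constructor
      · rintro ⟨y, _, h1, h2⟩
        exact ⟨⟨h1.1, h2.1⟩, h1.2.trans h2.2⟩
      · rintro ⟨h1, h2⟩
        obtain ⟨w, h3, -, h4⟩ := other x z h2 (by omega) (by omega) x
        exact ⟨w, h4, ⟨h1.1, h3.1⟩, h1.2, h3.2⟩
    have hsub : ∀ t, 1 ≤ t → t ≤ n → {t} ⊆ Finset.Icc 1 n := fun t h1 h2 =>
      Finset.singleton_subset_iff.mpr (Finset.mem_Icc.mpr ⟨h1, h2⟩)
    rw [tripleForm, coord_flagVector P (hsub i hi (by omega)),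
      coord_flagVector P (hsub j (by omega) (by omega)),
      coord_flagVector P (hsub k (by omega) hk), coord_flagVector P, flagNumber_singleton,
      flagNumber_singleton, flagNumber_singleton, flagNumber_pair (hij.trans hjk), ← ea, ← eb, ← ee]
    · unfold bipartiteExcess at h
      have h' : (0 : ℝ) ≤ ((Y.biUnion fun y => a y ×ˢ b y).card : ℝ) + 2 * Y.card -
          2 * (Y.biUnion a).card - 2 * (Y.biUnion b).card := by exact_mod_cast h
      linarith
    · exact Finset.insert_subset (Finset.mem_Icc.mpr (by omega)) (hsub k (by omega) hk)
  · intro y hy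
    have hy : grade ℕ y = j := (Finset.mem_filter.mp hy).2
    have h := hP.two_le_card_between (bot_lt y (by omega)) (t := i) (by omega) (by omega)
    refine h.trans (Finset.card_le_card fun x hx => ?_)
    have hx := mem_between.mp hx
    exact Finset.mem_filter.mpr ⟨Finset.mem_univ _, hx.2, hx.1.2⟩
  · intro y hy
    have hy : grade ℕ y = j := (Finset.mem_filter.mp hy).2
    have h := hP.two_le_card_between (lt_top y (by omega)) (t := k) (by omega) (by omega)
    refine h.trans (Finset.card_le_card fun x hx => ?_)
    have hx := mem_between.mp hx
    exact Finset.mem_filter.mpr ⟨Finset.mem_univ _, hx.2, hx.1.1⟩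
  · intro y hy x hx
    have hx := (Finset.mem_filter.mp hx).2
    obtain ⟨w, h1, h2, h3⟩ := other x ⊤ (lt_top x (by omega)) (by omega) (by omega) y
    exact ⟨w, Finset.mem_filter.mpr ⟨Finset.mem_univ _, h3⟩, h2,
      Finset.mem_filter.mpr ⟨Finset.mem_univ _, hx.1, h1.1⟩⟩
  · intro y hy x hx
    have hx := (Finset.mem_filter.mp hx).2
    obtain ⟨w, h1, h2, h3⟩ := other ⊥ x (bot_lt x (by omega)) (by omega) (by omega) y
    exact ⟨w, Finset.mem_filter.mpr ⟨Finset.mem_univ _, h3⟩, h2,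
      Finset.mem_filter.mpr ⟨Finset.mem_univ _, hx.1, h1.2⟩⟩

end GradedPoset

/-! ### Counting chains from the top -/

namespace GradedPoset

variable {P : GradedPoset}

open Classical in
/-- The chains with rank set `S` all of whose elements lie strictly below `y`. -/
noncomputable def chainsBelow (P : GradedPoset) (S : Finset ℕ) (y : P) : Finset (Finset P) :=
  (P.chains S).filter fun C : Finset P => ∀ x : P, x ∈ C → x < y

lemma chainsBelow_empty (y : P) : (P.chainsBelow ∅ y).card = 1 := by
  classical
  rw [Finset.card_eq_one]
  refine ⟨∅, Finset.ext fun C => ?_⟩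
  rw [chainsBelow, Finset.mem_filter, Finset.mem_singleton, mem_chains]
  constructor
  · rintro ⟨⟨-, h⟩, -⟩
    exact Finset.eq_empty_of_forall_notMem fun x hx =>
      Finset.notMem_empty _ ((h _).mp ⟨x, hx, rfl⟩)
  · rintro rfl
    simp

lemma chainsBelow_top {n : ℕ} (hr : P.totalRank = n + 1) {S : Finset ℕ}
    (hS : S ⊆ Finset.Icc 1 n) : P.chainsBelow S ⊤ = P.chains S := by
  classical
  rw [chainsBelow, Finset.filter_true_of_mem]
  refine fun C hC x hx => lt_of_grade_lt (Or.inl le_top) ?_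
  have := Finset.mem_Icc.mp (hS (grade_mem_of_mem_chains hC hx))
  have : grade ℕ (⊤ : P) = n + 1 := hr
  omega

open Classical in
/-- Chains grouped by their top elements. -/
lemma card_chainsBelow_insert {S : Finset ℕ} {t : ℕ} (ht : ∀ s ∈ S, s < t) (y : P) :
    (P.chainsBelow (insert t S) y).card =
      ∑ x : P with grade ℕ x = t ∧ x < y, (P.chainsBelow S x).card := by
  rw [← Finset.card_sigma]
  symm
  have hnot : ∀ {x : P} {C : Finset P}, C ∈ P.chains S → grade ℕ x = t → x ∉ C :=
    fun hC hx h => (ht _ (grade_mem_of_mem_chains hC h)).ne hx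
  refine Finset.card_bij (fun p _ => insert p.1 p.2) ?_ ?_ ?_
  · rintro ⟨x, C⟩ h
    simp only [Finset.mem_sigma, chainsBelow, Finset.mem_filter, Finset.mem_univ, true_and] at h ⊢
    obtain ⟨⟨hxt, hxy⟩, hC, hCx⟩ := h
    have hC' := mem_chains.mp hC
    refine ⟨mem_chains.mpr ⟨?_, fun s => ?_⟩, fun z hz => ?_⟩
    · rw [Finset.coe_insert]
      exact hC'.1.insert fun z hz _ => Or.inr (hCx z hz).le
    · rw [Finset.mem_insert, ← hC'.2 s]
      simp only [Finset.mem_insert, exists_eq_or_imp, hxt]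
      rw [eq_comm (a := t)]
    · rcases Finset.mem_insert.mp hz with rfl | hz
      · exact hxy
      · exact (hCx z hz).trans hxy
  · rintro ⟨x, C⟩ h ⟨x', C'⟩ h' heq
    simp only [Finset.mem_sigma, chainsBelow, Finset.mem_filter, Finset.mem_univ, true_and]
      at h h' heq
    have hx : x = x' := by
      have : x ∈ insert x' C' := heq ▸ Finset.mem_insert_self x C
      exact (Finset.mem_insert.mp this).resolve_right (hnot h'.2.1 h.1.1)
    subst hx
    have hCC : C = C' := by
      rw [← Finset.erase_insert (hnot h.2.1 h.1.1), heq, Finset.erase_insert (hnot h'.2.1 h.1.1)]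
    rw [hCC]
  · intro D hD
    simp only [chainsBelow, Finset.mem_filter] at hD
    obtain ⟨hD, hDy⟩ := hD
    obtain ⟨x, hx, hxt⟩ := ((mem_chains.mp hD).2 t).mpr (Finset.mem_insert_self t S)
    have hlt : ∀ z ∈ D, z ≠ x → z < x ∧ grade ℕ z ∈ S := fun z hz hzx => by
      have h1 := chain_comparable hD hz hx
      rcases Finset.mem_insert.mp (grade_mem_of_mem_chains hD hz) with h | h
      · exact absurd (le_antisymm (le_of_grade_le h1 (by omega))
          (le_of_grade_le h1.symm (by omega))) hzx
      · exact ⟨lt_of_grade_lt h1 (by rw [hxt]; exact ht _ h), h⟩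
    refine ⟨⟨x, D.erase x⟩, ?_, Finset.insert_erase hx⟩
    simp only [Finset.mem_sigma, chainsBelow, Finset.mem_filter, Finset.mem_univ, true_and]
    refine ⟨⟨hxt, hDy x hx⟩, mem_chains.mpr ⟨?_, fun s => ⟨?_, fun hs => ?_⟩⟩, fun z hz => ?_⟩
    · exact (mem_chains.mp hD).1.mono fun z hz => Finset.mem_of_mem_erase hz
    · rintro ⟨z, hz, rfl⟩
      exact (hlt z (Finset.mem_of_mem_erase hz) (Finset.ne_of_mem_erase hz)).2
    · obtain ⟨z, hz, rfl⟩ := ((mem_chains.mp hD).2 s).mpr (Finset.mem_insert_of_mem hs)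
      exact ⟨z, Finset.mem_erase.mpr ⟨fun e => (ht _ hs).ne (e ▸ hxt), hz⟩, rfl⟩
    · exact (hlt z (Finset.mem_of_mem_erase hz) (Finset.ne_of_mem_erase hz)).1

open Classical in
/-- The Eulerian property follows from the alternating sums over open intervals. -/
lemma isEulerian_of_sum_Ioo
    (h : ∀ x y : P, x < y → ∑ z with x < z ∧ z < y, (-1 : ℤ) ^ (grade ℕ z - grade ℕ x) =
      -1 - (-1) ^ (grade ℕ y - grade ℕ x)) : P.IsEulerian := by
  let _ : LocallyFiniteOrder P := Fintype.toLocallyFiniteOrder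
  suffices H : ∀ x y : P, x ≤ y →
      IncidenceAlgebra.mu ℤ x y = (-1) ^ (grade ℕ y - grade ℕ x) from H
  intro x y hxy
  obtain ⟨d, hd⟩ : ∃ d, d = grade ℕ y := ⟨_, rfl⟩
  induction d using Nat.strong_induction_on generalizing y with
  | _ d ih =>
    rcases hxy.eq_or_lt with rfl | hlt
    · simp
    · rw [IncidenceAlgebra.mu_eq_neg_sum_Ico_of_ne hlt.ne]
      rw [Finset.sum_congr rfl fun z hz => ih _ (hd ▸ grade_strictMono (Finset.mem_Ico.mp hz).2) z
        (Finset.mem_Ico.mp hz).1 rfl]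
      have h2 : (Finset.Ico x y : Finset P) = insert x ({z | x < z ∧ z < y} : Finset P) := by
        ext z
        simp only [Finset.mem_Ico, Finset.mem_insert, Finset.mem_filter, Finset.mem_univ, true_and]
        constructor
        · rintro ⟨h1, h2⟩
          rcases h1.eq_or_lt with h1 | h1
          · exact Or.inl h1.symm
          · exact Or.inr ⟨h1, h2⟩
        · rintro (rfl | h)
          · exact ⟨le_rfl, hlt⟩
          · exact ⟨h.1.le, h.2⟩
      rw [h2, Finset.sum_insert (by simp), h x y hlt, Nat.sub_self, pow_zero]
      ring

end GradedPoset

/-! ### Posets of copies -/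

/-- A description of a poset `P` by copies: an element is given by its type in `Θ` and by copy
numbers; the copy number `j` of an element of type `p` is one of `0, …, k j - 1` if it is active at
`p`, and is `0` otherwise; elements of related types are comparable iff their common active copy
numbers agree. -/
structure CopyPresentation (P : GradedPoset) (Θ ι : Type) where
  type : P → Θ
  num : P → ι → ℕ
  rank : Θ → ℕ
  active : Θ → ι → Bool
  rel : Θ → Θ → Bool
  k : ι → ℕ
  valid : Θ → Bool
  grade_eq : ∀ x, grade ℕ x = rank (type x)
  ext : ∀ x y, type x = type y → num x = num y → x = y
  exists_iff : ∀ p c, (∃ x, type x = p ∧ num x = c) ↔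
    valid p ∧ ∀ j, (active p j → c j < k j) ∧ (¬ active p j → c j = 0)
  lt_iff : ∀ x y, x < y ↔ rel (type x) (type y) ∧
    ∀ j, active (type x) j → active (type y) j → num x j = num y j

namespace CopyPresentation

variable {P : GradedPoset} {Θ ι : Type} (D : CopyPresentation P Θ ι)

lemma num_spec (x : P) : D.valid (D.type x) ∧ ∀ j, (D.active (D.type x) j → D.num x j < D.k j) ∧
    (¬ D.active (D.type x) j → D.num x j = 0) :=
  (D.exists_iff _ _).mp ⟨x, rfl, rfl⟩

variable [Fintype ι]

open Classical in
/-- The number of elements of a given type with some prescribed copy numbers. -/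
lemma card_fiber {p : Θ} (hp : D.valid p) (forced : ι → Bool) (a : ι → ℕ)
    (ha : ∀ j, forced j → D.active p j → a j < D.k j) :
    ({z | D.type z = p ∧ ∀ j, D.active p j → forced j → D.num z j = a j} : Finset P).card =
      ∏ j, if D.active p j && !forced j then D.k j else 1 := by
  have e : ∀ j, (if D.active p j && !forced j then D.k j else 1) =
      (if D.active p j then if forced j then {a j} else Finset.range (D.k j)
        else {0} : Finset ℕ).card := fun j => by
    cases D.active p j <;> cases forced j <;> simp
  rw [Finset.prod_congr rfl fun j _ => e j, ← Fintype.card_piFinset]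
  refine Finset.card_bij (fun z _ => D.num z) ?_ ?_ ?_
  · intro z hz
    obtain ⟨rfl, h⟩ := (Finset.mem_filter.mp hz).2
    rw [Fintype.mem_piFinset]
    intro j
    have h1 := (D.num_spec z).2 j
    have h2 := h j
    split_ifs with h3 h4
    · exact Finset.mem_singleton.mpr (h2 h3 h4)
    · exact Finset.mem_range.mpr (h1.1 h3)
    · exact Finset.mem_singleton.mpr (h1.2 h3)
  · intro z hz w hw h
    exact D.ext z w ((Finset.mem_filter.mp hz).2.1.trans (Finset.mem_filter.mp hw).2.1.symm) h
  · intro c hc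
    rw [Fintype.mem_piFinset] at hc
    obtain ⟨z, hz, hzc⟩ := (D.exists_iff p c).mpr ⟨hp, fun j => by
      have h := hc j
      constructor
      · intro h1
        rw [if_pos h1] at h
        split_ifs at h with h2
        · rw [Finset.mem_singleton.mp h]; exact ha j h2 h1
        · exact Finset.mem_range.mp h
      · intro h1
        rw [if_neg h1] at h
        exact Finset.mem_singleton.mp h⟩
    refine ⟨z, Finset.mem_filter.mpr ⟨Finset.mem_univ _, hz, fun j h1 h2 => ?_⟩, hzc⟩
    have h := hc j
    rw [if_pos h1, if_pos h2] at h
    rw [hzc]; exact Finset.mem_singleton.mp h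

/-! ### Counting in posets of copies -/

open Classical in
lemma card_below {p : Θ} (y : P) :
    ({z | D.type z = p ∧ z < y} : Finset P).card =
      if D.valid p && D.rel p (D.type y) then
        ∏ j, if D.active p j && !D.active (D.type y) j then D.k j else 1 else 0 := by
  split_ifs with h
  · rw [Bool.and_eq_true] at h
    rw [← D.card_fiber h.1 (D.active (D.type y)) (D.num y) fun j hj _ => ((D.num_spec y).2 j).1 hj]
    congr 1
    refine Finset.filter_congr fun z _ => and_congr_right fun hz => ?_
    rw [D.lt_iff, hz]
    exact and_iff_right h.2
  · rw [Finset.card_eq_zero]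
    refine Finset.eq_empty_of_forall_notMem fun z hz => h ?_
    obtain ⟨rfl, hzy⟩ := (Finset.mem_filter.mp hz).2
    rw [Bool.and_eq_true]
    exact ⟨(D.num_spec z).1, ((D.lt_iff z y).mp hzy).1⟩

-- A copy number of the middle element is forced exactly when it is also active at `x` or at `y`.
-- The two prescriptions agree where both apply because `x < y`. The remaining active copy numbers
-- are free.
open Classical in
lemma card_between {p : Θ} {x y : P} (hxy : x < y) :
    ({z | D.type z = p ∧ x < z ∧ z < y} : Finset P).card =
      if D.valid p && (D.rel (D.type x) p && D.rel p (D.type y)) then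
        ∏ j, if D.active p j && !(D.active (D.type x) j || D.active (D.type y) j) then D.k j else 1
      else 0 := by
  split_ifs with h
  · rw [Bool.and_eq_true, Bool.and_eq_true] at h
    have hxy' := ((D.lt_iff x y).mp hxy).2
    rw [← D.card_fiber h.1 (fun j => D.active (D.type x) j || D.active (D.type y) j)
      (fun j => if D.active (D.type x) j then D.num x j else D.num y j) fun j hj _ => by
        simp only [Bool.or_eq_true] at hj
        split_ifs with h1
        · exact ((D.num_spec x).2 j).1 h1
        · exact ((D.num_spec y).2 j).1 (hj.resolve_left h1)]
    congr 1
    refine Finset.filter_congr fun z _ => and_congr_right fun hz => ?_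
    rw [D.lt_iff, D.lt_iff, hz]
    constructor
    · rintro ⟨⟨-, h1⟩, -, h2⟩ j hj hj'
      rw [Bool.or_eq_true] at hj'
      split_ifs with h3
      · exact (h1 j h3 hj).symm
      · exact h2 j hj (hj'.resolve_left h3)
    · refine fun h1 => ⟨⟨h.2.1, fun j hj hj' => ?_⟩, h.2.2, fun j hj hj' => ?_⟩
      · have := h1 j hj' (by rw [hj]; rfl)
        rw [this, if_pos hj]
      · have := h1 j hj (by rw [hj']; exact Bool.or_true _)
        rw [this]
        split_ifs with h3
        · exact hxy' j h3 hj'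
        · rfl
  · rw [Finset.card_eq_zero]
    refine Finset.eq_empty_of_forall_notMem fun z hz => h ?_
    obtain ⟨rfl, hxz, hzy⟩ := (Finset.mem_filter.mp hz).2
    rw [Bool.and_eq_true, Bool.and_eq_true]
    exact ⟨(D.num_spec z).1, ((D.lt_iff x z).mp hxz).1, ((D.lt_iff z y).mp hzy).1⟩

variable [Fintype Θ]

/-- The number of chains below an element of type `q`, by recursion on the descending list of
their ranks. -/
def chainCount : List ℕ → Θ → ℕ
  | [], _ => 1
  | t :: L, q => ∑ p, if D.rank p = t ∧ (D.valid p && D.rel p q) then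
      (∏ j, if D.active p j && !D.active q j then D.k j else 1) * chainCount L p else 0

/-- Grouping chains by the type of their top element, the number of choices and of continuations
depends only on types, so counting reduces to a recursion over the finite set `Θ`. -/
lemma card_chainsBelow {L : List ℕ} (hL : L.Pairwise (· > ·)) (y : P) :
    (P.chainsBelow L.toFinset y).card = D.chainCount L (D.type y) := by
  classical
  induction L generalizing y with
  | nil => exact GradedPoset.chainsBelow_empty y
  | cons t L ih =>
    rw [List.pairwise_cons] at hL
    rw [List.toFinset_cons, GradedPoset.card_chainsBelow_insert
      (fun s hs => hL.1 s (List.mem_toFinset.mp hs)), chainCount]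
    rw [← Finset.sum_fiberwise_of_maps_to (g := D.type) (t := Finset.univ)
      fun _ _ => Finset.mem_univ _]
    refine Finset.sum_congr rfl fun p _ => ?_
    rw [Finset.filter_filter, Finset.sum_congr rfl (g := fun _ => D.chainCount L p)
      fun x hx => by rw [ih hL.2, (Finset.mem_filter.mp hx).2.2], Finset.sum_const, smul_eq_mul]
    by_cases hp : D.rank p = t
    · have e : ({x | (grade ℕ x = t ∧ x < y) ∧ D.type x = p} : Finset P) =
          ({z | D.type z = p ∧ z < y} : Finset P) := by
        refine Finset.filter_congr fun x _ => ⟨fun h => ⟨h.2, h.1.2⟩, fun h => ⟨⟨?_, h.2⟩, h.1⟩⟩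
        rw [D.grade_eq, h.1, hp]
      rw [e, D.card_below]
      by_cases h : D.valid p && D.rel p (D.type y)
      · rw [if_pos h, if_pos ⟨hp, h⟩]
      · rw [if_neg h, if_neg fun h' => h h'.2, zero_mul]
    · rw [if_neg fun h => hp h.1, Finset.card_eq_zero.mpr, zero_mul]
      refine Finset.eq_empty_of_forall_notMem fun x hx => hp ?_
      obtain ⟨⟨h1, -⟩, rfl⟩ := (Finset.mem_filter.mp hx).2
      rw [← D.grade_eq, h1]

lemma flagNumber_eq_chainCount {n : ℕ} (hr : P.totalRank = n + 1) {L : List ℕ}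
    (hL : L.Pairwise (· > ·)) (hLn : L.toFinset ⊆ Finset.Icc 1 n) :
    P.flagNumber L.toFinset = D.chainCount L (D.type ⊤) := by
  rw [GradedPoset.flagNumber_eq, ← GradedPoset.chainsBelow_top hr hLn, D.card_chainsBelow hL]

/-- The alternating sum over the open intervals between elements of the types `p` and `q`. -/
def intervalSum (p q : Θ) : ℤ :=
  ∑ c, if D.valid c && (D.rel p c && D.rel c q) then
    (-1) ^ (D.rank c - D.rank p) *
      ∏ j, (if D.active c j && !(D.active p j || D.active q j) then (D.k j : ℤ) else 1) else 0

open Classical in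
lemma sum_Ioo_eq {x y : P} (hxy : x < y) :
    ∑ z with x < z ∧ z < y, (-1 : ℤ) ^ (grade ℕ z - grade ℕ x) =
      D.intervalSum (D.type x) (D.type y) := by
  rw [intervalSum, ← Finset.sum_fiberwise_of_maps_to (g := D.type) (t := Finset.univ)
      fun _ _ => Finset.mem_univ _]
  refine Finset.sum_congr rfl fun p _ => ?_
  rw [Finset.filter_filter, Finset.sum_congr rfl
    (g := fun _ => (-1 : ℤ) ^ (D.rank p - D.rank (D.type x)))
      fun z hz => by rw [D.grade_eq, D.grade_eq, (Finset.mem_filter.mp hz).2.2],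
    Finset.sum_const, nsmul_eq_mul]
  have e : ({z | (x < z ∧ z < y) ∧ D.type z = p} : Finset P) =
      ({z | D.type z = p ∧ x < z ∧ z < y} : Finset P) :=
    Finset.filter_congr fun z _ => and_comm (a := x < z ∧ z < y)
  rw [e, D.card_between hxy]
  split_ifs with h
  · push_cast
    rw [mul_comm]
  · simp

end CopyPresentation

/-! ### Horizontal doubles -/

namespace GradedPoset

variable (P : GradedPoset)

open Classical in
/-- The horizontal double as a poset of copies of the elements of `P`. -/
noncomputable def doublePresentation :
    CopyPresentation P.double P (Fin (P.totalRank - 1)) where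
  type := fun z : Copies P _ _ => z.1.1
  num := fun z : Copies P _ _ => z.1.2
  rank := grade ℕ
  active x j := decide (P.Replicated ((j : ℕ) + 1, (j : ℕ) + 1) x)
  rel x y := decide (x < y)
  k _ := 2
  valid _ := true
  grade_eq _ := rfl
  ext := fun _ _ h1 h2 => Subtype.ext (Prod.ext h1 h2)
  exists_iff p c := by
    simp only [true_and, decide_eq_true_eq]
    constructor
    · rintro ⟨z, rfl, rfl⟩
      exact z.2
    · exact fun h => ⟨⟨(p, c), h⟩, rfl, rfl⟩
  lt_iff := fun (z w : Copies P _ _) => by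
    simp only [decide_eq_true_eq]
    constructor
    · exact fun h => ⟨Copies.lt_fst h, h.le.2⟩
    · exact fun h => lt_of_le_of_ne ⟨h.1.le, h.2⟩ fun e => h.1.ne (e ▸ rfl)

variable {P}

/-- The only operator of the horizontal double acting on `c` is that of its own rank. Elements of
other ranks do not constrain it, so both copies are available. -/
lemma prod_doublePresentation {c : P} (h1 : ⊥ < c) (h2 : c < ⊤)
    (q : Fin (P.totalRank - 1) → Bool) (hq : ∀ j, q j → (j : ℕ) + 1 ≠ grade ℕ c) :
    (∏ j, if P.doublePresentation.active c j && !q j then P.doublePresentation.k j else 1) = 2 := by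
  have hbot : grade ℕ (⊥ : P) = 0 := grade_bot
  have htop : grade ℕ (⊤ : P) = P.totalRank := rfl
  have h1' := grade_strictMono (𝕆 := ℕ) h1
  have h2' := grade_strictMono (𝕆 := ℕ) h2
  rw [Finset.prod_eq_single (⟨grade ℕ c - 1, by omega⟩ : Fin (P.totalRank - 1))]
  · have : q ⟨grade ℕ c - 1, by omega⟩ = false := by
      by_contra h
      rw [Bool.not_eq_false] at h
      exact hq _ h (by simp only; omega)
    rw [this, if_pos]
    · rfl
    · simp only [doublePresentation, Bool.not_false, Bool.and_true, decide_eq_true_eq]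
      exact ⟨by simp only; omega, by simp only; omega, h1.ne', h2.ne⟩
  · intro j _ hj
    refine if_neg fun h => hj ?_
    rw [Bool.and_eq_true] at h
    have h := h.1
    simp only [doublePresentation, decide_eq_true_eq] at h
    have h3 := h.1
    have h4 := h.2.1
    simp only at h3 h4
    exact Fin.ext (by simp only; omega)
  · exact fun h => absurd (Finset.mem_univ _) h

lemma active_doublePresentation {x : P} {j : Fin (P.totalRank - 1)}
    (h : P.doublePresentation.active x j) : (j : ℕ) + 1 = grade ℕ x := by
  simp only [doublePresentation, decide_eq_true_eq] at h
  exact le_antisymm h.1 h.2.1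

lemma card_chainsBelow_double {S : Finset ℕ} (hS : ∀ s ∈ S, 1 ≤ s) (w : P.double) :
    (P.double.chainsBelow S w).card =
      2 ^ S.card * (P.chainsBelow S (P.doublePresentation.type w)).card := by
  classical
  have hbot : grade ℕ (⊥ : P) = 0 := grade_bot
  induction S using Finset.induction_on_max generalizing w with
  | empty => rw [chainsBelow_empty, chainsBelow_empty]; rfl
  | insert t S ht ih =>
    have htS : t ∉ S := fun h => (ht t h).false
    have ht1 := hS t (Finset.mem_insert_self t S)
    have ih := fun w => ih (fun s hs => hS s (Finset.mem_insert_of_mem hs)) w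
    rw [card_chainsBelow_insert ht, card_chainsBelow_insert ht,
      Finset.card_insert_of_notMem htS, Finset.mul_sum]
    rw [← Finset.sum_fiberwise_of_maps_to (g := P.doublePresentation.type)
      (t := {x | grade ℕ x = t ∧ x < P.doublePresentation.type w})]
    · refine Finset.sum_congr rfl fun x hx => ?_
      have hx := (Finset.mem_filter.mp hx).2
      rw [Finset.filter_filter, Finset.sum_congr rfl
        (g := fun _ => 2 ^ S.card * (P.chainsBelow S x).card)
        fun z hz => by rw [ih z, (Finset.mem_filter.mp hz).2.2], Finset.sum_const, smul_eq_mul]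
      have e : ({z | (grade ℕ z = t ∧ z < w) ∧ P.doublePresentation.type z = x} :
          Finset P.double) = ({z | P.doublePresentation.type z = x ∧ z < w} : Finset _) := by
        refine Finset.filter_congr fun z _ => ⟨fun h => ⟨h.2, h.1.2⟩, fun h => ⟨⟨?_, h.2⟩, h.1⟩⟩
        rw [P.doublePresentation.grade_eq, h.1]
        exact hx.1
      rw [e, P.doublePresentation.card_below, if_pos, prod_doublePresentation]
      · ring
      · exact lt_of_grade_lt (Or.inl bot_le) (by omega)
      · exact hx.2.trans_le le_top
      · intro j hj h
        have := active_doublePresentation hj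
        have := grade_strictMono (𝕆 := ℕ) hx.2
        omega
      · simp [doublePresentation] at hx ⊢
        exact hx.2
    · intro z hz
      have hz := (Finset.mem_filter.mp hz).2
      refine Finset.mem_filter.mpr ⟨Finset.mem_univ _, ?_, ?_⟩
      · rw [← hz.1]; rfl
      · exact Copies.lt_fst hz.2

/-- The flag numbers of a horizontal double. -/
lemma flagNumber_double {n : ℕ} (hr : P.totalRank = n + 1) {S : Finset ℕ}
    (hS : S ⊆ Finset.Icc 1 n) : P.double.flagNumber S = 2 ^ S.card * P.flagNumber S := by
  rw [flagNumber_eq, flagNumber_eq, ← chainsBelow_top hr hS,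
    ← chainsBelow_top (P := P.double) hr hS,
    card_chainsBelow_double fun s hs => (Finset.mem_Icc.mp (hS hs)).1]
  rfl

-- Every element strictly between has two copies, and both lie between the given copies of the
-- endpoints. Hence the half-Eulerian property asks for half of the Eulerian value in `P` itself.
open Classical in
lemma sum_Ioo_double {x y : P.double} (hxy : x < y) :
    ∑ z with x < z ∧ z < y, (-1 : ℤ) ^ (grade ℕ z - grade ℕ x) =
      2 * ∑ z with P.doublePresentation.type x < z ∧ z < P.doublePresentation.type y,
        (-1 : ℤ) ^ (grade ℕ z - grade ℕ (P.doublePresentation.type x)) := by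
  rw [← Finset.sum_fiberwise_of_maps_to (g := P.doublePresentation.type)
    (t := {z | P.doublePresentation.type x < z ∧ z < P.doublePresentation.type y}), Finset.mul_sum]
  · refine Finset.sum_congr rfl fun c hc => ?_
    have hc := (Finset.mem_filter.mp hc).2
    rw [Finset.filter_filter, Finset.sum_congr rfl
      (g := fun _ => (-1 : ℤ) ^ (grade ℕ c - grade ℕ (P.doublePresentation.type x)))
        fun z hz => by rw [← (Finset.mem_filter.mp hz).2.2]; rfl,
      Finset.sum_const, nsmul_eq_mul]
    have e : ({z | (x < z ∧ z < y) ∧ P.doublePresentation.type z = c} : Finset P.double) =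
        ({z | P.doublePresentation.type z = c ∧ x < z ∧ z < y} : Finset P.double) :=
      Finset.filter_congr fun z _ => and_comm (a := x < z ∧ z < y)
    rw [e, P.doublePresentation.card_between hxy, if_pos, prod_doublePresentation]
    · rfl
    · exact lt_of_le_of_lt bot_le hc.1
    · exact lt_of_lt_of_le hc.2 le_top
    · intro j hj h
      have h1 := grade_strictMono (𝕆 := ℕ) hc.1
      have h2 := grade_strictMono (𝕆 := ℕ) hc.2
      rw [Bool.or_eq_true] at hj
      rcases hj with hj | hj
      · have := active_doublePresentation hj; omega
      · have := active_doublePresentation hj; omega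
    · have h1 : P.doublePresentation.rel (P.doublePresentation.type x) c = true :=
        decide_eq_true hc.1
      have h2 : P.doublePresentation.rel c (P.doublePresentation.type y) = true :=
        decide_eq_true hc.2
      rw [h1, h2]; rfl
  · intro z hz
    have hz := (Finset.mem_filter.mp hz).2
    exact Finset.mem_filter.mpr ⟨Finset.mem_univ _, Copies.lt_fst hz.1, Copies.lt_fst hz.2⟩

end GradedPoset

open GradedPoset in
/-- A criterion for posets of copies to be half-Eulerian. -/
lemma CopyPresentation.isHalfEulerian {P : GradedPoset} {Θ ι : Type} [Fintype Θ] [Fintype ι]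
    (D : CopyPresentation P Θ ι)
    (h : ∀ p q, D.rel p q → 2 * D.intervalSum p q = -1 - (-1) ^ (D.rank q - D.rank p)) :
    P.IsHalfEulerian := by
  refine isEulerian_of_sum_Ioo fun x y hxy => ?_
  have hxy' : P.doublePresentation.type x < P.doublePresentation.type y := Copies.lt_fst hxy
  rw [sum_Ioo_double hxy, D.sum_Ioo_eq hxy', h _ _ ((D.lt_iff _ _).mp hxy').1, ← D.grade_eq,
    ← D.grade_eq]
  rfl

/-! ### Interval posets and glued posets as posets of copies -/

section IntervalPosets

variable {n : ℕ} {𝓘 : Finset (ℕ × ℕ)}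

/-- Membership of a rank in an interval. -/
def inInterval (I : ℕ × ℕ) (r : ℕ) : Bool := decide (I.1 ≤ r) && decide (r ≤ I.2)

lemma inInterval_iff {I : ℕ × ℕ} {r : ℕ} : inInterval I r = true ↔ I.1 ≤ r ∧ r ≤ I.2 := by
  simp [inInterval]

lemma replicated_chain_iff (h : IsIntervalSystem n 𝓘) (I : 𝓘) (r : Fin (n + 2)) :
    (GradedPoset.chain n).Replicated (I : ℕ × ℕ) r ↔ inInterval I r := by
  rw [inInterval_iff]
  have hI := h.1 I I.2
  refine ⟨fun h => ⟨h.1, h.2.1⟩, fun h => ⟨h.1, h.2, ?_, ?_⟩⟩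
  · intro he
    have h0 : r.val = 0 := congrArg (fun x : Fin (n + 2) => x.val) he
    omega
  · intro he
    have h0 : r.val = n + 1 := congrArg (fun x : Fin (n + 2) => x.val) he
    omega

/-- The poset `P(n, 𝓘, N)` as a poset of copies. -/
def intervalPresentation (h : IsIntervalSystem n 𝓘) (N : ℕ+) :
    CopyPresentation (intervalPoset n 𝓘 N) (Fin (n + 2)) 𝓘 where
  type := fun z : GradedPoset.Copies _ _ _ => z.1.1
  num := fun z : GradedPoset.Copies _ _ _ => z.1.2
  rank r := r
  active r I := inInterval I r
  rel p q := decide (p < q)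
  k _ := N
  valid _ := true
  grade_eq _ := rfl
  ext := fun _ _ h1 h2 => Subtype.ext (Prod.ext h1 h2)
  exists_iff p c := by
    simp only [true_and, ← replicated_chain_iff h]
    constructor
    · rintro ⟨z, rfl, rfl⟩
      exact z.2
    · exact fun h => ⟨⟨(p, c), h⟩, rfl, rfl⟩
  lt_iff := fun (z w : GradedPoset.Copies _ _ _) => by
    rw [decide_eq_true_eq]
    constructor
    · exact fun hlt => ⟨GradedPoset.Copies.lt_fst hlt, fun I h1 h2 => hlt.le.2 I
        ((replicated_chain_iff h I _).mpr h1) ((replicated_chain_iff h I _).mpr h2)⟩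
    · refine fun hlt => lt_of_le_of_ne ⟨hlt.1.le, fun I h1 h2 => hlt.2 I ?_ ?_⟩
        fun e => hlt.1.ne (e ▸ rfl)
      · exact (replicated_chain_iff h I _).mp h1
      · exact (replicated_chain_iff h I _).mp h2

lemma totalRank_intervalPoset (N : ℕ+) : (intervalPoset n 𝓘 N).totalRank = n + 1 := rfl

lemma prod_ite_eq_pow {ι : Type*} (s : Finset ι) (p : ι → Bool) (N : ℕ) :
    (∏ j ∈ s, if p j then N else 1) = N ^ ∑ j ∈ s, (if p j then 1 else 0) := by
  rw [← Finset.prod_pow_eq_pow_sum]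
  refine Finset.prod_congr rfl fun j _ => ?_
  split_ifs <;> simp

/-- Descending through the ranks, a copy number for `I` is chosen freely when `I` is entered and
stays fixed until it is left. Since `I` is an interval it is entered at most once, and not at all if
the start `q` already lies in it. -/
lemma chainCount_intervalPresentation (h : IsIntervalSystem n 𝓘) (N : ℕ+) {L : List ℕ}
    (hL : L.Pairwise (· > ·)) (q : Fin (n + 2)) (hq : ∀ s ∈ L, s < q) :
    (intervalPresentation h N).chainCount L q =
      (N : ℕ) ^ ∑ I : 𝓘, (if L.any (inInterval I) && !inInterval I q then 1 else 0) := by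
  induction L generalizing q with
  | nil => simp [CopyPresentation.chainCount]
  | cons t L ih =>
    rw [List.pairwise_cons] at hL
    have htq := hq t List.mem_cons_self
    have hqn := q.2
    rw [CopyPresentation.chainCount, Finset.sum_eq_single (⟨t, by omega⟩ : Fin (n + 2))]
    · rw [if_pos]
      · rw [ih hL.2 ⟨t, by omega⟩ fun s hs => hL.1 s hs]
        refine (congrArg₂ (· * ·) (prod_ite_eq_pow Finset.univ
          (fun I : 𝓘 => inInterval I t && !inInterval I q) (N : ℕ)) rfl).trans ?_
        simp only
        rw [← pow_add, ← Finset.sum_add_distrib]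
        congr 1
        refine Finset.sum_congr rfl fun I _ => ?_
        rw [List.any_cons]
        cases ht : inInterval I t
        · cases hs : L.any (inInterval I)
          · simp
          -- Convexity: if `I` contains `s` but not `t`, where `s < t < q`, then it does not contain
          -- `q`.
          · obtain ⟨s, hs, hsI⟩ := List.any_eq_true.mp hs
            have h1 := inInterval_iff.mp hsI
            have h2 := hL.1 s hs
            have h3 : inInterval I q = false := by
              rw [← Bool.not_eq_true, inInterval_iff]
              intro h3
              rw [← Bool.not_eq_true, inInterval_iff] at ht
              omega
            simp [h3]
        · simp
      · refine ⟨rfl, ?_⟩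
        simp only [intervalPresentation, Bool.true_and, decide_eq_true_eq]
        exact htq
    · intro p _ hp
      refine if_neg fun h => hp (Fin.ext ?_)
      exact h.1
    · exact fun h => absurd (Finset.mem_univ _) h

/-- `S` meets every interval of `𝓘`. -/
def Hits (𝓘 : Finset (ℕ × ℕ)) (S : Finset ℕ) : Prop := ∀ I ∈ 𝓘, ∃ s ∈ S, inInterval I s

instance (𝓘 : Finset (ℕ × ℕ)) (S : Finset ℕ) : Decidable (Hits 𝓘 S) := by
  unfold Hits; infer_instance

/-- The flag vector of the doubled limit poset. -/
noncomputable def limitVector (n : ℕ) (𝓘 : Finset (ℕ × ℕ)) : FlagSpace n :=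
  fun S => if Hits 𝓘 S then 2 ^ (S : Finset ℕ).card else 0

/-- A chain is determined by one copy number for each interval met by `S`. After division by `N ^
|𝓘|` only sets meeting all intervals survive in the limit. -/
lemma flagNumber_intervalPoset (h : IsIntervalSystem n 𝓘) (N : ℕ+) {S : Finset ℕ}
    (hS : S ⊆ Finset.Icc 1 n) :
    (intervalPoset n 𝓘 N).flagNumber S =
      (N : ℕ) ^ (𝓘.filter fun I => ∃ s ∈ S, inInterval I s).card := by
  have hL : (S.sort (· ≥ ·)).Pairwise (· > ·) := (Finset.sortedGT_sort S).pairwise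
  have hLS : (S.sort (· ≥ ·)).toFinset = S := Finset.sort_toFinset S (· ≥ ·)
  have hmem : ∀ s, s ∈ S.sort (· ≥ ·) ↔ s ∈ S := fun s => Finset.mem_sort (· ≥ ·)
  have h1 := (intervalPresentation h N).flagNumber_eq_chainCount (totalRank_intervalPoset N) hL
    (by rwa [hLS])
  rw [hLS] at h1
  rw [h1, chainCount_intervalPresentation h N hL]
  · congr 1
    rw [Finset.card_filter, ← Finset.sum_coe_sort 𝓘]
    refine Finset.sum_congr rfl fun I _ => ?_
    have htop : inInterval I (((intervalPresentation h N).type ⊤ : Fin (n + 2)) : ℕ) = false := by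
      rw [← Bool.not_eq_true, inInterval_iff]
      have := h.1 I I.2
      have h2 : (((intervalPresentation h N).type ⊤ : Fin (n + 2)) : ℕ) = n + 1 := rfl
      omega
    rw [htop]
    simp [List.any_eq_true, hmem]
  · intro s hs
    have := Finset.mem_Icc.mp (hS ((hmem s).mp hs))
    have h2 : (((intervalPresentation h N).type ⊤ : Fin (n + 2)) : ℕ) = n + 1 := rfl
    omega

lemma tendsto_inv_pow_mul_pow {d m : ℕ} (h : m ≤ d) :
    Tendsto (fun N : ℕ+ => (((N : ℕ) : ℝ) ^ d)⁻¹ * ((N : ℕ) : ℝ) ^ m) atTop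
      (𝓝 (if m = d then 1 else 0)) := by
  have hN : ∀ N : ℕ+, ((N : ℕ) : ℝ) ≠ 0 := fun N => by exact_mod_cast N.pos.ne'
  have hcast : Tendsto (fun N : ℕ+ => ((N : ℕ) : ℝ)) atTop atTop :=
    tendsto_natCast_atTop_atTop.comp tendsto_PNat_val_atTop_atTop
  split_ifs with he
  · subst he
    refine tendsto_const_nhds.congr fun N => ?_
    rw [inv_mul_cancel₀ (pow_ne_zero _ (hN N))]
  · have h1 : 0 < d - m := by omega
    have := (tendsto_pow_neg_atTop (𝕜 := ℝ) h1.ne').comp hcast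
    refine this.congr fun N => ?_
    simp only [Function.comp]
    rw [zpow_neg, zpow_natCast, ← Nat.sub_add_cancel h, pow_add, Nat.add_sub_cancel, mul_inv,
      mul_assoc, inv_mul_cancel₀ (pow_ne_zero _ (hN N)), mul_one]

/-- The flag vector of the doubled limit poset exists. -/
lemma isDoubledLimitFlagVector_limitVector (h : IsIntervalSystem n 𝓘) :
    IsDoubledLimitFlagVector n 𝓘 (limitVector n 𝓘) := by
  rw [IsDoubledLimitFlagVector, tendsto_pi_nhds]
  intro S
  have hS := Finset.mem_powerset.mp S.2
  have hc := Finset.card_filter_le 𝓘 fun I => ∃ s ∈ (S : Finset ℕ), inInterval I s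
  have hlim := (tendsto_inv_pow_mul_pow hc).const_mul ((2 : ℝ) ^ (S : Finset ℕ).card)
  have e : (2 : ℝ) ^ (S : Finset ℕ).card * (if (𝓘.filter fun I => ∃ s ∈ (S : Finset ℕ),
      inInterval I s).card = 𝓘.card then 1 else 0) = limitVector n 𝓘 S := by
    by_cases hH : Hits 𝓘 S
    · rw [limitVector, if_pos hH, if_pos (Finset.card_filter_eq_iff.mpr hH), mul_one]
    · rw [limitVector, if_neg hH, if_neg fun he => hH (Finset.card_filter_eq_iff.mp he), mul_zero]
  rw [e] at hlim
  refine hlim.congr fun N => ?_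
  simp only [Pi.smul_apply, smul_eq_mul, flagVector]
  rw [GradedPoset.flagNumber_double (totalRank_intervalPoset N) hS, flagNumber_intervalPoset h N hS]
  push_cast
  ring

end IntervalPosets

/-! ### Glued posets as posets of copies -/

namespace GluingRecipe

variable {m l : ℕ} [NeZero m] (A : GluingRecipe m l) (k : Fin l → ℕ+)

-- The hypothesis `hA` says that `rep` is idempotent at each rank, so `rep t r` is a canonical
-- representative of its class; identified pieces are replicated alike by `same`.
omit [NeZero m] in
lemma inInterval_rep_iff (hA : ∀ t r, A.rep (A.rep t r) r = A.rep t r) {t : Fin m} {r : Fin 8}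
    {j : Fin l} : inInterval (A.int (A.rep t r) j) r.val ↔
      (GradedPoset.chain 6).Replicated (A.int t j) r := by
  rw [replicated_iff, inInterval_iff, A.same (A.rep t r) t r (hA t _) j]

/-- The glued poset as a poset of copies; the types are pairs of a rank and a representative of a
class of posets identified at that rank. -/
def presentation (hA : ∀ t r, A.rep (A.rep t r) r = A.rep t r) :
    CopyPresentation (A.poset k) (Fin 8 × Fin m) (Fin l) where
  type := fun z : (A.gluing k).Carrier => (z.1.1, z.1.2.1)
  num := fun z : (A.gluing k).Carrier => z.1.2.2
  rank p := p.1
  active p j := inInterval (A.int p.2 j) p.1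
  rel p q := decide (p.1 < q.1) && decide (∃ t, A.rep t p.1 = p.2 ∧ A.rep t q.1 = q.2)
  k j := k j
  valid p := decide (A.rep p.2 p.1 = p.2)
  grade_eq _ := rfl
  ext := fun _ _ h1 h2 => Subtype.ext (Prod.ext (congrArg (fun p => p.1) h1)
    (Prod.ext (congrArg (fun p => p.2) h1) h2))
  exists_iff p c := by
    have h0 : ∀ t (y : GradedPoset.Copies (GradedPoset.chain 6) (A.int t) k) j,
        (inInterval (A.int (A.rep t y.1.1) j) (y.1.1 : Fin 8).val → y.1.2 j < k j) ∧
        (¬inInterval (A.int (A.rep t y.1.1) j) (y.1.1 : Fin 8).val → y.1.2 j = 0) :=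
      fun t y j => ⟨fun h => (y.2 j).1 ((A.inInterval_rep_iff hA).mp h),
        fun h => (y.2 j).2 fun h' => h ((A.inInterval_rep_iff hA).mpr h')⟩
    simp only [decide_eq_true_eq]
    constructor
    · rintro ⟨⟨z, t, y, hz⟩, h1, h2⟩
      obtain rfl : p = (z.1, z.2.1) := h1.symm
      obtain rfl : c = z.2.2 := h2.symm
      subst hz
      refine ⟨hA t _, fun j => ?_⟩
      exact h0 t y j
    · rintro ⟨hp, hc⟩
      let y : GradedPoset.Copies (GradedPoset.chain 6) (A.int p.2) k := ⟨(p.1, c), fun j => by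
        have := hc j
        rw [inInterval_iff, ← replicated_iff (A := A)] at this
        exact this⟩
      exact ⟨⟨_, p.2, y, rfl⟩, Prod.ext rfl hp, rfl⟩
  lt_iff := fun (z w : (A.gluing k).Carrier) => by
    have hsame : ∀ t (y : GradedPoset.Copies (GradedPoset.chain 6) (A.int t) k) j,
        inInterval (A.int (A.rep t y.1.1) j) (y.1.1 : Fin 8).val ↔
          (GradedPoset.chain 6).Replicated (A.int t j) y.1.1 :=
      fun t y j => A.inInterval_rep_iff hA
    simp only [Bool.and_eq_true, decide_eq_true_eq]
    constructor
    · intro h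
      have hrk : (z.1.1 : Fin 8) < w.1.1 :=
        lt_of_le_of_ne (Gluing.rk_le h.le) fun e =>
          h.ne (Gluing.eq_of_rk_eq h.le (congrArg Fin.val e))
      refine ⟨⟨hrk, ?_⟩, ?_⟩
      · obtain ⟨t, x, y, hxy, hx, hy⟩ := h.le
        rw [← hx, ← hy]
        exact ⟨t, rfl, rfl⟩
      · obtain ⟨t, x, y, hxy, hx, hy⟩ := h.le
        rw [← hx, ← hy]
        intro j h1 h2
        exact hxy.2 j ((hsame t x j).mp h1) ((hsame t y j).mp h2)
    · rintro ⟨⟨hrk, t, h1, h2⟩, h3⟩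
      refine lt_of_le_of_ne ?_ fun e => hrk.ne (e ▸ rfl)
      obtain ⟨z, s, x, rfl⟩ := z
      obtain ⟨w, u, y, rfl⟩ := w
      -- The elements `x`, `y` may come from pieces `s`, `u` other than the piece `t` witnessing the
      -- relation. Since the pieces are identified at the respective ranks, the same copy numbers
      -- define elements of piece `t`, where they can be compared.
      have e1 : ∀ j, (GradedPoset.chain 6).Replicated (A.int t j) x.1.1 ↔
          (GradedPoset.chain 6).Replicated (A.int s j) x.1.1 := fun j =>
        replicated_iff.trans ((A.same t s x.1.1 h1 j).trans replicated_iff.symm)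
      have e2 : ∀ j, (GradedPoset.chain 6).Replicated (A.int t j) y.1.1 ↔
          (GradedPoset.chain 6).Replicated (A.int u j) y.1.1 := fun j =>
        replicated_iff.trans ((A.same t u y.1.1 h2 j).trans replicated_iff.symm)
      let x' : GradedPoset.Copies (GradedPoset.chain 6) (A.int t) k :=
        ⟨x.1, fun j => by rw [e1 j]; exact x.2 j⟩
      let y' : GradedPoset.Copies (GradedPoset.chain 6) (A.int t) k :=
        ⟨y.1, fun j => by rw [e2 j]; exact y.2 j⟩
      refine ⟨t, x', y', ⟨hrk.le, fun j hj hj' => ?_⟩, ?_, ?_⟩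
      · exact h3 j ((hsame s x j).mpr ((e1 j).mp hj)) ((hsame u y j).mpr ((e2 j).mp hj'))
      · exact Prod.ext rfl (Prod.ext h1 rfl)
      · exact Prod.ext rfl (Prod.ext h2 rfl)

lemma totalRank_poset : (A.poset k).totalRank = 7 := rfl

end GluingRecipe

/-! ### Polynomials as lists of coefficients -/

/-- The value at `x` of the polynomial with the given list of coefficients. -/
def polyEval (x : ℤ) : List ℤ → ℤ
  | [] => 0
  | a :: p => a + x * polyEval x p

/-- Addition of polynomials. -/
def polyAdd : List ℤ → List ℤ → List ℤ
  | [], q => q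
  | a :: p, [] => a :: p
  | a :: p, b :: q => (a + b) :: polyAdd p q

/-- Multiplication of a polynomial by an integer. -/
def polyScale (a : ℤ) : List ℤ → List ℤ
  | [] => []
  | b :: q => (a * b) :: polyScale a q

/-- Multiplication of polynomials. -/
def polyMul : List ℤ → List ℤ → List ℤ
  | [], _ => []
  | a :: p, q => polyAdd (polyScale a q) (0 :: polyMul p q)

/-- The sum of a list of polynomials. -/
def polySum (l : List (List ℤ)) : List ℤ := l.foldr polyAdd []

/-- The product of a list of polynomials. -/
def polyProd (l : List (List ℤ)) : List ℤ := l.foldr polyMul [1]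

section Poly

variable (x : ℤ)

lemma polyEval_add (p q : List ℤ) :
    polyEval x (polyAdd p q) = polyEval x p + polyEval x q := by
  induction p generalizing q with
  | nil => simp [polyAdd, polyEval]
  | cons a p ih =>
    cases q with
    | nil => simp [polyAdd, polyEval]
    | cons b q => simp only [polyAdd, polyEval, ih]; ring

lemma polyEval_scale (a : ℤ) (q : List ℤ) : polyEval x (polyScale a q) = a * polyEval x q := by
  induction q with
  | nil => simp [polyScale, polyEval]
  | cons b q ih => simp only [polyScale, polyEval, ih]; ring

lemma polyEval_mul (p q : List ℤ) :
    polyEval x (polyMul p q) = polyEval x p * polyEval x q := by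
  induction p with
  | nil => simp [polyMul, polyEval]
  | cons a p ih =>
    simp only [polyMul, polyEval_add, polyEval_scale, polyEval, ih]; ring

lemma polyEval_sum {α : Type*} (l : List α) (f : α → List ℤ) :
    polyEval x (polySum (l.map f)) = (l.map fun a => polyEval x (f a)).sum := by
  induction l with
  | nil => rfl
  | cons a l ih =>
    rw [List.map_cons, List.map_cons, List.sum_cons, ← ih, ← polyEval_add]; rfl

lemma polyEval_prod {α : Type*} (l : List α) (f : α → List ℤ) :
    polyEval x (polyProd (l.map f)) = (l.map fun a => polyEval x (f a)).prod := by
  induction l with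
  | nil => simp [polyProd, polyEval]
  | cons a l ih =>
    rw [List.map_cons, List.map_cons, List.prod_cons, ← ih, ← polyEval_mul]; rfl

lemma polyEval_eq_zero {p : List ℤ} (h : p.all (· == 0)) : polyEval x p = 0 := by
  induction p with
  | nil => rfl
  | cons a p ih =>
    rw [List.all_cons, Bool.and_eq_true, beq_iff_eq] at h
    rw [polyEval, h.1, ih h.2, mul_zero, add_zero]

end Poly

/-- The polynomial has degree at most `e`, so the coefficient of degree `e` survives. -/
lemma tendsto_inv_pow_mul_polyEval {p : List ℤ} {e : ℕ} (h : (p.drop (e + 1)).all (· == 0)) :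
    Tendsto (fun N : ℕ+ => (((N : ℕ) : ℝ) ^ e)⁻¹ * (polyEval ((N : ℕ) : ℤ) p : ℝ)) atTop
      (𝓝 (p.getD e 0 : ℤ)) := by
  have hN : ∀ N : ℕ+, ((N : ℕ) : ℝ) ≠ 0 := fun N => by exact_mod_cast N.pos.ne'
  induction e generalizing p with
  | zero =>
    cases p with
    | nil => simp [polyEval]
    | cons a p =>
      rw [List.drop_succ_cons, List.drop_zero] at h
      refine tendsto_const_nhds.congr fun N => ?_
      simp [polyEval, polyEval_eq_zero _ h]
  | succ e ih =>
    cases p with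
    | nil => simp [polyEval]
    | cons a p =>
      rw [List.drop_succ_cons] at h
      -- Horner form: the constant term is killed by the negative power, and one factor `N` lowers
      -- the exponent for the remaining polynomial.
      have h1 := ih h
      have h2 := (tendsto_inv_pow_mul_pow (Nat.zero_le (e + 1))).const_mul (a : ℝ)
      rw [if_neg (by omega), mul_zero] at h2
      have h3 := h2.add h1
      rw [zero_add] at h3
      refine h3.congr fun N => ?_
      simp only [polyEval]
      push_cast
      rw [pow_succ]
      have := hN N
      field_simp

/-! ### The glued posets are half-Eulerian -/

namespace GluingRecipe

variable {m l : ℕ} (A : GluingRecipe m l) (κ : Fin l → List ℤ)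

/-- Whether the index `j` replicates the elements of type `p`. -/
def isActive (p : Fin 8 × Fin m) (j : Fin l) : Bool := inInterval (A.int p.2 j) p.1

/-- Whether there are comparable elements of types `p` and `q`. -/
def isRelated (p q : Fin 8 × Fin m) : Bool :=
  decide (p.1 < q.1) && decide (∃ t, A.rep t p.1 = p.2 ∧ A.rep t q.1 = q.2)

/-- Whether there are elements of type `p`. -/
def isValid (p : Fin 8 × Fin m) : Bool := decide (A.rep p.2 p.1 = p.2)

/-- The number of elements of a given type with given copy numbers for the indices in `q`, if the
multiplicities are given by the polynomials `κ`. -/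
def weightPoly (p : Fin 8 × Fin m) (q : Fin l → Bool) : List ℤ :=
  polyProd ((List.finRange l).map fun j => if A.isActive p j && !q j then κ j else [1])

/-- The alternating sums over open intervals as polynomials. -/
def intervalPoly (p q : Fin 8 × Fin m) : List ℤ :=
  polySum ((List.finRange 8).map fun r => polySum ((List.finRange m).map fun c =>
    if A.isValid (r, c) && (A.isRelated p (r, c) && A.isRelated (r, c) q) then
      polyScale ((-1) ^ (r.val - p.1.val))
        (A.weightPoly κ (r, c) fun j => A.isActive p j || A.isActive q j) else []))

/-- The numbers of chains below an element of type `q` as polynomials. -/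
def chainPoly : List (Fin 8) → Fin 8 × Fin m → List ℤ
  | [], _ => [1]
  | t :: L, q => polySum ((List.finRange m).map fun c =>
      if A.isValid (t, c) && A.isRelated (t, c) q then
        polyMul (A.weightPoly κ (t, c) fun j => A.isActive q j) (chainPoly L (t, c)) else [])

variable [NeZero m] {κ} (hA : ∀ t r, A.rep (A.rep t r) r = A.rep t r) {k : Fin l → ℕ+}
  {N : ℕ} (hk : ∀ j, ((k j : ℕ) : ℤ) = polyEval N (κ j))

include hk

omit [NeZero m] in
lemma polyEval_weightPoly (p : Fin 8 × Fin m) (q : Fin l → Bool) :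
    polyEval N (A.weightPoly κ p q) =
      ∏ j, (if A.isActive p j && !q j then ((k j : ℕ) : ℤ) else 1) := by
  rw [weightPoly, polyEval_prod, Fin.prod_univ_def]
  congr 2
  ext j
  rw [hk]
  split_ifs <;> simp [polyEval]

lemma intervalSum_eq (p q : Fin 8 × Fin m) :
    (A.presentation k hA).intervalSum p q = polyEval N (A.intervalPoly κ p q) := by
  rw [CopyPresentation.intervalSum, Fintype.sum_prod_type, Fin.sum_univ_def, intervalPoly,
    polyEval_sum]
  congr 2
  ext r
  rw [Fin.sum_univ_def, polyEval_sum]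
  congr 2
  ext c
  rw [apply_ite (polyEval (N : ℤ)), polyEval_scale, A.polyEval_weightPoly hk]
  rfl

lemma chainCount_eq (L : List (Fin 8)) (q : Fin 8 × Fin m) :
    (((A.presentation k hA).chainCount (L.map Fin.val) q : ℕ) : ℤ) =
      polyEval N (A.chainPoly κ L q) := by
  induction L generalizing q with
  | nil => simp [CopyPresentation.chainCount, chainPoly, polyEval]
  | cons t L ih =>
    rw [List.map_cons, CopyPresentation.chainCount, Fintype.sum_prod_type,
      Finset.sum_eq_single t, chainPoly, polyEval_sum, Fin.sum_univ_def, Nat.cast_list_sum,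
      List.map_map]
    · congr 2
      ext c
      rw [apply_ite (polyEval (N : ℤ)), polyEval_mul, A.polyEval_weightPoly hk, ← ih,
        Function.comp_apply, Nat.cast_ite, Nat.cast_mul, Nat.cast_prod]
      have e : ((A.presentation k hA).rank (t, c) = (t : ℕ) ∧
          ((A.presentation k hA).valid (t, c) && (A.presentation k hA).rel (t, c) q) = true) ↔
            (A.isValid (t, c) && A.isRelated (t, c) q) = true := and_iff_right rfl
      by_cases h : (A.isValid (t, c) && A.isRelated (t, c) q) = true
      · rw [if_pos h, if_pos (e.mpr h)]
        congr 1
        refine Finset.prod_congr rfl fun j _ => ?_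
        rw [Nat.cast_ite, Nat.cast_one]
        rfl
      · rw [if_neg h, if_neg fun h' => h (e.mp h')]
        rfl
    · intro r _ hr
      refine Finset.sum_eq_zero fun c _ => if_neg fun h => hr (Fin.ext ?_)
      exact h.1
    · exact fun h => absurd (Finset.mem_univ _) h

omit hk [NeZero m] in
variable (κ) in
/-- A finite check for the half-Eulerian property. -/
def checkHalfEulerian : Bool :=
  (List.finRange 8).all fun r => (List.finRange m).all fun c => (List.finRange 8).all fun r' =>
    (List.finRange m).all fun c' => !A.isRelated (r, c) (r', c') ||
      (polyAdd (polyScale 2 (A.intervalPoly κ (r, c) (r', c')))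
        [1 + (-1) ^ (r'.val - r.val)]).all (· == 0)

-- The check asks for identities of coefficients, so one finite computation covers every value of
-- `N`.
include hA in
lemma isHalfEulerian_of_check (h : A.checkHalfEulerian κ) : (A.poset k).IsHalfEulerian := by
  refine (A.presentation k hA).isHalfEulerian fun p q hpq => ?_
  simp only [checkHalfEulerian, List.all_eq_true (p := fun _ : Fin _ => _), List.mem_finRange,
    true_imp_iff] at h
  have h1 := h p.1 p.2 q.1 q.2
  have h2 : A.isRelated (p.1, p.2) (q.1, q.2) = true := hpq
  rw [h2, Bool.not_true, Bool.false_or] at h1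
  have h3 := polyEval_eq_zero (N : ℤ) h1
  rw [polyEval_add, polyEval_scale, ← A.intervalSum_eq hA hk, polyEval, polyEval, mul_zero,
    add_zero] at h3
  have h4 : (A.presentation k hA).rank q - (A.presentation k hA).rank p =
    q.1.val - p.1.val := rfl
  rw [h4]
  linarith

end GluingRecipe

/-! ### The limits of the flag vectors of the glued posets -/

/-- Decidable form of `Hits` for lists. -/
def hitsList (l : List (ℕ × ℕ)) (L : List ℕ) : Bool := l.all fun I => L.any (inInterval I)

lemma hits_iff_hitsList {l : List (ℕ × ℕ)} {L : List ℕ} {S : Finset ℕ} (h : ∀ s, s ∈ L ↔ s ∈ S) :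
    Hits l.toFinset S ↔ hitsList l L := by
  simp [Hits, hitsList, List.all_eq_true, List.any_eq_true, h]

/-- The sum of the flag vectors of the doubled limit posets of a list of interval systems. -/
noncomputable def limitSum (n : ℕ) (ls : List (List (ℕ × ℕ))) : FlagSpace n :=
  (ls.map fun l => limitVector n l.toFinset).sum

lemma limitSum_apply {n : ℕ} (ls : List (List (ℕ × ℕ))) {S : RankSet n} {L : List ℕ}
    (h : ∀ s, s ∈ L ↔ s ∈ (S : Finset ℕ)) :
    limitSum n ls S = 2 ^ (S : Finset ℕ).card * ((ls.countP fun l => hitsList l L : ℕ) : ℝ) := by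
  induction ls with
  | nil => simp [limitSum]
  | cons l ls ih =>
    have e : limitSum n (l :: ls) = limitVector n l.toFinset + limitSum n ls := by simp [limitSum]
    rw [e, Pi.add_apply, ih, List.countP_cons, limitVector]
    simp only [hits_iff_hitsList h]
    split_ifs <;> push_cast <;> ring

/-- The elements of `S` in descending order. -/
def rankList (S : Finset ℕ) : List (Fin 8) := [6, 5, 4, 3, 2, 1].filter fun r => r.val ∈ S

lemma rankList_mem_sublists (S : Finset ℕ) :
    rankList S ∈ ([6, 5, 4, 3, 2, 1] : List (Fin 8)).sublists :=
  List.mem_sublists.mpr List.filter_sublist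

lemma mem_rankList {S : Finset ℕ} (hS : S ⊆ Finset.Icc 1 6) (s : ℕ) :
    s ∈ (rankList S).map Fin.val ↔ s ∈ S := by
  simp only [rankList, List.mem_map, List.mem_filter, decide_eq_true_eq]
  constructor
  · rintro ⟨r, ⟨-, h⟩, rfl⟩; exact h
  · intro h
    have := Finset.mem_Icc.mp (hS h)
    refine ⟨⟨s, by omega⟩, ⟨?_, h⟩, rfl⟩
    simp only [List.mem_cons, Fin.ext_iff, List.not_mem_nil, or_false]
    change s = 6 ∨ s = 5 ∨ s = 4 ∨ s = 3 ∨ s = 2 ∨ s = 1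
    omega

lemma pairwise_rankList (S : Finset ℕ) : ((rankList S).map Fin.val).Pairwise (· > ·) := by
  have h : (([6, 5, 4, 3, 2, 1] : List (Fin 8)).map Fin.val).Pairwise (· > ·) := by decide
  exact h.sublist (List.filter_sublist.map _)

namespace GluingRecipe

variable {m l : ℕ} [NeZero m] (A : GluingRecipe m l)

/-- A finite check for the limits of the flag numbers. -/
def checkLimit (κ : Fin l → List ℤ) (e : ℕ) (ls : List (List (ℕ × ℕ))) : Bool :=
  ([6, 5, 4, 3, 2, 1] : List (Fin 8)).sublists.all fun L =>
    ((A.chainPoly κ L (7, A.rep 0 7)).drop (e + 1)).all (· == 0) &&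
    (A.chainPoly κ L (7, A.rep 0 7)).getD e 0 == (ls.countP fun l => hitsList l (L.map Fin.val) : ℕ)

lemma flagNumber_eq (hA : ∀ t r, A.rep (A.rep t r) r = A.rep t r) {k : Fin l → ℕ+} {N : ℕ}
    {κ : Fin l → List ℤ} (hk : ∀ j, ((k j : ℕ) : ℤ) = polyEval N (κ j)) {S : Finset ℕ}
    (hS : S ⊆ Finset.Icc 1 6) :
    ((A.poset k).flagNumber S : ℤ) = polyEval N (A.chainPoly κ (rankList S) (7, A.rep 0 7)) := by
  have hLS : ((rankList S).map Fin.val).toFinset = S := by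
    ext s; rw [List.mem_toFinset, mem_rankList hS]
  have h := (A.presentation k hA).flagNumber_eq_chainCount (A.totalRank_poset k)
    (pairwise_rankList S) (by rwa [hLS])
  have htop : (A.presentation k hA).type ⊤ = (7, A.rep 0 7) := Prod.ext rfl (A.rep_last _ 0)
  rw [hLS, htop] at h
  rw [h, A.chainCount_eq hA hk]

/-- For every rank set the check bounds the degree of the chain polynomial by `e` and compares its
coefficient of degree `e` with the number of interval systems met by the set. The factor `2 ^ |S|`
comes from the horizontal double on one side and from the limit vectors on the other. -/
lemma tendsto_flagVector (hA : ∀ t r, A.rep (A.rep t r) r = A.rep t r) {k : ℕ+ → Fin l → ℕ+}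
    {κ : Fin l → List ℤ} (hk : ∀ N j, ((k N j : ℕ) : ℤ) = polyEval ((N : ℕ) : ℤ) (κ j)) {e : ℕ}
    {ls : List (List (ℕ × ℕ))} (hcheck : A.checkLimit κ e ls) :
    Tendsto (fun N : ℕ+ => (((N : ℕ) : ℝ) ^ e)⁻¹ • flagVector 6 (A.poset (k N)).double)
      atTop (𝓝 (limitSum 6 ls)) := by
  rw [tendsto_pi_nhds]
  intro S
  have hS := Finset.mem_powerset.mp S.2
  have h := List.all_eq_true.mp hcheck _ (rankList_mem_sublists S)
  rw [Bool.and_eq_true, beq_iff_eq] at h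
  have hlim := (tendsto_inv_pow_mul_polyEval h.1).const_mul ((2 : ℝ) ^ (S : Finset ℕ).card)
  rw [h.2, Int.cast_natCast, ← limitSum_apply ls (mem_rankList hS)] at hlim
  refine hlim.congr fun N => ?_
  simp only [Pi.smul_apply, smul_eq_mul, flagVector]
  rw [GradedPoset.flagNumber_double (A.totalRank_poset _) hS, ← A.flagNumber_eq hA (hk N) hS]
  push_cast
  ring

end GluingRecipe

/-- The multiplicities `mult3` as polynomials. -/
def multPoly : Fin 7 → List ℤ := ![[1, 1], [1, 1], [1, 1], [0, 1], [0, 0, 1], [2, 1], [2, -1, 1]]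

lemma mult3_eq (N : ℕ+) (j : Fin 7) :
    ((mult3 N j : ℕ) : ℤ) = polyEval ((N : ℕ) : ℤ) (multPoly j) := by
  -- This makes the truncated subtraction in `N ^ 2 - N + 2` an honest one.
  have h : (N : ℕ) ≤ (N : ℕ) ^ 2 := Nat.le_self_pow two_ne_zero _
  fin_cases j <;> simp [mult3, multPoly, polyEval, Nat.cast_sub h] <;> ring

lemma natCast_eq_polyEval (N : ℕ+) : ((N : ℕ) : ℤ) = polyEval ((N : ℕ) : ℤ) [0, 1] := by
  simp [polyEval]

/-- The interval systems of `gluedSystems`. -/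
def gluedLists : Fin 4 → List (List (ℕ × ℕ)) :=
  ![[[(1, 2), (2, 6)], [(2, 5), (5, 6)]],
    [[(1, 3), (3, 4), (4, 6)], [(1, 2), (2, 3)], [(4, 5), (5, 6)]],
    [[(1, 2), (3, 4), (4, 5)], [(3, 5), (5, 6)], [(1, 2), (2, 5)]],
    [[(1, 2), (2, 4)], [(2, 5), (5, 6)], [(2, 3), (3, 4), (5, 6)]]]

lemma limitSum_gluedLists (m : Fin 4) :
    limitSum 6 (gluedLists m) = ∑ 𝓘 ∈ gluedSystems m, limitVector 6 𝓘 := by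
  have h : gluedSystems m = ((gluedLists m).map List.toFinset).toFinset := by
    revert m; decide
  have hn : ((gluedLists m).map List.toFinset).Nodup := by
    revert m; decide
  rw [h, List.sum_toFinset _ hn, List.map_map]
  rfl

lemma gluedPoset_totalRank (N : ℕ+) (m : Fin 4) : (gluedPoset N m).totalRank = 7 := by
  fin_cases m <;> rfl

/-- The glued posets are half-Eulerian. -/
lemma gluedPoset_isHalfEulerian (N : ℕ+) (m : Fin 4) : (gluedPoset N m).IsHalfEulerian := by
  fin_cases m
  · exact recipe1.isHalfEulerian_of_check (κ := fun _ => [0, 1]) (by decide)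
      (fun _ => natCast_eq_polyEval N) (by decide +kernel)
  · exact recipe2.isHalfEulerian_of_check (κ := fun _ => [0, 1]) (by decide)
      (fun _ => natCast_eq_polyEval N) (by decide +kernel)
  · exact recipe3.isHalfEulerian_of_check (by decide) (mult3_eq N) (by decide +kernel)
  · exact recipe4.isHalfEulerian_of_check (by decide) (mult3_eq N) (by decide +kernel)

/-- The limits of the normalized flag vectors of the doubles of the glued posets. -/
lemma gluedPoset_tendsto (m : Fin 4) :
    Tendsto (fun N : ℕ+ => (((N : ℕ) : ℝ) ^ gluedExponent m)⁻¹ •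
      flagVector 6 (gluedPoset N m).double) atTop (𝓝 (limitSum 6 (gluedLists m))) := by
  fin_cases m
  · exact recipe1.tendsto_flagVector (κ := fun _ => [0, 1]) (by decide)
      (fun N _ => natCast_eq_polyEval N) (by decide +kernel)
  · exact recipe2.tendsto_flagVector (κ := fun _ => [0, 1]) (by decide)
      (fun N _ => natCast_eq_polyEval N) (by decide +kernel)
  · exact recipe3.tendsto_flagVector (by decide) mult3_eq (by decide +kernel)
  · exact recipe4.tendsto_flagVector (by decide) mult3_eq (by decide +kernel)

/-! ### Even interval systems -/

/-- The even interval systems on `[1, 6]`. -/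
def evenSystems : List (List (ℕ × ℕ)) :=
  [[], [(1, 2)], [(1, 4)], [(1, 6)],
    [(2, 3)], [(2, 5)], [(3, 4)], [(3, 6)],
    [(4, 5)], [(5, 6)], [(1, 2), (3, 4)], [(1, 2), (3, 6)],
    [(1, 2), (4, 5)], [(1, 2), (5, 6)], [(1, 4), (3, 6)], [(1, 4), (5, 6)],
    [(2, 3), (4, 5)], [(2, 3), (5, 6)], [(3, 4), (5, 6)], [(1, 2), (3, 4), (5, 6)]]

/-- Whether two different intervals may belong to the same even interval system. -/
def evenCompatible (I J : ℕ × ℕ) : Bool :=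
  !(decide (J.1 ≤ I.1) && decide (I.2 ≤ J.2)) && ((min I.2 J.2 + 1 - max I.1 J.1) % 2 == 0)

lemma isEvenIntervalSystem_evenSystems :
    ∀ l ∈ evenSystems, IsEvenIntervalSystem 6 l.toFinset := by
  unfold IsEvenIntervalSystem IsIntervalSystem
  decide +kernel

/-- Members of an even system meet themselves evenly, hence are among the nine intervals of even
length in `[1,6]`. It remains to go through the pairwise compatible subfamilies. -/
lemma exists_evenSystems {𝓘 : Finset (ℕ × ℕ)} (h : IsEvenIntervalSystem 6 𝓘) :
    ∃ l ∈ evenSystems, 𝓘 = l.toFinset := by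
  let E : List (ℕ × ℕ) := [(1, 2), (1, 4), (1, 6), (2, 3), (2, 5), (3, 4), (3, 6), (4, 5), (5, 6)]
  have hmem : ∀ I ∈ 𝓘, I ∈ E := fun I hI => by
    have h1 := h.1.1 I hI
    have h2 := h.2 I hI I hI
    rw [Finset.inter_self, Nat.card_Icc, Nat.even_iff] at h2
    obtain ⟨a, b⟩ := I
    simp only at h1 h2
    have key : ∀ a b : Fin 7, 1 ≤ a.val → a.val ≤ b.val → (b.val + 1 - a.val) % 2 = 0 →
        (a.val, b.val) ∈ E := by decide
    exact key ⟨a, by omega⟩ ⟨b, by omega⟩ h1.1 h1.2.1 h2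
  have hpair : ∀ I ∈ 𝓘, ∀ J ∈ 𝓘, I ≠ J → evenCompatible I J := fun I hI J hJ hne => by
    have h1 : ¬(J.1 ≤ I.1 ∧ I.2 ≤ J.2) := fun hc =>
      hne (h.1.2 I hI J hJ (Finset.Icc_subset_Icc hc.1 hc.2))
    have h2 := h.2 I hI J hJ
    have e : Finset.Icc I.1 I.2 ∩ Finset.Icc J.1 J.2 =
        Finset.Icc (max I.1 J.1) (min I.2 J.2) := by
      ext s; simp only [Finset.mem_inter, Finset.mem_Icc]; omega
    rw [e, Nat.card_Icc, Nat.even_iff] at h2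
    simp only [evenCompatible, Bool.and_eq_true, beq_iff_eq]
    refine ⟨?_, h2⟩
    rw [Bool.not_eq_true', ← Bool.not_eq_true, Bool.and_eq_true, decide_eq_true_eq,
      decide_eq_true_eq]
    exact h1
  have key : ∀ L ∈ E.sublists, L.Pairwise (fun I J => evenCompatible I J && evenCompatible J I) →
      L ∈ evenSystems := by decide +kernel
  refine ⟨E.filter (· ∈ 𝓘), key _ (List.mem_sublists.mpr List.filter_sublist) ?_, ?_⟩
  · have hE : E.Nodup := by decide
    refine (List.Nodup.filter _ hE).pairwise_of_forall_ne fun I hI J hJ hne => ?_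
    have hI := of_decide_eq_true (List.mem_filter.mp hI).2
    have hJ := of_decide_eq_true (List.mem_filter.mp hJ).2
    rw [Bool.and_eq_true]
    exact ⟨hpair I hI J hJ hne, hpair J hJ I hI hne.symm⟩
  · ext I
    rw [List.mem_toFinset, List.mem_filter, decide_eq_true_eq]
    exact ⟨fun hI => ⟨hmem I hI, hI⟩, fun hI => hI.2⟩

/-! ### Even interval systems give half-Eulerian posets -/

/-- The alternating sums over open intervals of `P(6, 𝓘, N)` as polynomials in `N`. -/
def systemPoly (l : List (ℕ × ℕ)) (p q : Fin 8) : List ℤ :=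
  polySum ((List.finRange 8).map fun c => if decide (p < c) && decide (c < q) then
    polyScale ((-1) ^ (c.val - p.val)) (polyProd (l.map fun I =>
      if inInterval I c && !(inInterval I p || inInterval I q) then [0, 1] else [1])) else [])

lemma intervalSum_intervalPresentation {l : List (ℕ × ℕ)} (hl : l.Nodup)
    (h : IsIntervalSystem 6 l.toFinset) (N : ℕ+) (p q : Fin 8) :
    (intervalPresentation h N).intervalSum p q = polyEval ((N : ℕ) : ℤ) (systemPoly l p q) := by
  rw [CopyPresentation.intervalSum, Fin.sum_univ_def, systemPoly, polyEval_sum]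
  congr 2
  ext c
  rw [apply_ite (polyEval ((N : ℕ) : ℤ)), polyEval_scale, polyEval_prod]
  have e : (∏ I : l.toFinset, if inInterval I c && !(inInterval I p || inInterval I q)
      then ((N : ℕ) : ℤ) else 1) = (l.map fun I => polyEval ((N : ℕ) : ℤ)
        (if inInterval I c && !(inInterval I p || inInterval I q) then [0, 1] else [1])).prod := by
    rw [Finset.prod_coe_sort l.toFinset fun I =>
      if inInterval I c && !(inInterval I p || inInterval I q) then ((N : ℕ) : ℤ) else 1,
      List.prod_toFinset _ hl]
    congr 2
    ext I
    split_ifs <;> simp [polyEval]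
  rw [← e]
  rfl

/-- The posets `P(6, 𝓘, N)` of even interval systems are half-Eulerian. -/
lemma isHalfEulerian_intervalPoset {l : List (ℕ × ℕ)} (hl : l ∈ evenSystems) (N : ℕ+) :
    (intervalPoset 6 l.toFinset N).IsHalfEulerian := by
  have hcheck : ∀ l ∈ evenSystems, l.Nodup ∧ ∀ p q : Fin 8, p < q →
      (polyAdd (polyScale 2 (systemPoly l p q)) [1 + (-1) ^ (q.val - p.val)]).all (· == 0) := by
    decide +kernel
  have h := isEvenIntervalSystem_evenSystems l hl
  refine (intervalPresentation h.1 N).isHalfEulerian fun p q hpq => ?_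
  have h1 := polyEval_eq_zero ((N : ℕ) : ℤ) ((hcheck l hl).2 p q (of_decide_eq_true hpq))
  rw [polyEval_add, polyEval_scale, ← intervalSum_intervalPresentation (hcheck l hl).1 h.1,
    polyEval, polyEval, mul_zero, add_zero] at h1
  have h2 : (intervalPresentation h.1 N).rank q - (intervalPresentation h.1 N).rank p =
    q.val - p.val := rfl
  rw [h2]
  linarith

/-! ### Values of linear forms at sums of limit vectors -/

/-- The coordinate of `limitSum 6 ls` at the set of the elements of `L`. -/
def hitNumber (ls : List (List (ℕ × ℕ))) (L : List ℕ) : ℤ :=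
  2 ^ L.length * (ls.countP fun l => hitsList l L : ℕ)

lemma coord_limitSum (ls : List (List (ℕ × ℕ))) {L : List ℕ} (hL : L.Nodup)
    (h : L.toFinset ⊆ Finset.Icc 1 6) : coord (limitSum 6 ls) L.toFinset = hitNumber ls L := by
  rw [coord, dif_pos (Finset.mem_powerset.mpr h), limitSum_apply ls (L := L) (by simp), hitNumber,
    List.toFinset_card_of_nodup hL]
  push_cast
  rfl

/-- The sum of `(-2) ^ |T \ R| * u (R ∪ L)` over the subsets `R` of `T`. -/
def gapValue (u : List ℕ → ℤ) : List ℕ → List ℕ → ℤ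
  | [], L => u L
  | t :: T, L => gapValue u T (t :: L) - 2 * gapValue u T L

/-- Splitting the subsets `R` by whether they contain the head `t`: either `t` joins the index set,
or it contributes a factor `-2`. -/
lemma sum_powerset_eq_gapValue {u : Finset ℕ → ℝ} {w : List ℕ → ℤ} (T L : List ℕ)
    (hTL : (T ++ L).Nodup) (h : ∀ L' : List ℕ, L'.Nodup → L' ⊆ T ++ L → u L'.toFinset = w L') :
    ∑ R ∈ T.toFinset.powerset, (-2) ^ (T.toFinset \ R).card * u (L.toFinset ∪ R) =
      gapValue w T L := by
  induction T generalizing L with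
  | nil => simp [gapValue, h L (by simpa using hTL)]
  | cons t T ih =>
    rw [List.cons_append, List.nodup_cons, List.mem_append, not_or] at hTL
    obtain ⟨⟨htT, htL⟩, hTL⟩ := hTL
    have ht : t ∉ T.toFinset := by simpa using htT
    have h1 := ih L hTL fun L' hn hs => h L' hn (List.Subset.trans hs (List.subset_cons_self _ _))
    have h2 := ih (t :: L) (List.nodup_middle.mpr
        (List.nodup_cons.mpr ⟨by simp [htT, htL], hTL⟩)) fun L' hn hs => h L' hn
      (List.Subset.trans hs List.perm_middle.subset)
    rw [gapValue, Int.cast_sub, Int.cast_mul, ← h1, ← h2, List.toFinset_cons,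
      Finset.sum_powerset_insert ht, add_comm, Finset.mul_sum, Int.cast_ofNat, sub_eq_add_neg,
      ← Finset.sum_neg_distrib]
    congr 1
    · refine Finset.sum_congr rfl fun R hR => ?_
      rw [Finset.insert_sdiff_insert, Finset.sdiff_insert_of_notMem ht, List.toFinset_cons,
        Finset.union_insert, Finset.insert_union]
    · refine Finset.sum_congr rfl fun R hR => ?_
      have htR : t ∉ R := fun hc => ht (Finset.mem_powerset.mp hR hc)
      rw [Finset.insert_sdiff_of_notMem _ htR, Finset.card_insert_of_notMem (by simp [htT])]
      ring

/-- The value of `inequalityForm T V` at `limitSum 6 ls`. -/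
def gapNumber (ls : List (List (ℕ × ℕ))) (T V : List ℕ) : ℤ :=
  gapValue (hitNumber ls) T ([1, 2, 3, 4, 5, 6].filter fun s => !V.contains s)

lemma inequalityForm_limitSum (ls : List (List (ℕ × ℕ))) {T V : List ℕ} (hT : T.Nodup)
    (hTV : T ⊆ V) (hV : V ⊆ [1, 2, 3, 4, 5, 6]) :
    inequalityForm T.toFinset V.toFinset (limitSum 6 ls) = gapNumber ls T V := by
  have e : Finset.Icc 1 6 \ V.toFinset =
      ([1, 2, 3, 4, 5, 6].filter fun s => !V.contains s).toFinset := by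
    ext s
    rw [Finset.mem_sdiff, Finset.mem_Icc]
    simp
    omega
  rw [inequalityForm, gapNumber, e]
  have hn : ([1, 2, 3, 4, 5, 6] : List ℕ).Nodup := by decide
  refine sum_powerset_eq_gapValue _ _ ?_ fun L' hn' hs => coord_limitSum ls hn' fun s hs' => ?_
  · refine hT.append (hn.filter _) fun s hs hs' => ?_
    have h1 := hTV hs
    simp [h1] at hs'
  · have h1 : s ∈ ([1, 2, 3, 4, 5, 6] : List ℕ) := by
      rcases List.mem_append.mp (hs (List.mem_toFinset.mp hs')) with h | h
      · exact hV (hTV h)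
      · exact (List.mem_filter.mp h).1
    rw [Finset.mem_Icc]
    simp at h1
    omega

/-- The value of `tripleForm i j k` at `limitSum 6 ls`. -/
def tripleNumber (ls : List (List (ℕ × ℕ))) (i j k : ℕ) : ℤ :=
  hitNumber ls [i, k] - 2 * hitNumber ls [i] - 2 * hitNumber ls [k] + 2 * hitNumber ls [j]

lemma tripleForm_limitSum (ls : List (List (ℕ × ℕ))) {i j k : ℕ} (hi : 1 ≤ i) (hij : i < j)
    (hjk : j < k) (hk : k ≤ 6) : tripleForm i j k (limitSum 6 ls) = tripleNumber ls i j k := by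
  have h : ∀ s, 1 ≤ s → s ≤ 6 → coord (limitSum 6 ls) {s} = hitNumber ls [s] := fun s h1 h2 => by
    rw [← coord_limitSum ls (List.nodup_singleton s) (by simp; omega)]
    simp
  have hik : coord (limitSum 6 ls) {i, k} = hitNumber ls [i, k] := by
    rw [← coord_limitSum ls (by simp; omega)
      (fun s => by simp only [List.mem_toFinset, List.mem_cons, Finset.mem_Icc]; simp; omega)]
    simp
  rw [tripleForm, hik, h i hi (by omega), h j (by omega) (by omega), h k (by omega) hk,
    tripleNumber]
  push_cast
  rfl

/-! ### The inequalities as linear forms -/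

/-- `inequalityForm T V` as a linear form. -/
noncomputable def inequalityLinear (n : ℕ) (T V : Finset ℕ) : FlagSpace n →ₗ[ℝ] ℝ :=
  ∑ R ∈ T.powerset, (-2 : ℝ) ^ (T \ R).card • coordForm n ((Finset.Icc 1 n \ V) ∪ R)

lemma inequalityLinear_apply {n : ℕ} (T V : Finset ℕ) (v : FlagSpace n) :
    inequalityLinear n T V v = inequalityForm T V v := by
  simp [inequalityLinear, inequalityForm, coordForm]

/-- `tripleForm i j k` as a linear form. -/
noncomputable def tripleLinear (n i j k : ℕ) : FlagSpace n →ₗ[ℝ] ℝ :=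
  coordForm n {i, k} - (2 : ℝ) • coordForm n {i} - (2 : ℝ) • coordForm n {k} +
    (2 : ℝ) • coordForm n {j}

lemma tripleLinear_apply {n : ℕ} (i j k : ℕ) (v : FlagSpace n) :
    tripleLinear n i j k v = tripleForm i j k v := by
  simp [tripleLinear, tripleForm, coordForm]

/-! ### The forms in `L_Q` expressed through the numbers `f_S` -/

lemma sum_Icc_neg_one_pow_card {α : Type*} [DecidableEq α] (A V : Finset α) :
    ∑ Q ∈ Finset.Icc A V, (-1 : ℝ) ^ Q.card = if A = V then (-1) ^ V.card else 0 := by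
  by_cases hAV : A ⊆ V
  · have hinj : Set.InjOn (fun R => A ∪ R) ((V \ A).powerset : Set (Finset α)) := by
      intro R hR R' hR' h
      have hd : ∀ R ∈ ((V \ A).powerset : Set (Finset α)), (A ∪ R) \ A = R := fun R hR =>
        Finset.union_sdiff_cancel_left
          (Finset.disjoint_of_subset_right (Finset.mem_powerset.mp hR) Finset.disjoint_sdiff)
      rw [← hd R hR, ← hd R' hR']
      exact congrArg (· \ A) h
    rw [Finset.Icc_eq_image_powerset hAV, Finset.sum_image hinj]
    have h : ∀ R ∈ (V \ A).powerset, (-1 : ℝ) ^ (A ∪ R).card = (-1) ^ A.card * (-1) ^ R.card :=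
      fun R hR => by
        rw [Finset.card_union_of_disjoint (Finset.disjoint_of_subset_right
          (Finset.mem_powerset.mp hR) Finset.disjoint_sdiff), pow_add]
    rw [Finset.sum_congr rfl h, ← Finset.mul_sum]
    have h2 := congrArg (Int.cast : ℤ → ℝ) (Finset.sum_powerset_neg_one_pow_card (x := V \ A))
    push_cast at h2
    rw [h2]
    by_cases hVA : V ⊆ A
    · rw [if_pos (Finset.sdiff_eq_empty_iff_subset.mpr hVA), if_pos (hAV.antisymm hVA), mul_one,
        hAV.antisymm hVA]
    · rw [if_neg (mt Finset.sdiff_eq_empty_iff_subset.mp hVA), if_neg fun h => hVA h.ge, mul_zero]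
  · rw [Finset.Icc_eq_empty hAV, Finset.sum_empty, if_neg fun h => hAV h.le]

/-- The form `facetForm M V` is a multiple of `inequalityForm M V`. -/
lemma facetForm_eq {n : ℕ} {M V : Finset ℕ} (hV : V ⊆ Finset.Icc 1 n) (hM : M ⊆ V)
    (v : FlagSpace n) :
    facetForm M V v = (-1) ^ (M.card / 2) * (-1 / 2) ^ M.card * (1 / 2) ^ (n - V.card) *
      inequalityForm M V v := by
  set N := Finset.Icc 1 n with hN
  have hcard : ∀ Q ⊆ N, Q.card ≤ n := fun Q hQ => by
    simpa [hN] using Finset.card_le_card hQ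
  -- After exchanging the sums, the coefficient of `f_T` is an alternating sum over the `Q` between
  -- `M ∪ (N \ T)` and `V`. It vanishes unless these two sets are equal, that is, unless `T = (N \
  -- V) ∪ R` with `R ⊆ M`.
  have h1 : ∑ Q ∈ V.powerset with M ⊆ Q, coordL v Q =
      ∑ T ∈ N.powerset, (-1 / 2 : ℝ) ^ T.card * coord v T * ((-1) ^ n *
        ∑ Q ∈ Finset.Icc (M ∪ N \ T) V, (-1 : ℝ) ^ Q.card) := by
    simp only [coordL, Finset.mul_sum]
    rw [Finset.sum_comm' (t' := N.powerset) (s' := fun T => Finset.Icc (M ∪ N \ T) V)]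
    · refine Finset.sum_congr rfl fun T _ => Finset.sum_congr rfl fun Q hQ => ?_
      have hQn := hcard Q ((Finset.mem_Icc.mp hQ).2.trans hV)
      have e : (-1 : ℝ) ^ (n - Q.card) = (-1) ^ n * (-1) ^ Q.card := by
        rw [← Nat.sub_add_cancel hQn, pow_add, Nat.add_sub_cancel, mul_assoc, ← mul_pow]
        simp
      rw [e]; ring
    · intro Q T
      have : N \ Q ⊆ T ↔ N \ T ⊆ Q := by
        constructor <;> intro h s hs <;> by_contra hc <;> rw [Finset.mem_sdiff] at hs <;>
          exact hs.2 (h (Finset.mem_sdiff.mpr ⟨hs.1, hc⟩))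
      simp only [Finset.mem_filter, Finset.mem_powerset, Finset.mem_Icc,
        Finset.union_subset_iff, ← hN, this]
      tauto
  rw [facetForm, h1, inequalityForm, Finset.mul_sum, Finset.mul_sum, ← hN]
  symm
  have hRV : ∀ R ∈ M.powerset, Disjoint (N \ V) R := fun R hR =>
    Finset.disjoint_of_subset_right ((Finset.mem_powerset.mp hR).trans hM) Finset.sdiff_disjoint
  apply Finset.sum_of_injOn (fun R => (N \ V) ∪ R)
  · intro R hR R' hR' h
    rw [← Finset.union_sdiff_cancel_left (hRV R hR), ← Finset.union_sdiff_cancel_left (hRV R' hR')]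
    exact congrArg (· \ (N \ V)) h
  · intro R hR
    exact Finset.mem_powerset.mpr (Finset.union_subset Finset.sdiff_subset
      (((Finset.mem_powerset.mp hR).trans hM).trans hV))
  · intro T hT hT'
    rw [sum_Icc_neg_one_pow_card, if_neg, mul_zero, mul_zero, mul_zero]
    rintro rfl
    refine hT' ⟨T ∩ M, Finset.mem_powerset.mpr Finset.inter_subset_right, ?_⟩
    have hTN := Finset.mem_powerset.mp hT
    ext s
    have h1 : s ∈ T → s ∈ N := fun h => hTN h
    simp only [Finset.mem_union, Finset.mem_sdiff, Finset.mem_inter]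
    tauto
  · intro R hR
    have hRM := Finset.mem_powerset.mp hR
    have e : M ∪ N \ (N \ V ∪ R) = V := by
      ext s
      have h1 : s ∈ V → s ∈ N := fun h => hV h
      have h2 : s ∈ M → s ∈ V := fun h => hM h
      have h3 : s ∈ R → s ∈ M := fun h => hRM h
      simp only [Finset.mem_union, Finset.mem_sdiff]
      tauto
    have hNc : N.card = n := by simp [hN]
    have hVn := hcard V hV
    rw [e, sum_Icc_neg_one_pow_card, if_pos rfl, Finset.card_union_of_disjoint (hRV R hR),
      Finset.card_sdiff_of_subset hV, hNc, Finset.card_sdiff_of_subset hRM, pow_add]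
    obtain ⟨c, hc⟩ := Nat.exists_eq_add_of_le (Finset.card_le_card hRM)
    obtain ⟨d, hd⟩ := Nat.exists_eq_add_of_le hVn
    have h3 : (-1 : ℝ) ^ n * (-1) ^ V.card = (-1) ^ d := by
      rw [hd, pow_add, mul_right_comm, ← mul_pow]; simp
    have h4 : n - V.card = d := by omega
    rw [h3, hc, h4, Nat.add_sub_cancel_left, pow_add]
    have h5 : (-1 / 2 : ℝ) ^ d * (-1) ^ d = (1 / 2) ^ d := by rw [← mul_pow]; norm_num
    have h6 : (-1 / 2 : ℝ) ^ c * (-2) ^ c = 1 := by rw [← mul_pow]; norm_num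
    linear_combination (-1 : ℝ) ^ ((R.card + c) / 2) * (-1 / 2) ^ R.card *
      coord v (N \ V ∪ R) * ((1 / 2) ^ d * h6 - h5)

/-! ### Generators and inequalities of the cone for `n = 6` -/

/-- The lists of interval systems whose limit vectors add up to the generators of the cone. -/
def generatorLists : Fin 20 ⊕ Fin 4 → List (List (ℕ × ℕ)) :=
  Sum.elim (fun j => [evenSystems[j]]) gluedLists

/-- The generators of the cone. -/
noncomputable def generator (j : Fin 20 ⊕ Fin 4) : FlagSpace 6 := limitSum 6 (generatorLists j)

/-- Pairs `(T, V)` whose inequalities give the facets of the first and of the second kind. -/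
def facetLists : Fin 15 ⊕ Fin 4 → List ℕ × List ℕ :=
  Sum.elim ![([3], [3, 4]), ([4], [1, 2, 3, 4]), ([4], [1, 2, 4, 5]), ([1, 4], [1, 2, 4, 5]),
      ([1, 5], [1, 2, 5, 6]), ([2], [2, 3, 5, 6]), ([2, 5], [2, 3, 5, 6]), ([3], [3, 4, 5, 6]),
      ([5], [1, 2, 3, 4, 5]), ([5], [1, 2, 3, 5, 6]), ([1], [1, 2, 4, 5, 6]),
      ([2], [2, 3, 4, 5, 6]), ([], [1, 2, 3, 4, 5, 6]), ([1], [1, 2, 3, 4, 5, 6]),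
      ([6], [1, 2, 3, 4, 5, 6])]
    ![([1], [1, 2, 3, 4, 5]), ([6], [2, 3, 4, 5, 6]), ([3], [1, 2, 3, 4, 5, 6]),
      ([4], [1, 2, 3, 4, 5, 6])]

/-- Triples `i < j < k` whose inequalities give facets. -/
def facetTriples : Fin 4 → ℕ × ℕ × ℕ := ![(1, 3, 6), (1, 4, 6), (2, 3, 5), (2, 4, 5)]

/-- The inequalities of the cone. -/
noncomputable def facetLinear : (Fin 15 ⊕ Fin 4) ⊕ Fin 4 → FlagSpace 6 →ₗ[ℝ] ℝ :=
  Sum.elim (fun i => inequalityLinear 6 (facetLists i).1.toFinset (facetLists i).2.toFinset)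
    fun i => tripleLinear 6 (facetTriples i).1 (facetTriples i).2.1 (facetTriples i).2.2

/-- The value of the `i`-th inequality at the `j`-th generator. -/
def slack : (Fin 15 ⊕ Fin 4) ⊕ Fin 4 → Fin 20 ⊕ Fin 4 → ℤ :=
  Sum.elim (fun i j => gapNumber (generatorLists j) (facetLists i).1 (facetLists i).2)
    fun i j => tripleNumber (generatorLists j) (facetTriples i).1 (facetTriples i).2.1
      (facetTriples i).2.2

lemma facetLists_valid : ∀ i, (facetLists i).1.Nodup ∧ (facetLists i).1 ⊆ (facetLists i).2 ∧
    (facetLists i).2 ⊆ [1, 2, 3, 4, 5, 6] := by decide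

lemma facetTriples_valid : ∀ i, 1 ≤ (facetTriples i).1 ∧
    (facetTriples i).1 < (facetTriples i).2.1 ∧ (facetTriples i).2.1 < (facetTriples i).2.2 ∧
    (facetTriples i).2.2 ≤ 6 := by decide

lemma facetLinear_generator (i : (Fin 15 ⊕ Fin 4) ⊕ Fin 4) (j : Fin 20 ⊕ Fin 4) :
    facetLinear i (generator j) = slack i j := by
  rcases i with i | i
  · obtain ⟨h1, h2, h3⟩ := facetLists_valid i
    exact (inequalityLinear_apply _ _ _).trans (inequalityForm_limitSum _ h1 h2 h3)
  · obtain ⟨h1, h2, h3, h4⟩ := facetTriples_valid i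
    exact (tripleLinear_apply _ _ _ _).trans (tripleForm_limitSum _ h1 h2 h3 h4)

/-- No zero set of a column of the table is contained in that of another column, which makes every
generator extreme. `slack_sep_forms` is the same statement for rows and facets. -/
lemma slack_sep_rays : ∀ j k, j ≠ k → ∃ i, slack i j = 0 ∧ 0 < slack i k := by decide +kernel

lemma slack_sep_forms : ∀ i k, i ≠ k → ∃ j, slack i j = 0 ∧ 0 < slack k j := by decide +kernel

/-! ### The valid inequalities -/

lemma facetLinear_flagVector_nonneg {P : GradedPoset} (hP : P.IsEulerian)
    (hr : P.totalRank = 6 + 1) (i : (Fin 15 ⊕ Fin 4) ⊕ Fin 4) :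
    0 ≤ facetLinear i (flagVector 6 P) := by
  rcases i with i | i
  · have h : ∀ i, (facetLists i).2.toFinset ⊆ Finset.Icc 1 6 ∧
        (facetLists i).1.toFinset ⊆ (facetLists i).2.toFinset ∧
        ∀ t ∈ (facetLists i).1.toFinset, ∀ r ∈ (facetLists i).1.toFinset, r ≠ t →
          ∃ s ∈ Finset.Icc 1 6 \ (facetLists i).2.toFinset, (r < s ∧ s < t) ∨ (t < s ∧ s < r) := by
      decide +kernel
    obtain ⟨h1, h2, h3⟩ := h i
    exact (hP.inequalityForm_nonneg hr h1 h2 h3).trans_eq (inequalityLinear_apply _ _ _).symm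
  · obtain ⟨h1, h2, h3, h4⟩ := facetTriples_valid i
    exact (hP.tripleForm_nonneg hr h1 h2 h3 h4).trans_eq (tripleLinear_apply _ _ _ _).symm

/-- The cone cut out by the generalized Dehn-Sommerville relations and the inequalities. -/
noncomputable def facetCone : PointedCone ℝ (FlagSpace 6) :=
  PointedCone.ofSubmodule (dehnSommervilleSpace 6) ⊓
    ⨅ i, (PointedCone.positive ℝ ℝ).comap (facetLinear i)

lemma mem_facetCone {v : FlagSpace 6} :
    v ∈ facetCone ↔ v ∈ dehnSommervilleSpace 6 ∧ ∀ i, 0 ≤ facetLinear i v := by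
  simp [facetCone, Submodule.mem_iInf]

lemma isClosed_facetCone : IsClosed (facetCone : Set (FlagSpace 6)) := by
  have e : (facetCone : Set (FlagSpace 6)) =
      (dehnSommervilleSpace 6 : Set (FlagSpace 6)) ∩ ⋂ i, {v | 0 ≤ facetLinear i v} := by
    ext v
    rw [SetLike.mem_coe, mem_facetCone]
    simp
  rw [e]
  refine (Submodule.closed_of_finiteDimensional _).inter (isClosed_iInter fun i => ?_)
  exact isClosed_le continuous_const (LinearMap.continuous_of_finiteDimensional _)

/-- The outer bound passes from flag vectors to the closed cone because it is itself a closed convex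
cone. -/
lemma eulerianCone_le_facetCone : eulerianCone 6 ≤ facetCone := by
  refine closure_minimal ?_ isClosed_facetCone
  refine Submodule.span_le.mpr ?_
  rintro _ ⟨P, hP, hr, rfl⟩
  exact mem_facetCone.mpr ⟨hP.flagVector_mem hr, facetLinear_flagVector_nonneg hP hr⟩

lemma mem_eulerianCone_of_tendsto {n : ℕ} {P : ℕ+ → GradedPoset} {e : ℕ} {v : FlagSpace n}
    (hP : ∀ N, (P N).IsHalfEulerian) (hr : ∀ N, (P N).totalRank = n + 1)
    (h : Tendsto (fun N : ℕ+ => (((N : ℕ) : ℝ) ^ e)⁻¹ • flagVector n (P N).double) atTop (𝓝 v)) :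
    v ∈ eulerianCone n := by
  refine mem_closure_of_tendsto h (Eventually.of_forall fun N => ?_)
  refine PointedCone.smul_mem _ (by positivity) (Submodule.subset_span ?_)
  exact ⟨_, hP N, hr N, rfl⟩

lemma generator_inl (j : Fin 20) : generator (.inl j) = limitVector 6 evenSystems[j].toFinset := by
  simp [generator, generatorLists, limitSum]

lemma generator_mem_eulerianCone (j : Fin 20 ⊕ Fin 4) : generator j ∈ eulerianCone 6 := by
  rcases j with j | m
  · rw [generator_inl]
    have hl : evenSystems[j] ∈ evenSystems := List.getElem_mem _
    exact mem_eulerianCone_of_tendsto (isHalfEulerian_intervalPoset hl)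
      (fun N => totalRank_intervalPoset N) (isDoubledLimitFlagVector_limitVector
        (isEvenIntervalSystem_evenSystems _ hl).1)
  · exact mem_eulerianCone_of_tendsto (fun N => gluedPoset_isHalfEulerian N m)
      (fun N => gluedPoset_totalRank N m) (gluedPoset_tendsto m)

lemma generator_mem_dehnSommervilleSpace (j : Fin 20 ⊕ Fin 4) :
    generator j ∈ dehnSommervilleSpace 6 :=
  (mem_facetCone.mp (eulerianCone_le_facetCone (generator_mem_eulerianCone j))).1

/-! ### Every point of the cone is a combination of the generators -/

/-- One step of Fourier-Motzkin elimination: an unknown can be chosen once every lower bound is at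
most every upper bound; the largest lower bound will do. -/
lemma exists_between_lists {l u : List ℝ} (hl : l ≠ []) (h : ∀ a ∈ l, ∀ b ∈ u, a ≤ b) :
    ∃ t, (∀ a ∈ l, a ≤ t) ∧ ∀ b ∈ u, t ≤ b := by
  obtain ⟨t, ht, hmax⟩ := Finset.exists_max_image l.toFinset id (by simpa using hl)
  exact ⟨t, fun a ha => hmax a (by simpa using ha), h t (by simpa using ht)⟩

/-- Nonnegative multiples of eleven of the generators can be split off. -/
lemma exists_coefficients {b0 b1 b2 b3 b4 b5 b6 b7 b8 b9 b10 b11 b12 : ℝ}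
    (h0 : 0 ≤ b7 + b8 + b10 + b11 + b12)
    (h1 : 0 ≤ b1 + b5 + b7)
    (h2 : 0 ≤ b2 + b10)
    (h3 : 0 ≤ b11)
    (h4 : 0 ≤ b8)
    (h5 : 0 ≤ b10)
    (h6 : 0 ≤ b6 + b12)
    (h7 : 0 ≤ b4 + b5)
    (h8 : 0 ≤ b2 + b9 + b10 + b11 + b12)
    (h9 : 0 ≤ b3 + b7 + b9 + b10 + b11 + b12)
    (h10 : 0 ≤ b4 + b9 + b10 + b11 + b12)
    (h11 : 0 ≤ b9 + b10 + b11 + b12)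
    (h12 : 0 ≤ b0)
    (h13 : 0 ≤ b1)
    (h14 : 0 ≤ b3)
    (h15 : 0 ≤ b1 + b4 + b5 + b9)
    (h16 : 0 ≤ b3 + b4 + b5 + b9)
    (h17 : 0 ≤ b1 + b5)
    (h18 : 0 ≤ b1 + b2 + b5)
    (h19 : 0 ≤ b1 + b4 + 2 * b5 + b9)
    (h20 : 0 ≤ b1 + b2 + b4 + 2 * b5 + b9)
    (h21 : 0 ≤ b1 + b4 + 2 * b5 + b6)
    (h22 : 0 ≤ b1 + b2 + b4 + 2 * b5 + b6) :
    ∃ t0 t1 t2 t3 t4 t5 t6 t7 t8 t9 t10 : ℝ, 0 ≤ t0 ∧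
      0 ≤ t1 ∧
      0 ≤ t2 ∧
      0 ≤ t3 ∧
      0 ≤ t4 ∧
      0 ≤ t5 ∧
      0 ≤ t6 ∧
      0 ≤ t7 ∧
      0 ≤ t8 ∧
      0 ≤ t9 ∧
      0 ≤ t10 ∧
      0 ≤ b0 ∧
      t1 + t2 ≤ b1 ∧
      0 ≤ b2 + t0 ∧
      t1 + t4 ≤ b3 ∧
      t2 + t6 ≤ b4 + t0 + t3 ∧
      t0 + t3 + t4 + t5 ≤ b5 + t2 ∧
      t7 + t8 + t9 + t10 ≤ b6 + t1 + t3 + t4 + t5 + t6 ∧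
      t9 ≤ b7 + t0 + t1 + t3 + t4 ∧
      t8 ≤ b8 ∧
      t8 + t9 ≤ b9 + t1 + t4 + t5 + t6 ∧
      t0 + t10 ≤ b10 ∧
      t7 ≤ b11 ∧
      t1 + t3 + t4 + t5 + t6 ≤ b12 + t7 + t8 + t9 + t10 := by
  -- The unknowns are chosen one after another. The bounds imposed on each also include conditions
  -- needed for later choices: for instance `t0 ≤ b10` leaves room for `t10`, and `t0 ≤ b1 + b5` for
  -- `t1` and `t2`. Compatibility of each pair of bounds follows from the hypotheses and the bounds
  -- already secured.
  obtain ⟨t0, hl, hu⟩ := exists_between_lists (l := [0, -b2]) (u := [b9 + b10 + b11 + b12, b10, b1 +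
    b5, b1 + b4 + 2 * b5 + b9, b1 + b4 + 2 * b5 + b6]) (by simp) (by
    simp only [List.forall_mem_cons, List.not_mem_nil, false_imp_iff, implies_true, and_true]
    refine ⟨⟨?_, ?_, ?_, ?_, ?_⟩, ⟨?_, ?_, ?_, ?_, ?_⟩⟩
    · linarith only [h11]
    · linarith only [h5]
    · linarith only [h17]
    · linarith only [h19]
    · linarith only [h21]
    · linarith only [h8]
    · linarith only [h2]
    · linarith only [h18]
    · linarith only [h20]
    · linarith only [h22])
  simp only [List.forall_mem_cons, List.not_mem_nil, false_imp_iff, implies_true, and_true] at hl hu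
  obtain ⟨h23, h24⟩ := hl
  obtain ⟨h25, h26, h27, h28, h29⟩ := hu
  obtain ⟨t1, hl, hu⟩ := exists_between_lists (l := [-b4 - b5 - b7 - b9 - b10 - b11 - b12, -b4 - b5
    - b9, 0]) (u := [b1, b3, b1 + b5 - t0]) (by simp) (by
    simp only [List.forall_mem_cons, List.not_mem_nil, false_imp_iff, implies_true, and_true]
    refine ⟨⟨?_, ?_, ?_⟩, ⟨?_, ?_, ?_⟩, ⟨?_, ?_, ?_⟩⟩
    · linarith only [h10, h1]
    · linarith only [h9, h7]
    · linarith only [h25, h1, h7]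
    · linarith only [h15]
    · linarith only [h16]
    · linarith only [h28]
    · linarith only [h13]
    · linarith only [h14]
    · linarith only [h27])
  simp only [List.forall_mem_cons, List.not_mem_nil, false_imp_iff, implies_true, and_true] at hl hu
  obtain ⟨h30, h31, h32⟩ := hl
  obtain ⟨h33, h34, h35⟩ := hu
  obtain ⟨t2, hl, hu⟩ := exists_between_lists (l := [-b5 - b7 - t1, 0, -b5 + t0, -b4 - 2 * b5 - b6 +
    t0 - t1]) (u := [b4 + b9 + b10 + b11 + b12, b1 - t1]) (by simp) (by
    simp only [List.forall_mem_cons, List.not_mem_nil, false_imp_iff, implies_true, and_true]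
    refine ⟨⟨?_, ?_⟩, ⟨?_, ?_⟩, ⟨?_, ?_⟩, ⟨?_, ?_⟩⟩
    · linarith only [h30]
    · linarith only [h1]
    · linarith only [h10]
    · linarith only [h33]
    · linarith only [h7, h25]
    · linarith only [h35]
    · linarith only [h7, h31, h3, h6, h26]
    · linarith only [h29])
  simp only [List.forall_mem_cons, List.not_mem_nil, false_imp_iff, implies_true, and_true] at hl hu
  obtain ⟨h36, h37, h38, h39⟩ := hl
  obtain ⟨h40, h41⟩ := hu
  obtain ⟨t3, hl, hu⟩ := exists_between_lists (l := [-b3 - b7 - t0, 0, -b4 - t0 + t2, -b4 - b5 - b6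
    - t1]) (u := [b9 + b10 + b11 + b12 - t0, b5 - t0 + t2]) (by simp) (by
    simp only [List.forall_mem_cons, List.not_mem_nil, false_imp_iff, implies_true, and_true]
    refine ⟨⟨?_, ?_⟩, ⟨?_, ?_⟩, ⟨?_, ?_⟩, ⟨?_, ?_⟩⟩
    · linarith only [h9]
    · linarith only [h36, h34]
    · linarith only [h25]
    · linarith only [h38]
    · linarith only [h40]
    · linarith only [h7]
    · linarith only [h31, h3, h6, h26]
    · linarith only [h39])
  simp only [List.forall_mem_cons, List.not_mem_nil, false_imp_iff, implies_true, and_true] at hl hu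
  obtain ⟨h42, h43, h44, h45⟩ := hl
  obtain ⟨h46, h47⟩ := hu
  obtain ⟨t4, hl, hu⟩ := exists_between_lists (l := [-b7 - t0 - t1 - t3, 0]) (u := [b5 - t0 + t2 -
    t3, b3 - t1]) (by simp) (by
    simp only [List.forall_mem_cons, List.not_mem_nil, false_imp_iff, implies_true, and_true]
    refine ⟨⟨?_, ?_⟩, ⟨?_, ?_⟩⟩
    · linarith only [h36]
    · linarith only [h42]
    · linarith only [h47]
    · linarith only [h34])
  simp only [List.forall_mem_cons, List.not_mem_nil, false_imp_iff, implies_true, and_true] at hl hu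
  obtain ⟨h48, h49⟩ := hl
  obtain ⟨h50, h51⟩ := hu
  obtain ⟨t5, hl, hu⟩ := exists_between_lists (l := [0, -b4 - b9 - t0 - t1 + t2 - t3 - t4, -b4 - b6
    - t0 - t1 + t2 - 2 * t3 - t4]) (u := [b7 + b8 + b10 + b11 + b12, b5 - t0 + t2 - t3 - t4]) (by
    simp) (by
    simp only [List.forall_mem_cons, List.not_mem_nil, false_imp_iff, implies_true, and_true]
    refine ⟨⟨?_, ?_⟩, ⟨?_, ?_⟩, ⟨?_, ?_⟩⟩
    · linarith only [h0]
    · linarith only [h50]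
    · linarith only [h40, h4, h48]
    · linarith only [h31]
    · linarith only [h3, h4, h6, h26, h44, h48]
    · linarith only [h45])
  simp only [List.forall_mem_cons, List.not_mem_nil, false_imp_iff, implies_true, and_true] at hl hu
  obtain ⟨h52, h53, h54⟩ := hl
  obtain ⟨h55, h56⟩ := hu
  obtain ⟨t6, hl, hu⟩ := exists_between_lists (l := [0, -b9 - t1 - t4 - t5, -b6 - t1 - t3 - t4 -
    t5]) (u := [b7 + b8 + b10 + b11 + b12 - t5, b4 + t0 - t2 + t3]) (by simp) (by
    simp only [List.forall_mem_cons, List.not_mem_nil, false_imp_iff, implies_true, and_true]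
    refine ⟨⟨?_, ?_⟩, ⟨?_, ?_⟩, ⟨?_, ?_⟩⟩
    · linarith only [h55]
    · linarith only [h44]
    · linarith only [h46, h4, h48]
    · linarith only [h53]
    · linarith only [h3, h4, h6, h26, h48]
    · linarith only [h54])
  simp only [List.forall_mem_cons, List.not_mem_nil, false_imp_iff, implies_true, and_true] at hl hu
  obtain ⟨h57, h58, h59⟩ := hl
  obtain ⟨h60, h61⟩ := hu
  obtain ⟨t7, hl, hu⟩ := exists_between_lists (l := [-b7 - b8 - b10 - b12 + t5 + t6, -b9 - b10 - b12
    + t0 + t3, 0]) (u := [b11, b6 + t1 + t3 + t4 + t5 + t6]) (by simp) (by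
    simp only [List.forall_mem_cons, List.not_mem_nil, false_imp_iff, implies_true, and_true]
    refine ⟨⟨?_, ?_⟩, ⟨?_, ?_⟩, ⟨?_, ?_⟩⟩
    · linarith only [h60]
    · linarith only [h4, h6, h26, h48]
    · linarith only [h46]
    · linarith only [h58, h6, h26]
    · linarith only [h3]
    · linarith only [h59])
  simp only [List.forall_mem_cons, List.not_mem_nil, false_imp_iff, implies_true, and_true] at hl hu
  obtain ⟨h62, h63, h64⟩ := hl
  obtain ⟨h65, h66⟩ := hu
  obtain ⟨t8, hl, hu⟩ := exists_between_lists (l := [-b7 - b10 - b12 + t5 + t6 - t7, 0]) (u := [b8,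
    b9 + t1 + t4 + t5 + t6, b6 + t1 + t3 + t4 + t5 + t6 - t7]) (by simp) (by
    simp only [List.forall_mem_cons, List.not_mem_nil, false_imp_iff, implies_true, and_true]
    refine ⟨⟨?_, ?_, ?_⟩, ⟨?_, ?_, ?_⟩⟩
    · linarith only [h62]
    · linarith only [h63, h48]
    · linarith only [h6, h26, h48]
    · linarith only [h4]
    · linarith only [h58]
    · linarith only [h66])
  simp only [List.forall_mem_cons, List.not_mem_nil, false_imp_iff, implies_true, and_true] at hl hu
  obtain ⟨h67, h68⟩ := hl
  obtain ⟨h69, h70, h71⟩ := hu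
  obtain ⟨t9, hl, hu⟩ := exists_between_lists (l := [-b10 - b12 + t0 + t1 + t3 + t4 + t5 + t6 - t7 -
    t8, 0]) (u := [b7 + t0 + t1 + t3 + t4, b9 + t1 + t4 + t5 + t6 - t8, b6 + t1 + t3 + t4 + t5 + t6
    - t7 - t8]) (by simp) (by
    simp only [List.forall_mem_cons, List.not_mem_nil, false_imp_iff, implies_true, and_true]
    refine ⟨⟨?_, ?_, ?_⟩, ⟨?_, ?_, ?_⟩⟩
    · linarith only [h67]
    · linarith only [h63]
    · linarith only [h6, h26]
    · linarith only [h48]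
    · linarith only [h70]
    · linarith only [h71])
  simp only [List.forall_mem_cons, List.not_mem_nil, false_imp_iff, implies_true, and_true] at hl hu
  obtain ⟨h72, h73⟩ := hl
  obtain ⟨h74, h75, h76⟩ := hu
  obtain ⟨t10, hl, hu⟩ := exists_between_lists (l := [0, -b12 + t1 + t3 + t4 + t5 + t6 - t7 - t8 -
    t9]) (u := [b6 + t1 + t3 + t4 + t5 + t6 - t7 - t8 - t9, b10 - t0]) (by simp) (by
    simp only [List.forall_mem_cons, List.not_mem_nil, false_imp_iff, implies_true, and_true]
    refine ⟨⟨?_, ?_⟩, ⟨?_, ?_⟩⟩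
    · linarith only [h76]
    · linarith only [h26]
    · linarith only [h6]
    · linarith only [h72])
  simp only [List.forall_mem_cons, List.not_mem_nil, false_imp_iff, implies_true, and_true] at hl hu
  obtain ⟨h77, h78⟩ := hl
  obtain ⟨h79, h80⟩ := hu
  refine ⟨t0, t1, t2, t3, t4, t5, t6, t7, t8, t9, t10, ?_, ?_, ?_, ?_, ?_, ?_, ?_, ?_, ?_, ?_, ?_,
    ?_, ?_, ?_, ?_, ?_, ?_, ?_, ?_, ?_, ?_, ?_, ?_, ?_⟩ <;> linarith

/-- The indices of the generators that form a basis of their span. -/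
def basisIndex : Fin 13 → Fin 20 ⊕ Fin 4 :=
  ![.inl 0, .inl 2, .inl 8, .inl 9, .inl 11, .inl 14, .inl 17, .inl 18, .inl 19,
    .inr 0, .inr 1, .inr 2, .inr 3]

/-- The indices of the other generators. -/
def otherIndex : Fin 11 → Fin 20 ⊕ Fin 4 :=
  ![.inl 4, .inl 3, .inl 1, .inl 5, .inl 7, .inl 6, .inl 10, .inl 12, .inl 13, .inl 15, .inl 16]

/-- The coefficients of the other generators with respect to the basis. -/
def relation : Matrix (Fin 11) (Fin 13) ℤ :=
  !![0, 0, -1, 0, -1, 1, 0, -1, 0, 0, 1, 0, 0;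
    0, 1, 0, 1, 0, 0, -1, -1, 0, -1, 0, 0, 1;
    0, 1, 0, 0, 1, -1, 0, 0, 0, 0, 0, 0, 0;
    0, 0, 0, 0, -1, 1, -1, -1, 0, 0, 0, 0, 1;
    0, 0, 0, 1, 0, 1, -1, -1, 0, -1, 0, 0, 1;
    0, 0, 0, 0, 0, 1, -1, 0, 0, -1, 0, 0, 1;
    0, 0, 0, 0, 1, 0, -1, 0, 0, -1, 0, 0, 1;
    0, 0, 0, 0, 0, 0, 1, 0, 0, 0, 0, 1, -1;
    0, 0, 0, 0, 0, 0, 1, 0, 1, 1, 0, 0, -1;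
    0, 0, 0, 0, 0, 0, 1, 1, 0, 1, 0, 0, -1;
    0, 0, 0, 0, 0, 0, 1, 0, 0, 0, 1, 0, -1]

/-- The sets `S ⊆ [1, 6]` without elements `s` such that `s + 1 ∈ S ∪ {7}`. -/
def sparseLists : Fin 13 → List ℕ :=
  ![[], [1], [2], [3], [4], [5], [1, 3], [1, 4], [1, 5], [2, 4], [2, 5], [3, 5], [1, 3, 5]]

/-- Eight times the inverse of the matrix of the coordinates of the basis at the sparse sets. -/
def sparseInverse : Matrix (Fin 13) (Fin 13) ℤ :=
  !![8, 0, 0, 0, 0, 0, 0, 0, 0, 0, 0, 0, 0;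
    -8, 4, 0, 0, 0, 0, 0, 0, 0, 0, 0, 0, 0;
    0, 0, 0, -4, 4, 0, 0, 0, 0, 0, 0, 0, 0;
    -8, 4, -4, 4, -4, 4, 0, 0, 0, 0, 0, 0, 0;
    0, 4, -4, -4, 0, 0, 2, 0, 0, 0, 0, 0, 0;
    0, -4, 0, 4, 0, 0, 0, 0, 0, 0, 0, 0, 0;
    8, 0, 0, 0, 0, -4, -2, 0, 0, 0, 2, 0, 0;
    8, 0, 0, -4, 0, -4, 0, 0, 2, 0, -2, 2, 0;
    0, 0, 0, 0, 4, 0, 0, -2, 0, 0, 0, -2, 1;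
    8, -4, 4, -4, 4, -4, 0, -2, 2, 0, 0, 0, 0;
    0, 0, 0, 0, 0, 0, 0, -2, 0, 2, 0, 0, 0;
    0, 0, 0, 4, -4, 0, -2, 2, 0, 0, 0, 0, 0;
    -8, 0, 0, 0, 0, 4, 2, 2, -2, -2, 0, 0, 0]

lemma exists_sparseLists : ∀ S ∈ (Finset.Icc 1 6).powerset, (∀ s ∈ S, s + 1 ∉ insert (6 + 1) S) →
    ∃ k, S = (sparseLists k).toFinset := by
  decide +kernel

lemma sparseLists_valid : ∀ k, (sparseLists k).Nodup ∧
    (sparseLists k).toFinset ⊆ Finset.Icc 1 6 := by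
  decide +kernel

lemma coord_mul_sparseInverse : ∀ i k,
    ∑ l, hitNumber (generatorLists (basisIndex l)) (sparseLists i) * sparseInverse l k =
      if i = k then 8 else 0 := by
  decide +kernel

/-- Solutions of the relations are determined by the 13 coordinates at sparse sets, and the 13
chosen generators have an invertible coordinate matrix there. -/
lemma exists_basis_sum {v : FlagSpace 6} (hv : v ∈ dehnSommervilleSpace 6) :
    ∃ b : Fin 13 → ℝ, v = ∑ l, b l • generator (basisIndex l) := by
  let c : Fin 13 → ℝ := fun k => coord v (sparseLists k).toFinset
  -- The division by 8 compensates for the integral multiple of the inverse matrix.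
  let b : Fin 13 → ℝ := fun l => (∑ k, sparseInverse l k * c k) / 8
  refine ⟨b, ?_⟩
  set w := ∑ l, b l • generator (basisIndex l) with hw
  have hwW : w ∈ dehnSommervilleSpace 6 := Submodule.sum_mem _ fun l _ =>
    Submodule.smul_mem _ _ (generator_mem_dehnSommervilleSpace _)
  have hd : IsDehnSommerville 6 (coord (v - w)) := Submodule.sub_mem _ hv hwW
  have hsub : ∀ S, coord (v - w) S = coord v S - coord w S := fun S => (coordForm 6 S).map_sub v w
  have hcw : ∀ i, coord w (sparseLists i).toFinset = c i := fun i => by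
    obtain ⟨h1, h2⟩ := sparseLists_valid i
    have e1 : coord w (sparseLists i).toFinset =
        ∑ l, b l * coord (generator (basisIndex l)) (sparseLists i).toFinset := by
      change coordForm 6 _ w = ∑ l, b l * coordForm 6 _ _
      rw [hw, map_sum]
      simp
    have e2 : ∀ l, coord (generator (basisIndex l)) (sparseLists i).toFinset =
        hitNumber (generatorLists (basisIndex l)) (sparseLists i) := fun l => coord_limitSum _ h1 h2
    have e3 : ∀ k, (∑ l, (hitNumber (generatorLists (basisIndex l)) (sparseLists i) : ℝ) *
        sparseInverse l k) = if i = k then 8 else 0 := fun k => by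
      exact_mod_cast coord_mul_sparseInverse i k
    simp only [e1, e2, b, Finset.sum_div, Finset.sum_mul]
    rw [Finset.sum_comm]
    calc _ = ∑ k, (∑ l, (hitNumber (generatorLists (basisIndex l)) (sparseLists i) : ℝ) *
          sparseInverse l k) * (c k / 8) := by
          refine Finset.sum_congr rfl fun k _ => ?_
          rw [Finset.sum_mul]
          exact Finset.sum_congr rfl fun l _ => by ring
      _ = c i := by
          simp only [e3, ite_mul, zero_mul, Finset.sum_ite_eq, Finset.mem_univ, if_true]
          ring
  -- The difference satisfies the Dehn-Sommerville relations and vanishes at all sparse sets, hence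
  -- everywhere.
  have h0 : ∀ S ⊆ Finset.Icc 1 6, coord (v - w) S = 0 := fun S hS =>
    hd.eq_zero (fun S hS hs => by
      obtain ⟨k, rfl⟩ := exists_sparseLists S (Finset.mem_powerset.mpr hS) hs
      rw [hsub, hcw, sub_self]) hS
  refine sub_eq_zero.mp (funext fun S => ?_)
  exact (coord_mk (v - w) S).symm.trans (h0 S (Finset.mem_powerset.mp S.2))

lemma hitNumber_relation : ∀ m, ∀ L ∈ [1, 2, 3, 4, 5, 6].sublists,
    hitNumber (generatorLists (otherIndex m)) L =
      ∑ l, relation m l * hitNumber (generatorLists (basisIndex l)) L := by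
  decide +kernel

lemma generator_relation (m : Fin 11) :
    generator (otherIndex m) = ∑ l, (relation m l : ℝ) • generator (basisIndex l) := by
  ext S
  let L := [1, 2, 3, 4, 5, 6].filter (· ∈ (S : Finset ℕ))
  have hS := Finset.mem_powerset.mp S.2
  have hL : L.toFinset = S := by
    ext s
    have := @hS s
    rw [Finset.mem_Icc] at this
    simp only [L, List.mem_toFinset, List.mem_filter, decide_eq_true_eq, List.mem_cons,
      List.not_mem_nil, or_false]
    exact ⟨fun h => h.2, fun h => ⟨by have := this h; omega, h⟩⟩
  have hn : L.Nodup := List.Nodup.filter _ (by decide)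
  have h : ∀ j, generator j S = hitNumber (generatorLists j) L := fun j => by
    have := coord_limitSum (generatorLists j) hn (hL ▸ hS)
    rw [hL] at this
    exact (coord_mk (generator j) S).symm.trans this
  have key := hitNumber_relation m L (List.mem_sublists.mpr List.filter_sublist)
  simp only [Finset.sum_apply, Pi.smul_apply, smul_eq_mul, h, key]
  push_cast
  rfl

/-- The values of the inequalities at the basis. -/
def basisSlack : (Fin 15 ⊕ Fin 4) ⊕ Fin 4 → Fin 13 → ℤ :=
  Sum.elim (Sum.elim
    ![
      ![0, 0, 0, 0, 0, 0, 0, 32, 32, 0, 32, 32, 32],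
      ![0, 8, 0, 0, 0, 8, 0, 8, 0, 0, 0, 0, 0],
      ![0, 0, 8, 0, 0, 0, 0, 0, 0, 0, 8, 0, 0],
      ![0, 0, 0, 0, 0, 0, 0, 0, 0, 0, 0, 16, 0],
      ![0, 0, 0, 0, 0, 0, 0, 0, 16, 0, 0, 0, 0],
      ![0, 0, 0, 0, 0, 0, 0, 0, 0, 0, 8, 0, 0],
      ![0, 0, 0, 0, 0, 0, 16, 0, 0, 0, 0, 0, 16],
      ![0, 0, 0, 0, 8, 8, 0, 0, 0, 0, 0, 0, 0],
      ![0, 0, 4, 0, 0, 0, 0, 0, 0, 4, 4, 4, 4],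
      ![0, 0, 0, 4, 0, 0, 0, 4, 0, 4, 4, 4, 4],
      ![0, 0, 0, 0, 4, 0, 0, 0, 0, 4, 4, 4, 4],
      ![0, 0, 0, 0, 0, 0, 0, 0, 0, 4, 4, 4, 4],
      ![1, 0, 0, 0, 0, 0, 0, 0, 0, 0, 0, 0, 0],
      ![0, 2, 0, 0, 0, 0, 0, 0, 0, 0, 0, 0, 0],
      ![0, 0, 0, 2, 0, 0, 0, 0, 0, 0, 0, 0, 0]]
    ![
      ![0, 4, 0, 0, 4, 4, 0, 0, 0, 4, 0, 0, 0],
      ![0, 0, 0, 4, 4, 4, 0, 0, 0, 4, 0, 0, 0],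
      ![0, 2, 0, 0, 0, 2, 0, 0, 0, 0, 0, 0, 0],
      ![0, 2, 2, 0, 0, 2, 0, 0, 0, 0, 0, 0, 0]])
    ![
      ![0, 4, 0, 0, 4, 8, 0, 0, 0, 4, 0, 0, 0],
      ![0, 4, 4, 0, 4, 8, 0, 0, 0, 4, 0, 0, 0],
      ![0, 4, 0, 0, 4, 8, 4, 0, 0, 0, 0, 0, 0],
      ![0, 4, 4, 0, 4, 8, 4, 0, 0, 0, 0, 0, 0]]

lemma slack_basisIndex : ∀ i l, slack i (basisIndex l) = basisSlack i l := by decide +kernel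

/-- The coefficients of a point in the basis may be negative. The eleven relations allow replacing
combinations of basis vectors by other generators, with weights `t m`, until all coefficients are
nonnegative. -/
lemma facetCone_le_hull : facetCone ≤ PointedCone.hull ℝ (Set.range generator) := by
  intro v hv
  obtain ⟨hW, hφ⟩ := mem_facetCone.mp hv
  obtain ⟨b, rfl⟩ := exists_basis_sum hW
  -- The 23 inequalities in terms of the basis coefficients; up to positive factors they are the
  -- hypotheses of `exists_coefficients`.
  have hs : ∀ i, 0 ≤ ∑ l, b l * (slack i (basisIndex l) : ℝ) := fun i => by
    have := hφ i
    rw [map_sum] at this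
    simpa only [map_smul, smul_eq_mul, facetLinear_generator] using this
  obtain ⟨t, ht, htb⟩ : ∃ t : Fin 11 → ℝ, (∀ m, 0 ≤ t m) ∧
      ∀ l, 0 ≤ b l - ∑ m, t m * relation m l := by
    simp only [slack_basisIndex] at hs
    simp only [Sum.forall, Fin.forall_fin_succ, Fin.sum_univ_succ, basisSlack] at hs
    simp at hs
    obtain ⟨⟨⟨h0, h1, h2, h3, h4, h5, h6, h7, h8, h9, h10, h11, h12, h13, h14⟩,
      h15, h16, h17, h18⟩, h19, h20, h21, h22⟩ := hs
    obtain ⟨t0, t1, t2, t3, t4, t5, t6, t7, t8, t9, t10, ht⟩ := exists_coefficients (b0 := b 0)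
      (b1 := b 1) (b2 := b 2) (b3 := b 3) (b4 := b 4) (b5 := b 5) (b6 := b 6) (b7 := b 7) (b8 := b
      8) (b9 := b 9) (b10 := b 10) (b11 := b 11) (b12 := b 12) (by linarith only [h0]) (by linarith
      only [h1]) (by linarith only [h2]) (by linarith only [h3]) (by linarith only [h4]) (by
      linarith only [h5]) (by linarith only [h6]) (by linarith only [h7]) (by linarith only [h8])
      (by linarith only [h9]) (by linarith only [h10]) (by linarith only [h11]) (by linarith only
      [h12]) (by linarith only [h13]) (by linarith only [h14]) (by linarith only [h15]) (by linarith
      only [h16]) (by linarith only [h17]) (by linarith only [h18]) (by linarith only [h19]) (by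
      linarith only [h20]) (by linarith only [h21]) (by linarith only [h22])
    refine ⟨![t0, t1, t2, t3, t4, t5, t6, t7, t8, t9, t10], ?_, ?_⟩
    · simp only [Fin.forall_fin_succ]
      simp [ht]
    · simp only [Fin.forall_fin_succ, Fin.sum_univ_succ, relation]
      simp
      refine ⟨?_, ?_, ?_, ?_, ?_, ?_, ?_, ?_, ?_, ?_, ?_, ?_, ?_⟩ <;> linarith
  have e : ∑ l, b l • generator (basisIndex l) =
      ∑ l, (b l - ∑ m, t m * relation m l) • generator (basisIndex l) +
        ∑ m, t m • generator (otherIndex m) := by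
    simp only [generator_relation, sub_smul, Finset.sum_sub_distrib, Finset.sum_smul,
      Finset.smul_sum, smul_smul]
    rw [Finset.sum_comm (s := (Finset.univ : Finset (Fin 11))), sub_add_cancel]
  rw [e]
  refine Submodule.add_mem _ (Submodule.sum_mem _ fun l _ => ?_) (Submodule.sum_mem _ fun m _ => ?_)
  · exact PointedCone.smul_mem _ (htb l) (Submodule.subset_span ⟨_, rfl⟩)
  · exact PointedCone.smul_mem _ (ht m) (Submodule.subset_span ⟨_, rfl⟩)

/-! ### The double description -/

lemma hull_generator_le : PointedCone.hull ℝ (Set.range generator) ≤ eulerianCone 6 := by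
  refine Submodule.span_le.mpr ?_
  rintro _ ⟨j, rfl⟩
  exact generator_mem_eulerianCone j

/-- The hull of the generators, the closed cone and `facetCone` form a cycle of inclusions, so all
three coincide. -/
lemma doubleDescription_eulerianCone :
    DoubleDescription (eulerianCone 6) (dehnSommervilleSpace 6) generator facetLinear where
  mem_iff_sum v := by
    constructor
    · intro hv
      obtain ⟨a, rfl⟩ := (Submodule.mem_span_range_iff_exists_fun _).mp
        (facetCone_le_hull (eulerianCone_le_facetCone hv))
      exact ⟨fun j => a j, fun j => (a j).2, rfl⟩
    · rintro ⟨a, ha, rfl⟩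
      exact Submodule.sum_mem _ fun j _ =>
        PointedCone.smul_mem _ (ha j) (generator_mem_eulerianCone j)
  mem_iff_forms v := ⟨fun hv => mem_facetCone.mp (eulerianCone_le_facetCone hv),
    fun hv => hull_generator_le (facetCone_le_hull (mem_facetCone.mpr hv))⟩
  sep_rays j k h := by
    obtain ⟨i, h1, h2⟩ := slack_sep_rays j k h
    exact ⟨i, by rw [facetLinear_generator, h1, Int.cast_zero],
      by rw [facetLinear_generator]; exact_mod_cast h2⟩
  sep_forms i k h := by
    obtain ⟨j, h1, h2⟩ := slack_sep_forms i k h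
    exact ⟨j, by rw [facetLinear_generator, h1, Int.cast_zero],
      by rw [facetLinear_generator]; exact_mod_cast h2⟩

/-! ### The facets given by the three kinds of inequalities -/

instance : Nontrivial ((Fin 15 ⊕ Fin 4) ⊕ Fin 4) := ⟨.inl (.inl 0), .inr 0, Sum.inl_ne_inr⟩

/-- The `i`-th facet. -/
noncomputable def facet (i : (Fin 15 ⊕ Fin 4) ⊕ Fin 4) : PointedCone ℝ (FlagSpace 6) :=
  zeroFace (eulerianCone 6) (facetLinear i)

lemma facet_injective : Function.Injective facet :=
  doubleDescription_eulerianCone.zeroFace_injective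

/-- The indices of the generators. -/
def generatorIndices : List (Fin 20 ⊕ Fin 4) :=
  (List.finRange 20).map .inl ++ (List.finRange 4).map .inr

lemma mem_generatorIndices (j : Fin 20 ⊕ Fin 4) : j ∈ generatorIndices := by
  rcases j with j | j <;> simp [generatorIndices]

/-- Whether the form with the values `f` at the generators vanishes at the same generators as the
`i`-th inequality. -/
def sameZeros (f : Fin 20 ⊕ Fin 4 → ℤ) (i : (Fin 15 ⊕ Fin 4) ⊕ Fin 4) : Bool :=
  generatorIndices.all fun j => (f j == 0) == (slack i j == 0)

lemma sameZeros_iff {f : Fin 20 ⊕ Fin 4 → ℤ} {i : (Fin 15 ⊕ Fin 4) ⊕ Fin 4} :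
    sameZeros f i ↔ ∀ j, f j = 0 ↔ slack i j = 0 := by
  simp only [sameZeros, List.all_eq_true, mem_generatorIndices, forall_true_left]
  refine forall_congr' fun j => ?_
  rw [beq_iff_eq, Bool.eq_iff_iff, beq_iff_eq, beq_iff_eq]

/-- This excludes unexpected facets: a form giving a facet shows up as one of the 23 zero patterns
in an integer table. The converse `isFacetGivenBy_facet` also needs nonnegative entries. -/
lemma exists_facet_of_isFacetGivenBy {F : PointedCone ℝ (FlagSpace 6)} {ψ : FlagSpace 6 → ℝ}
    {f : Fin 20 ⊕ Fin 4 → ℤ} {c : ℝ} (hc : c ≠ 0) (hf : ∀ j, ψ (generator j) = c * f j)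
    (h : IsFacetGivenBy (eulerianCone 6) F ψ) : ∃ i, F = facet i ∧ sameZeros f i := by
  obtain ⟨i, rfl, hi⟩ := doubleDescription_eulerianCone.exists_of_isFacetGivenBy h
  refine ⟨i, rfl, sameZeros_iff.mpr fun j => ?_⟩
  have := hi j
  rw [hf, facetLinear_generator] at this
  simpa [hc] using this

lemma isFacetGivenBy_facet {ψ : FlagSpace 6 →ₗ[ℝ] ℝ} {f : Fin 20 ⊕ Fin 4 → ℤ} {c : ℝ}
    (hc : 0 < c) (hf : ∀ j, ψ (generator j) = c * f j) {i : (Fin 15 ⊕ Fin 4) ⊕ Fin 4}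
    (hn : ∀ j, 0 ≤ f j) (h : sameZeros f i) : IsFacetGivenBy (eulerianCone 6) (facet i) ψ := by
  refine doubleDescription_eulerianCone.isFacetGivenBy (fun j => ?_) fun j => ?_
  · rw [hf]
    exact mul_nonneg hc.le (by exact_mod_cast hn j)
  · rw [hf, facetLinear_generator]
    simpa [hc.ne'] using sameZeros_iff.mp h j

lemma isFacetGivenBy_facetLinear (i : (Fin 15 ⊕ Fin 4) ⊕ Fin 4) :
    IsFacetGivenBy (eulerianCone 6) (facet i) (facetLinear i) :=
  doubleDescription_eulerianCone.isFacetGivenBy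
    (fun j => doubleDescription_eulerianCone.nonneg i (generator_mem_eulerianCone j)) fun _ =>
    Iff.rfl

lemma exists_sublists {T V : Finset ℕ} (hV : V ⊆ Finset.Icc 1 6) (hT : T ⊆ V) :
    ∃ L ∈ [1, 2, 3, 4, 5, 6].sublists, ∃ L' ∈ L.sublists, T = L'.toFinset ∧ V = L.toFinset := by
  have e : V = ([1, 2, 3, 4, 5, 6].filter (· ∈ V)).toFinset := by
    ext s
    have := @hV s
    rw [Finset.mem_Icc] at this
    simp only [List.mem_toFinset, List.mem_filter, decide_eq_true_eq, List.mem_cons,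
      List.not_mem_nil, or_false]
    exact ⟨fun h => ⟨by have := this h; omega, h⟩, fun h => h.2⟩
  refine ⟨_, List.mem_sublists.mpr List.filter_sublist, _,
    List.mem_sublists.mpr (List.filter_sublist (p := (· ∈ T))), ?_, e⟩
  ext s
  have := @hT s
  rw [List.mem_toFinset, List.mem_filter, ← List.mem_toFinset, ← e, decide_eq_true_eq]
  tauto

lemma inequalityForm_generator {L L' : List ℕ} (hL : L ∈ [1, 2, 3, 4, 5, 6].sublists)
    (hL' : L' ∈ L.sublists) (j : Fin 20 ⊕ Fin 4) :
    inequalityForm L'.toFinset L.toFinset (generator j) = gapNumber (generatorLists j) L' L := by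
  have h1 := List.mem_sublists.mp hL
  have h2 := List.mem_sublists.mp hL'
  exact inequalityForm_limitSum _ ((h2.trans h1).nodup (by decide)) h2.subset h1.subset

/-! ### The conditions on pairs `(M, V)` as a finite check -/

instance (S : Finset ℕ) (a b : ℕ) : Decidable (IsMaxInterval S a b) :=
  decidable_of_iff (b ∈ S ∧ b + 1 ∉ S ∧ a ≤ b ∧ (a = 0 ∨ a - 1 ∉ S) ∧ Finset.Icc a b ⊆ S) <| by
    constructor
    · rintro ⟨-, h1, h2, h3, h4⟩
      refine ⟨h2, h4, fun c hc => ?_, h1⟩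
      rcases h3 with h3 | h3
      · omega
      · rwa [← hc, Nat.add_sub_cancel] at h3
    · rintro ⟨h1, h2, h3, h4⟩
      refine ⟨h2 (Finset.right_mem_Icc.mpr h1), h4, h1, ?_, h2⟩
      rcases a with _ | a
      · exact Or.inl rfl
      · exact Or.inr (h3 a rfl)

lemma IsMaxInterval.lt {S : Finset ℕ} {a b m : ℕ} (h : IsMaxInterval S a b)
    (hS : ∀ s ∈ S, s < m) : a < m ∧ b < m :=
  have hb := hS b (h.2.1 (Finset.right_mem_Icc.mpr h.1))
  ⟨h.1.trans_lt hb, hb⟩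

lemma forall_isMaxInterval_iff {S : Finset ℕ} {m : ℕ} (hS : ∀ s ∈ S, s < m)
    {p : ℕ → ℕ → Prop} : (∀ a b, IsMaxInterval S a b → p a b) ↔
      ∀ b < m, ∀ a < m, IsMaxInterval S a b → p a b :=
  ⟨fun h b _ a _ => h a b, fun h a b hab => h b (hab.lt hS).2 a (hab.lt hS).1 hab⟩

/-- The conditions of `IsFacetPair` on `V` alone. -/
def IsFacetSupport (V : Finset ℕ) : Prop :=
  (∀ b < 8, ∀ a < 8, IsMaxInterval V a b → 2 ≤ (Finset.Icc a b).card) ∧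
  ∀ b < 8, ∀ a < 8, IsMaxInterval (Finset.Icc 0 7 \ V) a b → (Finset.Icc a b).card ≤ 3

instance (V : Finset ℕ) : Decidable (IsFacetSupport V) := by
  unfold IsFacetSupport; infer_instance

/-- The conditions of `IsFacetPair` on `M` and a maximal interval `[a, b]` of `V`. -/
def IsMarkedInterval (M : Finset ℕ) (a b : ℕ) : Prop :=
  (M ∩ Finset.Icc a b = ∅ ∨ M ∩ Finset.Icc a b = Finset.Icc a (a + 1) ∨
    M ∩ Finset.Icc a b = Finset.Icc (b - 1) b) ∧
  (a ∉ M → a = 1 ∨ ∃ m ∈ M, m + 2 = a) ∧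
  (b ∉ M → b = 6 ∨ b + 2 ∈ M)

instance (M : Finset ℕ) (a b : ℕ) : Decidable (IsMarkedInterval M a b) := by
  unfold IsMarkedInterval; infer_instance

/-- The conditions of `IsFacetPair` on `M` and `V`. -/
def IsFacetMark (M V : Finset ℕ) : Prop :=
  ∀ b < 8, ∀ a < 8, IsMaxInterval V a b → IsMarkedInterval M a b

instance (M V : Finset ℕ) : Decidable (IsFacetMark M V) := by
  unfold IsFacetMark; infer_instance

lemma isFacetPair_iff {M V : Finset ℕ} (hV : V ⊆ Finset.Icc 1 6) (hM : M ⊆ V) :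
    IsFacetPair 6 M V ↔ IsFacetSupport V ∧ IsFacetMark M V := by
  have h1 : ∀ s ∈ V, s < 8 := fun s hs => by
    have := Finset.mem_Icc.mp (hV hs)
    omega
  have h2 : ∀ s ∈ Finset.Icc 0 (6 + 1) \ V, s < 8 := fun s hs => by
    have := Finset.mem_Icc.mp (Finset.mem_sdiff.mp hs).1
    omega
  rw [IsFacetPair, forall_isMaxInterval_iff h1, forall_isMaxInterval_iff h2,
    forall_isMaxInterval_iff h1, IsFacetSupport, IsFacetMark]
  unfold IsMarkedInterval
  tauto

-- Validity is not inherited from `IsEulerian.inequalityForm_nonneg`, since `M` may have two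
-- elements in one maximal interval of `V`. Instead the form is evaluated at all generators: it is
-- nonnegative there and has the zero pattern of one of the first 15 facets.
set_option maxRecDepth 4000 in
lemma exists_sameZeros_of_isFacetMark : ∀ V ∈ [1, 2, 3, 4, 5, 6].sublists,
    IsFacetSupport V.toFinset → ∀ M ∈ V.sublists, IsFacetMark M.toFinset V.toFinset →
      Even M.length ∧ ∃ i : Fin 15,
        (generatorIndices.all fun j =>
          decide (0 ≤ (-1) ^ (M.length / 2) * gapNumber (generatorLists j) M V)) ∧
        sameZeros (fun j => (-1) ^ (M.length / 2) * gapNumber (generatorLists j) M V)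
          (.inl (.inl i)) := by
  decide +kernel


/-- A pair `(M, V)` for each of the facets of the first kind. -/
def pairLists : Fin 15 → List ℕ × List ℕ :=
  ![([3, 4], [3, 4]), ([3, 4], [1, 2, 3, 4]), ([4, 5], [1, 2, 4, 5]), ([1, 2, 4, 5], [1, 2, 4, 5]),
    ([1, 2, 5, 6], [1, 2, 5, 6]), ([2, 3], [2, 3, 5, 6]), ([2, 3, 5, 6], [2, 3, 5, 6]),
    ([3, 4], [3, 4, 5, 6]), ([4, 5], [1, 2, 3, 4, 5]), ([5, 6], [1, 2, 3, 5, 6]),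
    ([1, 2], [1, 2, 4, 5, 6]), ([2, 3], [2, 3, 4, 5, 6]), ([], [1, 2, 3, 4, 5, 6]),
    ([1, 2], [1, 2, 3, 4, 5, 6]), ([5, 6], [1, 2, 3, 4, 5, 6])]

/-- Each of the 15 facets is attained. The singletons of `facetLists` become two-element pieces of
`M` here, with the same zeros on the generators. -/
lemma pairLists_valid : ∀ i, (pairLists i).2 ∈ [1, 2, 3, 4, 5, 6].sublists ∧
    (pairLists i).1 ∈ (pairLists i).2.sublists ∧
    IsFacetSupport (pairLists i).2.toFinset ∧
    IsFacetMark (pairLists i).1.toFinset (pairLists i).2.toFinset ∧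
    sameZeros (fun j => (-1) ^ ((pairLists i).1.length / 2) *
      gapNumber (generatorLists j) (pairLists i).1 (pairLists i).2) (.inl (.inl i)) := by
  decide +kernel

lemma sameZeros_unique {f : Fin 20 ⊕ Fin 4 → ℤ} {i k : (Fin 15 ⊕ Fin 4) ⊕ Fin 4}
    (hi : sameZeros f i) (hk : sameZeros f k) : i = k := by
  by_contra h
  obtain ⟨j, h1, h2⟩ := slack_sep_forms i k h
  rw [← sameZeros_iff.mp hi, sameZeros_iff.mp hk] at h1
  exact h2.ne' h1

/-- The inequality of a facet pair gives one of the facets of the first kind. -/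
lemma isFacetGivenBy_facetForm {V M : List ℕ} (hV : V ∈ [1, 2, 3, 4, 5, 6].sublists)
    (hM : M ∈ V.sublists) (h : IsFacetPair 6 M.toFinset V.toFinset) :
    ∃ i : Fin 15, IsFacetGivenBy (eulerianCone 6) (facet (.inl (.inl i)))
        (facetForm M.toFinset V.toFinset) ∧
      sameZeros (fun j => (-1) ^ (M.length / 2) * gapNumber (generatorLists j) M V)
        (.inl (.inl i)) := by
  have hM' := List.mem_sublists.mp hM
  have hMn : M.Nodup := (hM'.trans (List.mem_sublists.mp hV)).nodup (by decide)
  obtain ⟨hs, hm⟩ := (isFacetPair_iff h.1 h.2.1).mp h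
  obtain ⟨heven, i, hn, hz⟩ := exists_sameZeros_of_isFacetMark V hV hs M hM hm
  refine ⟨i, ?_, hz⟩
  -- The factor from `facetForm_eq` without its sign; it is positive because `|M|` is even.
  let c : ℝ := (-1 / 2) ^ M.length * (1 / 2) ^ (6 - V.toFinset.card)
  have hc : 0 < c := mul_pos (heven.pow_pos (by norm_num)) (by positivity)
  have e : ∀ v, facetForm M.toFinset V.toFinset v =
      c * ((-1) ^ (M.length / 2) * inequalityForm M.toFinset V.toFinset v) := fun v => by
    rw [facetForm_eq h.1 h.2.1, List.toFinset_card_of_nodup hMn]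
    ring
  let ψ := (c * (-1) ^ (M.length / 2)) • inequalityLinear 6 M.toFinset V.toFinset
  have hψ : (ψ : FlagSpace 6 → ℝ) = facetForm M.toFinset V.toFinset := by
    ext v
    rw [e, ← inequalityLinear_apply, ← mul_assoc]
    rfl
  rw [← hψ]
  refine isFacetGivenBy_facet hc (fun j => ?_) (fun j => ?_) hz
  · rw [hψ, e, inequalityForm_generator hV hM]
    push_cast
    rfl
  · exact of_decide_eq_true (List.all_eq_true.mp hn j (mem_generatorIndices j))

lemma IsFacetGivenBy.eq {n : ℕ} {C F F' : PointedCone ℝ (FlagSpace n)} {ψ : FlagSpace n → ℝ}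
    (h : IsFacetGivenBy C F ψ) (h' : IsFacetGivenBy C F' ψ) : F = F' :=
  SetLike.coe_injective (h.2.2.trans h'.2.2.symm)

lemma exists_isFacetGivenBy_facetForm {M V : Finset ℕ} (h : IsFacetPair 6 M V) :
    ∃ i : Fin 15, IsFacetGivenBy (eulerianCone 6) (facet (.inl (.inl i))) (facetForm M V) := by
  obtain ⟨L, hL, L', hL', rfl, rfl⟩ := exists_sublists h.1 h.2.1
  obtain ⟨i, hi, -⟩ := isFacetGivenBy_facetForm hL hL' h
  exact ⟨i, hi⟩

/-- An inequality determines the facet it gives, so every admissible pair lands on one of the 15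
facets, and `pairLists` provides a pair for each. -/
lemma pairFacets_eq : pairFacets 6 = Set.range fun i => facet (.inl (.inl i)) := by
  ext F
  constructor
  · rintro ⟨M, V, h, hF⟩
    obtain ⟨i, hi⟩ := exists_isFacetGivenBy_facetForm h
    exact ⟨i, hi.eq hF⟩
  · rintro ⟨i, rfl⟩
    obtain ⟨h1, h2, h3, h4, h5⟩ := pairLists_valid i
    have hV : (pairLists i).2.toFinset ⊆ Finset.Icc 1 6 := fun s hs => by
      have := (List.mem_sublists.mp h1).subset (List.mem_toFinset.mp hs)
      rw [Finset.mem_Icc]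
      simp at this
      omega
    have hM : (pairLists i).1.toFinset ⊆ (pairLists i).2.toFinset := fun s hs =>
      List.mem_toFinset.mpr ((List.mem_sublists.mp h2).subset (List.mem_toFinset.mp hs))
    have hp := (isFacetPair_iff hV hM).mpr ⟨h3, h4⟩
    obtain ⟨k, hk, hz⟩ := isFacetGivenBy_facetForm h1 h2 hp
    rw [sameZeros_unique hz h5] at hk
    exact ⟨_, _, hp, hk⟩

/-! ### Facets of the second and third kind -/

lemma not_sameZeros_gapNumber : ∀ V ∈ [1, 2, 3, 4, 5, 6].sublists, ∀ T ∈ V.sublists,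
    ∀ i : Fin 4, sameZeros (fun j => gapNumber (generatorLists j) T V) (.inr i) = false := by
  decide +kernel

/-- No pair `T ⊆ V` has the zero pattern of one of the last four facets, so only the first 19 can
occur; the first 15 are removed by the difference. The remaining four have one-element sets `T`, for
which the condition on maximal intervals is automatic. -/
lemma inequalityFacets_eq :
    inequalityFacets 6 \ pairFacets 6 = Set.range fun i => facet (.inl (.inr i)) := by
  rw [pairFacets_eq]
  ext F
  constructor
  · rintro ⟨⟨T, V, h, hF⟩, hn⟩
    obtain ⟨L, hL, L', hL', rfl, rfl⟩ := exists_sublists h.1 h.2.1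
    obtain ⟨i, rfl, hi⟩ := exists_facet_of_isFacetGivenBy one_ne_zero
      (fun j => (inequalityForm_generator hL hL' j).trans (one_mul _).symm) hF
    rcases i with (i | i) | i
    · exact (hn ⟨i, rfl⟩).elim
    · exact ⟨i, rfl⟩
    · rw [not_sameZeros_gapNumber L hL L' hL' i] at hi
      exact absurd hi Bool.false_ne_true
  · rintro ⟨i, rfl⟩
    constructor
    · have h : ∀ i : Fin 4, (facetLists (.inr i)).2.toFinset ⊆ Finset.Icc 1 6 ∧
          (facetLists (.inr i)).1.toFinset ⊆ (facetLists (.inr i)).2.toFinset ∧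
          (facetLists (.inr i)).1.toFinset.card ≤ 1 := by decide +kernel
      obtain ⟨h1, h2, h3⟩ := h i
      refine ⟨_, _, ⟨h1, h2, fun a b _ => (Finset.card_le_card Finset.inter_subset_right).trans h3⟩,
        ?_⟩
      have e : (facetLinear (.inl (.inr i)) : FlagSpace 6 → ℝ) =
          inequalityForm (facetLists (.inr i)).1.toFinset (facetLists (.inr i)).2.toFinset :=
        by
        ext v
        exact inequalityLinear_apply (facetLists (.inr i)).1.toFinset
          (facetLists (.inr i)).2.toFinset v
      rw [← e]
      exact isFacetGivenBy_facetLinear _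
    · rintro ⟨k, hk⟩
      exact Sum.inl_ne_inr (Sum.inl_injective (facet_injective hk))

lemma not_sameZeros_tripleNumber : ∀ i ∈ List.range 7, ∀ j ∈ List.range 7, ∀ k ∈ List.range 7,
    1 ≤ i → i < j → j < k →
    ∀ l : Fin 15 ⊕ Fin 4,
      sameZeros (fun m => tripleNumber (generatorLists m) i j k) (.inl l) = false := by
  decide +kernel

/-- Over all triples in `[1,6]`, no zero pattern equals that of one of the 19 facets of the other
kinds, so a triple giving a facet gives one of the last four. -/
lemma tripleFacets_eq : tripleFacets 6 = Set.range fun i => facet (.inr i) := by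
  ext F
  constructor
  · rintro ⟨i, j, k, hi, hij, hjk, hk, hF⟩
    obtain ⟨l, rfl, hl⟩ := exists_facet_of_isFacetGivenBy one_ne_zero
      (fun m => (tripleForm_limitSum _ hi hij hjk hk).trans (one_mul _).symm) hF
    rcases l with l | l
    · rw [not_sameZeros_tripleNumber i (List.mem_range.mpr (by omega)) j
        (List.mem_range.mpr (by omega)) k (List.mem_range.mpr (by omega)) hi hij hjk l] at hl
      exact absurd hl Bool.false_ne_true
    · exact ⟨l, rfl⟩
  · rintro ⟨i, rfl⟩
    obtain ⟨h1, h2, h3, h4⟩ := facetTriples_valid i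
    refine ⟨_, _, _, h1, h2, h3, h4, ?_⟩
    have e : (facetLinear (.inr i) : FlagSpace 6 → ℝ) =
        tripleForm (facetTriples i).1 (facetTriples i).2.1 (facetTriples i).2.2 := by
      ext v
      exact tripleLinear_apply _ _ _ v
    rw [← e]
    exact isFacetGivenBy_facetLinear _

/-! ### Assembly of the rays and facets -/

lemma setOf_ray_eq : {R | ∃ 𝓘, IsEvenIntervalSystem 6 𝓘 ∧ R = ray (limitVector 6 𝓘)} =
    Set.range fun j => ray (generator (.inl j)) := by
  ext R
  constructor
  · rintro ⟨𝓘, h𝓘, rfl⟩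
    obtain ⟨l, hl, rfl⟩ := exists_evenSystems h𝓘
    obtain ⟨j, hj, rfl⟩ := List.getElem_of_mem hl
    exact ⟨⟨j, hj⟩, congrArg ray (generator_inl ⟨j, hj⟩)⟩
  · rintro ⟨j, rfl⟩
    exact ⟨_, isEvenIntervalSystem_evenSystems _ (List.getElem_mem _),
      congrArg ray (generator_inl j)⟩

lemma ncard_range_of_injective {α β : Type*} [Fintype α] {f : α → β} (hf : Function.Injective f) :
    (Set.range f).ncard = Fintype.card α := by
  rw [← Set.image_univ, Set.ncard_image_of_injective _ hf, Set.ncard_univ, Nat.card_eq_fintype_card]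

theorem mainTheorem6 :
    ∃ (v : Finset (ℕ × ℕ) → FlagSpace 6) (w : Fin 4 → FlagSpace 6),
      -- `v 𝓘` is the flag vector of the doubled limit poset `D P(6, 𝓘)`
      (∀ 𝓘, IsIntervalSystem 6 𝓘 → IsDoubledLimitFlagVector 6 𝓘 (v 𝓘)) ∧
      -- `w m` is the limit of the normalized flag vectors of the doubles of the `m`-th sequence of
      -- glued half-Eulerian posets, and the sum of the flag vectors of doubled limit posets
      (∀ m N, (gluedPoset N m).totalRank = 7 ∧ (gluedPoset N m).IsHalfEulerian) ∧
      (∀ m, Tendsto (fun N : ℕ+ => (((N : ℕ) : ℝ) ^ gluedExponent m)⁻¹ •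
        flagVector 6 (gluedPoset N m).double) atTop (𝓝 (w m))) ∧
      (∀ m, w m = ∑ 𝓘 ∈ gluedSystems m, v 𝓘) ∧
      -- (i) finite generation and the 24 = 20 + 4 extreme rays
      (eulerianCone 6).FG ∧
      {R | IsExtremeRay (eulerianCone 6) R}.ncard = 24 ∧
      {R | ∃ 𝓘, IsEvenIntervalSystem 6 𝓘 ∧ R = ray (v 𝓘)}.ncard = 20 ∧
      (Set.range fun m => ray (w m)).ncard = 4 ∧
      {R | IsExtremeRay (eulerianCone 6) R} =
        {R | ∃ 𝓘, IsEvenIntervalSystem 6 𝓘 ∧ R = ray (v 𝓘)} ∪ Set.range (fun m => ray (w m)) ∧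
      -- (ii) the 23 = 15 + 4 + 4 facets
      {F | IsFacet (eulerianCone 6) F}.ncard = 23 ∧
      (∀ M V, IsFacetPair 6 M V →
        ∃ F, IsFacetGivenBy (eulerianCone 6) F (facetForm M V)) ∧
      (pairFacets 6).ncard = 15 ∧
      (inequalityFacets 6 \ pairFacets 6).ncard = 4 ∧
      (tripleFacets 6).ncard = 4 ∧
      Disjoint (tripleFacets 6) (pairFacets 6 ∪ inequalityFacets 6) ∧
      {F | IsFacet (eulerianCone 6) F} =
        pairFacets 6 ∪ inequalityFacets 6 ∪ tripleFacets 6 := by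
  have hray : Function.Injective fun j => ray (generator j) :=
    doubleDescription_eulerianCone.ray_injective
  have hrays : {R | IsExtremeRay (eulerianCone 6) R} = Set.range fun j => ray (generator j) :=
    haveI : Nontrivial (Fin 20 ⊕ Fin 4) := ⟨.inl 0, .inr 0, Sum.inl_ne_inr⟩
    doubleDescription_eulerianCone.extremeRays
  have hfacets : {F | IsFacet (eulerianCone 6) F} = Set.range facet :=
    doubleDescription_eulerianCone.facets
  have hsum : ∀ {α β γ : Type} (f : α ⊕ β → γ),
      Set.range f = Set.range (fun i => f (.inl i)) ∪ Set.range fun i => f (.inr i) := fun f => by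
    ext
    simp
  refine ⟨limitVector 6, fun m => limitSum 6 (gluedLists m),
    fun 𝓘 h => isDoubledLimitFlagVector_limitVector h,
    fun m N => ⟨gluedPoset_totalRank N m, gluedPoset_isHalfEulerian N m⟩, gluedPoset_tendsto,
    limitSum_gluedLists, doubleDescription_eulerianCone.fg, ?_, ?_, ?_, ?_, ?_,
    fun M V h => (exists_isFacetGivenBy_facetForm h).imp' _ fun i hi => hi, ?_, ?_, ?_, ?_, ?_⟩
  · rw [hrays, ncard_range_of_injective hray]
    rfl
  · rw [setOf_ray_eq]
    exact (ncard_range_of_injective (hray.comp Sum.inl_injective)).trans rfl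
  · exact (ncard_range_of_injective (hray.comp Sum.inr_injective)).trans rfl
  · rw [hrays, setOf_ray_eq, hsum]
    rfl
  · rw [hfacets, ncard_range_of_injective facet_injective]
    rfl
  · rw [pairFacets_eq]
    exact (ncard_range_of_injective
      ((facet_injective.comp Sum.inl_injective).comp Sum.inl_injective)).trans rfl
  · rw [inequalityFacets_eq]
    exact (ncard_range_of_injective
      ((facet_injective.comp Sum.inl_injective).comp Sum.inr_injective)).trans rfl
  · rw [tripleFacets_eq]
    exact (ncard_range_of_injective (facet_injective.comp Sum.inr_injective)).trans rfl
  -- Only the difference `inequalityFacets 6 \ pairFacets 6` has been indexed, so the union is first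
  -- rewritten with it; disjointness is then injectivity of `facet`.
  · rw [← Set.union_sdiff_self, pairFacets_eq, tripleFacets_eq, Set.disjoint_union_right,
      ← pairFacets_eq, inequalityFacets_eq, pairFacets_eq]
    constructor <;>
    · rw [Set.disjoint_left]
      rintro _ ⟨i, rfl⟩ ⟨k, hk⟩
      exact Sum.inl_ne_inr (facet_injective hk)
  · rw [hfacets, ← Set.union_sdiff_self (s := pairFacets 6) (t := inequalityFacets 6),
      inequalityFacets_eq, pairFacets_eq, tripleFacets_eq, hsum, hsum fun i => facet (.inl i)]
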